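/- **Setting.** Let $\mathfrak r$ be a finite index set, $r=|\mathfrak r|$, and let ${\bf\Omega}=({\bf\Omega}_i)_{i\in\mathfrak r}$ be finite probability spaces in which every subset is measurable. For vertex sets $(X_i)_{i\in\mathfrak r}$ and $I\subset\mathfrak r$, an index-$I$ edge is a set with exactly one vertex in each $X_i$, $i\in I$, and no others; $X_I$ is the set of these edges, and $e|_J$ is the restriction of $e$ to an index set $J\subset I$. A *$k$-bound colored $\mathfrak r$-partite hypergraph* $H$ on $(X_i)$ colors every edge $e\in X_I$, $1\le|I|\le k$, with a color $H(e)$ in a finite set ${\rm C}_I(H)$. A *complex* is such a hypergraph in which, for each $I$, at most one color is called invisible, and in which every edge containing an invisible edge is invisible; the other edges are visible, and $\mathbb V(S)$ denotes the set of visible edges of a complex $S$. The visible index-$I$ colors of all complexes below are index-$I$ colors of a given hypergraph ${\bf G}$ on ${\bf\Omega}$. A *partitionwise map* $\varphi$ from $(W_i)$ to $(U_i)$ maps each $W_i$ into $U_i$; $\Phi(W)$ is the set of partitionwise maps from $W$ to ${\bf\Omega}$. A *random* $\varphi\in\Phi(W)$ maps the vertices independently, each $w\in W_i$ according to ${\bf\Omega}_i$.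 For a complex $S$ we say that $\varphi$ *embeds* $S$ in $H$, written $S\stackrel{\varphi}{\hookrightarrow}H$, if $S(e)=H(\varphi(e))$ for all $e\in\mathbb V(S)$ (and $\varphi(e)$ is visible, if $H$ is a complex). For a visible index-$I$ edge $e$ of a complex $S$, the *relative density* is $${\bf d}_{\bf G}(S\langle e\rangle)=\mathbb P_{{\bf e}\in{\bf\Omega}_I}\big[{\bf G}({\bf e})=S(e)\,\big|\,{\bf G}({\bf e}|_J)=S(e|_J)\ \forall\,\emptyset\ne J\subsetneq I\big],$$ taken to be $0$ if the condition has probability $0$. For a positive integer $D$, a *$D$-blowup* of a complex $S$ is a $k$-bound complex $B$ on finitely many vertices that some partitionwise map embeds in $S$, such that every $v\in V(B)$ has at most $D$ vertices $w\neq v$ for which $\{v,w\}$ is a visible edge of $B$. For $u\in V(B)$, $B\setminus u$ is $B$ with $u$ and all edges containing $u$ deleted. **Lemma (Counting Lemma for Blowups).** Let $k,\Delta$ be positive integers and let $0<\varepsilon\le1$. There exist functions $\eta_i:(0,1)\to(0,\varepsilon)$, $i=1,\dots,k$ (depending only on $k,\Delta,\varepsilon$), such that the following holds for all reals $0<\rho_1\le\rho_2\le\dots\le\rho_k<1$;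 write $\eta_i=\eta_i(\rho_i)$. Let $r\ge k$ and $h\geq 1$ be integers, let ${\bf\Omega}=({\bf\Omega}_i)_{i\in\mathfrak r}$ be as above, and let ${\bf G}$ be a $k$-bound colored $\mathfrak r$-partite hypergraph on ${\bf\Omega}$ with $|{\rm C}_I({\bf G})|\le1/\rho_{|I|}$ for all $I$ with $1\le |I|\le k$. Let $S$ be a $k$-bound complex with exactly $h$ vertices in each of its $r$ vertex sets whose visible index-$I$ colors are index-$I$ colors of ${\bf G}$. Suppose that for every $2\Delta$-blowup $S'$ of $S$ with $|V(S')|\le2\Delta^{2k}$ there are numbers $t_e$, $e\in\mathbb V(S')$, with $$\mathbb P_{\phi\in\Phi(V(S'))}\big[S'\stackrel{\phi}{\hookrightarrow}{\bf G}\big]=\prod_{e\in\mathbb V(S')}t_e,\qquad \max\{0,(1-\eta_{|e|}){\bf d}_{\bf G}(S'\langle e\rangle)\}\le t_e\le\min\{1,(1+\eta_{|e|}){\bf d}_{\bf G}(S'\langle e\rangle)\},$$ and suppose that ${\bf d}_{\bf G}(S\langle e\rangle)>\rho_{|e|}$ for all $e\in\mathbb V(S)$. Then for every $\Delta$-blowup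 $B$ of $S$ and every vertex $u\in V(B)$, $$\mathbb E_{\varphi\in\Phi(B\setminus u)}\Big[\,\mathbb P_{\phi\in\Phi(\{u\})}\big[B\stackrel{\varphi\dot\cup\phi}{\hookrightarrow}{\bf G}\big]\ \Big|\ B\setminus u\stackrel{\varphi}{\hookrightarrow}{\bf G}\Big]\ \ge\ \big(1-\eta_k^{1/4}\big)\prod_{e\in\mathbb V(B):\,u\in e}{\bf d}_{\bf G}(B\langle e\rangle),$$ where the left-hand side is read as $0$ if the condition has probability $0$. -/

import Mathlib

open MeasureTheory ProbabilityTheory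

universe u v w x y

noncomputable section

namespace BlowupCounting

/-- The index sets of a `k`-bound `ι`-partite hypergraph: the subsets `I` of `ι` with
`1 ≤ |I| ≤ k`. -/
def Idx (ι : Type u) (k : ℕ) : Type u :=
  {I : Finset ι // I.Nonempty ∧ I.card ≤ k}

namespace Idx

variable {ι : Type u} {k : ℕ}

/-- The size of an index set. -/
def size (I : Idx ι k) : ℕ := I.1.card

instance [Finite ι] : Finite (Idx ι k) :=
  inferInstanceAs (Finite {I : Finset ι // I.Nonempty ∧ I.card ≤ k})

end Idx

variable {ι : Type u} {k : ℕ}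

/-- Index-`I` edges over the vertex sets `X i`: an edge has exactly one vertex in each `X i` with
`i ∈ I`, and is recorded by the function that picks this vertex. -/
abbrev Edge (X : ι → Type v) (I : Idx ι k) : Type (max u v) :=
  (i : I.1) → X i

/-- The restriction `e|_J` of an index-`I` edge to `J ⊆ I`. -/
def Edge.restrict {X : ι → Type v} {I J : Idx ι k} (h : J.1 ⊆ I.1) (e : Edge X I) : Edge X J :=
  fun j => e ⟨j.1, h j.2⟩

/-- The vertices: the disjoint union of the vertex sets. -/
abbrev Vert (X : ι → Type v) : Type (max u v) := (i : ι) × X i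

/-- Partitionwise maps from the vertex sets `W i` to the vertex sets `X i`. -/
abbrev PartMap (W : ι → Type v) (X : ι → Type w) : Type (max u v w) :=
  (a : Vert W) → X a.1

/-- The image `φ(e)` of an edge under a partitionwise map. -/
def PartMap.mapEdge {W : ι → Type v} {X : ι → Type w} (φ : PartMap W X) {I : Idx ι k}
    (e : Edge W I) : Edge X I :=
  fun i => φ ⟨i.1, e i⟩

/-- A `k`-bound colored `ι`-partite hypergraph on the vertex sets `X i`, whose index-`I` edges are
colored by the elements of `C I`. -/
structure ColoredGraph (k : ℕ) (C : Idx ι k → Type x) (X : ι → Type v) where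
  /-- the color of an edge -/
  color : (I : Idx ι k) → Edge X I → C I

/-- A `k`-bound (simplicial) complex whose visible index-`I` colors are elements of `C I`; the
invisible color is `none`.  An edge that contains an invisible edge is invisible. -/
structure ColoredComplex (k : ℕ) (C : Idx ι k → Type x) (W : ι → Type v) extends
    ColoredGraph k (fun I => Option (C I)) W where
  /-- every face of a visible edge is visible -/
  visible_restrict : ∀ (I J : Idx ι k) (h : J.1 ⊆ I.1) (e : Edge W I),
    (color I e).isSome → (color J (e.restrict h)).isSome

section Probability

variable [Fintype ι] {Ω : ι → Type w} [∀ i, MeasurableSpace (Ω i)]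

/-- The law of a random partitionwise map: every vertex in `W i` is mapped to `Ω i` with law `μ i`,
independently of the other vertices. -/
def randomMap (μ : (i : ι) → Measure (Ω i)) (W : ι → Type v) [∀ i, Fintype (W i)] :
    Measure (PartMap W Ω) :=
  Measure.pi fun a : Vert W => μ a.1

/-- The law of a random index-`I` edge. -/
def randomEdge (μ : (i : ι) → Measure (Ω i)) (I : Idx ι k) : Measure (Edge Ω I) :=
  Measure.pi fun i : I.1 => μ i

/-- The relative density of the total color `c = (c_J)_{J ⊆ I}` in `G`: the conditional probability
that a random index-`I` edge has color `c_I`, given that its frame color is `(c_J)_{J ⊊ I}`. -/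
def ColoredGraph.relDensity {C : Idx ι k → Type x} (G : ColoredGraph k C Ω)
    (μ : (i : ι) → Measure (Ω i)) (I : Idx ι k) (c : (J : Idx ι k) → J.1 ⊆ I.1 → C J) : ℝ :=
  (cond (randomEdge μ I)
    {e | ∀ (J : Idx ι k) (h : J.1 ⊂ I.1), G.color J (e.restrict h.1) = c J h.1}).real
    {e | G.color I e = c I subset_rfl}

end Probability

namespace ColoredComplex

variable {C : Idx ι k → Type x} {W : ι → Type v}

/-- The set of visible edges of all sizes. -/
def VisibleEdge (B : ColoredComplex k C W) : Type (max u v) :=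
  {e : (I : Idx ι k) × Edge W I // (B.color e.1 e.2).isSome}

instance [Finite ι] [∀ i, Finite (W i)] (B : ColoredComplex k C W) : Finite B.VisibleEdge :=
  inferInstanceAs (Finite {e : (I : Idx ι k) × Edge W I // (B.color e.1 e.2).isSome})

instance [Finite ι] [∀ i, Finite (W i)] (B : ColoredComplex k C W) : Fintype B.VisibleEdge :=
  Fintype.ofFinite _

namespace VisibleEdge

variable {B : ColoredComplex k C W}

/-- The index of a visible edge. -/
def idx (e : B.VisibleEdge) : Idx ι k := e.1.1

/-- The size of a visible edge. -/
def size (e : B.VisibleEdge) : ℕ := e.idx.size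

/-- The vertex `a` lies on the edge `e`. -/
def Mem (a : Vert W) (e : B.VisibleEdge) : Prop :=
  ∃ h : a.1 ∈ e.idx.1, e.1.2 ⟨a.1, h⟩ = a.2

/-- The total color `(B(e|_J))_{J ⊆ I}` of a visible index-`I` edge `e`. -/
def totalColor (e : B.VisibleEdge) (J : Idx ι k) (h : J.1 ⊆ e.idx.1) : C J :=
  (B.color J (e.1.2.restrict h)).get (B.visible_restrict e.1.1 J h e.1.2 e.2)

/-- The relative density `d_G(B⟨e⟩)`. -/
def density [Fintype ι] {Ω : ι → Type w} [∀ i, MeasurableSpace (Ω i)] (e : B.VisibleEdge)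
    (G : ColoredGraph k C Ω) (μ : (i : ι) → Measure (Ω i)) : ℝ :=
  G.relDensity μ e.idx e.totalColor

end VisibleEdge

open Classical in
/-- The visible edges that contain the vertex `a`. -/
def edgesAt [Finite ι] [∀ i, Finite (W i)] (B : ColoredComplex k C W) (a : Vert W) :
    Finset B.VisibleEdge :=
  Finset.univ.filter fun e => e.Mem a

/-- `φ` embeds the complex `B` in the colored graph `G`: the color of every visible edge is
preserved. -/
def Embeds {X : ι → Type w} (B : ColoredComplex k C W) (G : ColoredGraph k C X)
    (φ : PartMap W X) : Prop :=
  ∀ (I : Idx ι k) (e : Edge W I) (c : C I), B.color I e = some c → G.color I (φ.mapEdge e) = c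

/-- `φ` embeds the complex `B` in the complex `S`: every visible edge is mapped to a visible edge of
the same color. -/
def EmbedsComplex {V : ι → Type w} (B : ColoredComplex k C W) (S : ColoredComplex k C V)
    (φ : PartMap W V) : Prop :=
  ∀ (I : Idx ι k) (e : Edge W I) (c : C I),
    B.color I e = some c → S.color I (φ.mapEdge e) = some c

/-- The number of vertices `b ≠ a` such that `{a, b}` is a visible edge (of size two). -/
def degree (B : ColoredComplex k C W) (a : Vert W) : ℕ :=
  Set.ncard {b : Vert W | b ≠ a ∧ ∃ e : B.VisibleEdge, e.size = 2 ∧ e.Mem a ∧ e.Mem b}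

/-- `B` is a `D`-blowup of `S`: its maximum degree is at most `D` and it is embeddable in `S`.
(The vertex sets of `B` are meant to be finite.) -/
def IsBlowup {V : ι → Type w} (D : ℕ) (B : ColoredComplex k C W) (S : ColoredComplex k C V) :
    Prop :=
  (∀ a, B.degree a ≤ D) ∧ ∃ φ : PartMap W V, B.EmbedsComplex S φ

/-- The complex `B ∖ a`: delete the vertex `a` and all edges that contain it. -/
def delete (B : ColoredComplex k C W) (a : Vert W) :
    ColoredComplex k C (fun i => {b : W i // (⟨i, b⟩ : Vert W) ≠ a}) where
  color I e := B.color I fun i => (e i).1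
  visible_restrict I J h e := B.visible_restrict I J h fun i => (e i).1

end ColoredComplex

open Classical in
/-- The partitionwise map that extends `φ` by `a ↦ z`. -/
def PartMap.extend {W : ι → Type v} {X : ι → Type w} {a : Vert W}
    (φ : PartMap (fun i => {b : W i // (⟨i, b⟩ : Vert W) ≠ a}) X) (z : X a.1) : PartMap W X :=
  fun b => if h : b = a then h ▸ z else φ ⟨b.1, b.2, h⟩

section Probability

variable [Fintype ι] {C : Idx ι k → Type x} {Ω : ι → Type w} [∀ i, MeasurableSpace (Ω i)]
  {W : ι → Type v} [∀ i, Fintype (W i)]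

/-- The probability that a random partitionwise map embeds `B` in `G`. -/
def embedProb (μ : (i : ι) → Measure (Ω i)) (B : ColoredComplex k C W) (G : ColoredGraph k C Ω) :
    ℝ :=
  (randomMap μ W).real {φ | B.Embeds G φ}

open Classical in
/-- For a random partitionwise map `φ` on `B ∖ a`, conditioned on embedding `B ∖ a` in `G`, the
expectation of the probability that extending `φ` by a random image of `a` embeds `B` in `G`. -/
def condExtendProb (μ : (i : ι) → Measure (Ω i)) (B : ColoredComplex k C W)
    (G : ColoredGraph k C Ω) (a : Vert W) : ℝ :=
  ∫ φ, (μ a.1).real {z | B.Embeds G (φ.extend z)}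
    ∂(cond (randomMap μ fun i => {b : W i // (⟨i, b⟩ : Vert W) ≠ a})
      {φ | (B.delete a).Embeds G φ})

end Probability

end BlowupCounting

end

open BlowupCounting MeasureTheory

/-! Write `prob` X for the probability that a random map embeds the part of B on the vertex set X.
The conditional expectation in the theorem is the quotient of `prob` of all vertices by `prob` of
all vertices but u (`condExtendProb_mul_prob`), so a lower bound for `prob` X in terms of `prob` (X
∖ u) is needed. It is proved for all X at once by strong induction (`Regular.prob_ge`).

The chance that a map on X ∖ u extends to u depends only on its restriction to the set N of
neighbors of u, and |N| ≤ Δ. The hypothesis, applied to one copy of N with zero, one or two copies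
of u attached, gives the first two moments of this chance, so all but a small fraction of the
embeddings of N have about the expected number of extensions. The difficulty is the conditioning: B
may be arbitrarily large, and an event that is rare on N could be frequent among the embeddings of X
∖ u.

`Regular.expect_le` excludes this, by induction on a bound j for the sizes of the edges at N that
are retained. Without such edges, N is independent of the rest. Otherwise let R be the set of
neighbors of N. For an arbitrary [0, 1]-valued weight on N, the weighted number of extensions from R
to N is concentrated (`concentration`, from the counts of at most two copies of N and of R); hence
for typical maps on R the conditioning is harmless. The atypical maps form a rare event on R. For
them all edges of the top size at N ∪ R are discarded, and the induction hypothesis is applied to N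
∪ R and j - 1. Restoring the discarded densities and the vertices of R costs a factor 2 ^ n * ρ_j ^
(-M) (`Regular.dens_mul_prob_le`), where the strong induction on X is used through `Extends`. The
errors at sizes up to j are chosen far smaller than this power of ρ_j, which is possible because ρ
is monotone and η_i may depend on ρ_i.

The set N grows by a factor Δ + 1 per step and there are fewer than k steps, so only configurations
of bounded size are counted. Two copies of each class form a 2Δ-blowup (`copies_isBlowup`), which is
why the hypothesis concerns 2Δ-blowups. -/

namespace BlowupCounting

set_option linter.unusedSectionVars false

/-! ### Finite expectations and the second moment method. -/

section Weights

/-- A probability weight on a finite type. -/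
structure IsWeight {α : Type*} [Fintype α] (w : α → ℝ) : Prop where
  nonneg : ∀ x, 0 ≤ w x
  sum_eq_one : ∑ x, w x = 1

/-- The expectation of `f` with respect to the weight `w`. -/
def expect {α : Type*} [Fintype α] (w : α → ℝ) (f : α → ℝ) : ℝ := ∑ x, w x * f x

variable {α β : Type*} [Fintype α] [Fintype β] {w : α → ℝ} {v : β → ℝ}

lemma expect_add (f g : α → ℝ) :
    expect w (fun x => f x + g x) = expect w f + expect w g := by
  simp [expect, mul_add, Finset.sum_add_distrib]

lemma expect_sub (f g : α → ℝ) :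
    expect w (fun x => f x - g x) = expect w f - expect w g := by
  simp [expect, mul_sub, Finset.sum_sub_distrib]

lemma expect_const_mul (r : ℝ) (f : α → ℝ) :
    expect w (fun x => r * f x) = r * expect w f := by
  simp only [expect, Finset.mul_sum]
  exact Finset.sum_congr rfl fun x _ => by ring

lemma expect_mul_const (r : ℝ) (f : α → ℝ) :
    expect w (fun x => f x * r) = expect w f * r := by
  simp only [expect, Finset.sum_mul]
  exact Finset.sum_congr rfl fun x _ => by ring

lemma expect_comm (f : α → β → ℝ) :
    expect w (fun x => expect v (f x)) = expect v (fun y => expect w (fun x => f x y)) := by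
  simp only [expect, Finset.mul_sum]
  rw [Finset.sum_comm]
  exact Finset.sum_congr rfl fun x _ => Finset.sum_congr rfl fun y _ => by ring

lemma expect_prod (f : α × β → ℝ) :
    expect (fun p : α × β => w p.1 * v p.2) f
      = expect w (fun x => expect v (fun y => f (x, y))) := by
  simp only [expect, Finset.mul_sum, Fintype.sum_prod_type]
  exact Finset.sum_congr rfl fun x _ => Finset.sum_congr rfl fun y _ => by ring

lemma expect_mul_expect (f : α → ℝ) (g : β → ℝ) :
    expect w f * expect v g = expect w (fun x => expect v (fun y => f x * g y)) := by
  rw [← expect_mul_const]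
  congr 1
  ext x
  rw [expect_const_mul]

lemma expect_sq (f : α → ℝ) :
    expect w f ^ 2 = expect (fun p : α × α => w p.1 * w p.2) (fun p => f p.1 * f p.2) := by
  rw [sq, expect_mul_expect, expect_prod]

namespace IsWeight

lemma prod (hw : IsWeight w) (hv : IsWeight v) :
    IsWeight (fun p : α × β => w p.1 * v p.2) where
  nonneg p := mul_nonneg (hw.nonneg _) (hv.nonneg _)
  sum_eq_one := by
    simp only [Fintype.sum_prod_type, ← Finset.mul_sum, hv.sum_eq_one, mul_one, hw.sum_eq_one]

lemma expect_const (hw : IsWeight w) (r : ℝ) : expect w (fun _ => r) = r := by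
  simp [expect, ← Finset.sum_mul, hw.sum_eq_one]

lemma expect_mono (hw : IsWeight w) {f g : α → ℝ} (h : ∀ x, f x ≤ g x) :
    expect w f ≤ expect w g :=
  Finset.sum_le_sum fun x _ => mul_le_mul_of_nonneg_left (h x) (hw.nonneg x)

lemma expect_nonneg (hw : IsWeight w) {f : α → ℝ} (h : ∀ x, 0 ≤ f x) : 0 ≤ expect w f :=
  Finset.sum_nonneg fun x _ => mul_nonneg (hw.nonneg x) (h x)

end IsWeight

/-- The second moment method for the number of extensions `x ↦ 𝔼_y b(y) c(x, y)`. -/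
lemma variance_le (a : α → ℝ) (b : β → ℝ) (c : α → β → ℝ) {A D θ : ℝ} (hD : 0 ≤ D)
    (h0 : expect w a ≤ (1 + θ) * A)
    (h1 : (1 - θ) * (A * D) ≤ expect w fun x => expect v fun y => a x * (b y * c x y))
    (h2 : (expect w fun x => expect v fun y => expect v fun y' =>
      a x * ((b y * c x y) * (b y' * c x y'))) ≤ (1 + θ) * (A * D ^ 2)) :
    expect w (fun x => a x * (expect v (fun y => b y * c x y) - D) ^ 2)
      ≤ 4 * θ * (A * D ^ 2) := by
  have e1 : (expect w fun x => expect v fun y => a x * (b y * c x y))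
      = expect w fun x => a x * expect v (fun y => b y * c x y) := by
    simp only [expect_const_mul]
  have e2 : (expect w fun x => expect v fun y => expect v fun y' =>
      a x * ((b y * c x y) * (b y' * c x y')))
      = expect w fun x => a x * expect v (fun y => b y * c x y) ^ 2 := by
    simp only [expect_const_mul, expect_mul_const, sq]
  have e3 : expect w (fun x => a x * (expect v (fun y => b y * c x y) - D) ^ 2)
      = (expect w fun x => a x * expect v (fun y => b y * c x y) ^ 2)
        - (2 * D) * (expect w fun x => a x * expect v (fun y => b y * c x y))
        + D ^ 2 * expect w a := by
    rw [← expect_const_mul, ← expect_const_mul, ← expect_sub, ← expect_add]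
    congr 1
    ext x
    ring
  rw [e1] at h1
  rw [e2] at h2
  rw [e3]
  nlinarith [mul_le_mul_of_nonneg_left h1 hD, mul_le_mul_of_nonneg_left h0 (sq_nonneg D)]

/-- A first moment bound from a second moment bound. -/
lemma expect_abs_le (hw : IsWeight w) (a f : α → ℝ) {s : ℝ} (hs : 0 < s) (ha : ∀ x, 0 ≤ a x) :
    expect w (fun x => a x * |f x|)
      ≤ (s * expect w a + s⁻¹ * expect w (fun x => a x * f x ^ 2)) / 2 := by
  have : (s * expect w a + s⁻¹ * expect w (fun x => a x * f x ^ 2)) / 2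
      = expect w (fun x => (s * a x + s⁻¹ * (a x * f x ^ 2)) * (1 / 2)) := by
    rw [expect_mul_const, expect_add, expect_const_mul, expect_const_mul]
    ring
  rw [this]
  refine hw.expect_mono fun x => ?_
  have h : |f x| ≤ (s + s⁻¹ * f x ^ 2) * (1 / 2) := by
    have h0 : 0 ≤ s⁻¹ * (s - |f x|) ^ 2 := by positivity
    have h1 : s⁻¹ * (s - |f x|) ^ 2 = s - 2 * |f x| + s⁻¹ * f x ^ 2 := by
      rw [sub_sq, sq_abs]
      field_simp
    linarith
  calc a x * |f x| ≤ a x * ((s + s⁻¹ * f x ^ 2) * (1 / 2)) := mul_le_mul_of_nonneg_left h (ha x)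
    _ = _ := by ring

/-- Exchanging the expectations puts ψ outside the sum over y. As ψ lies in [0, 1], it can only
decrease the L¹ deviation of the degrees, so one error bound serves every ψ. -/
lemma expect_weighted_ge (hw : IsWeight w) (a : α → ℝ) (b : β → ℝ) (c : α → β → ℝ)
    (ψ : α → ℝ) (ha : ∀ x, 0 ≤ a x) (hψ : ∀ x, 0 ≤ ψ x ∧ ψ x ≤ 1) (D : ℝ) :
    expect w (fun x => ψ x * a x) * D
      - expect w (fun x => a x * |expect v (fun y => b y * c x y) - D|)
      ≤ expect v (fun y => b y * expect w (fun x => ψ x * (a x * c x y))) := by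
  have e : expect v (fun y => b y * expect w (fun x => ψ x * (a x * c x y)))
      = expect w (fun x => ψ x * a x * expect v (fun y => b y * c x y)) := by
    simp only [← expect_const_mul]
    rw [expect_comm]
    congr 1; ext x; congr 1; ext y; ring
  rw [e, ← expect_mul_const, ← expect_sub]
  refine hw.expect_mono fun x => ?_
  have h1 := neg_abs_le (expect v (fun y => b y * c x y) - D)
  have h2 : 0 ≤ a x * |expect v (fun y => b y * c x y) - D| := mul_nonneg (ha x) (abs_nonneg _)
  have h3 : 0 ≤ ψ x * a x := mul_nonneg (hψ x).1 (ha x)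
  nlinarith [mul_le_mul_of_nonneg_left h1 h3, mul_le_mul_of_nonneg_right (hψ x).2 h2]

/-- The square is an expectation over pairs (x, x'), and for fixed pairs the sum over y is a
codegree. Again ψ(x) ψ(x') ≤ 1 bounds the error independently of ψ. -/
lemma expect_weighted_sq_le (hw : IsWeight w) (a : α → ℝ) (b : β → ℝ) (c : α → β → ℝ)
    (ψ : α → ℝ) (ha : ∀ x, 0 ≤ a x) (hψ : ∀ x, 0 ≤ ψ x ∧ ψ x ≤ 1) (D : ℝ) :
    expect v (fun y => b y * expect w (fun x => ψ x * (a x * c x y)) ^ 2)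
      ≤ expect w (fun x => ψ x * a x) ^ 2 * D
        + expect (fun p : α × α => w p.1 * w p.2) (fun p => (a p.1 * a p.2) *
          |expect v (fun y => b y * (c p.1 y * c p.2 y)) - D|) := by
  have e : expect v (fun y => b y * expect w (fun x => ψ x * (a x * c x y)) ^ 2)
      = expect (fun p : α × α => w p.1 * w p.2) (fun p => (ψ p.1 * a p.1) * (ψ p.2 * a p.2) *
        expect v (fun y => b y * (c p.1 y * c p.2 y))) := by
    simp only [expect_sq, ← expect_const_mul]
    rw [expect_comm]
    congr 1; ext p; congr 1; ext y; ring
  rw [e, expect_sq, ← expect_mul_const, ← expect_add]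
  refine (hw.prod hw).expect_mono fun p => ?_
  have h1 := le_abs_self (expect v (fun y => b y * (c p.1 y * c p.2 y)) - D)
  have h3 : 0 ≤ a p.1 * a p.2 := mul_nonneg (ha _) (ha _)
  have h4 : 0 ≤ ψ p.1 * ψ p.2 := mul_nonneg (hψ _).1 (hψ _).1
  have h5 : ψ p.1 * ψ p.2 ≤ 1 := mul_le_one₀ (hψ _).2 (hψ _).1 (hψ _).2
  have h6 := mul_le_mul_of_nonneg_left h1 (mul_nonneg h4 h3)
  have h7 := mul_le_mul_of_nonneg_right h5 (mul_nonneg h3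
    (abs_nonneg (expect v (fun y => b y * (c p.1 y * c p.2 y)) - D)))
  linarith

set_option maxHeartbeats 800000 in
/-- If the small configurations of copies of the two vertex classes have the expected frequencies,
then `y ↦ 𝔼_x ψ(x) a(x) c(x, y)` is concentrated for every `[0, 1]`-valued `ψ`. -/
lemma concentration (hw : IsWeight w) (a : α → ℝ) (b : β → ℝ) (c : α → β → ℝ)
    (ψ : α → ℝ) (ha : ∀ x, 0 ≤ a x) (hψ : ∀ x, 0 ≤ ψ x ∧ ψ x ≤ 1)
    {A B C τ : ℝ} (hA : 0 < A) (hB : 0 < B) (hC : 0 < C) (hτ : 0 < τ) (hτ1 : τ ≤ 1)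
    (h10 : expect w a ≤ (1 + τ ^ 8) * A)
    (h01 : expect v b ≤ (1 + τ ^ 8) * B)
    (h11 : (1 - τ ^ 8) * (A * (B * C)) ≤ expect w fun x => expect v fun y => a x * (b y * c x y))
    (h12 : (expect w fun x => expect v fun y => expect v fun y' =>
      a x * ((b y * c x y) * (b y' * c x y'))) ≤ (1 + τ ^ 8) * (A * (B * C) ^ 2))
    (h21 : (1 - τ ^ 8) * (A ^ 2 * (B * C ^ 2)) ≤ expect w fun x => expect w fun x' =>
      expect v fun y => (a x * a x') * (b y * (c x y * c x' y)))
    (h22 : (expect w fun x => expect w fun x' => expect v fun y => expect v fun y' =>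
      (a x * a x') * ((b y * (c x y * c x' y)) * (b y' * (c x y' * c x' y'))))
        ≤ (1 + τ ^ 8) * (A ^ 2 * (B * C ^ 2) ^ 2)) :
    expect v (fun y => b y * (expect w (fun x => ψ x * (a x * c x y))
      - expect w (fun x => ψ x * a x) * C) ^ 2) ≤ 24 * τ ^ 4 * (A ^ 2 * (B * C ^ 2)) := by
  have hτ8 : τ ^ 8 ≤ τ ^ 4 := pow_le_pow_of_le_one hτ.le hτ1 (by norm_num)
  have hτ4 : τ ^ 4 ≤ 1 := pow_le_one₀ hτ.le hτ1
  have hτ4' : 0 < τ ^ 4 := by positivity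
  have hee : τ ^ 8 = τ ^ 4 * τ ^ 4 := by ring
  set m := expect w (fun x => ψ x * a x) with hm
  have hm0 : 0 ≤ m := hw.expect_nonneg fun x => mul_nonneg (hψ x).1 (ha x)
  have hma : m ≤ 2 * A := by
    have : m ≤ expect w a :=
      hw.expect_mono fun x => by nlinarith [mul_le_mul_of_nonneg_right (hψ x).2 (ha x)]
    nlinarith
  -- The function ψ is arbitrary, so its extensions cannot be counted directly. Instead the degrees
  -- of points x (`v1`) and the codegrees of pairs (`v2`) are shown to be concentrated, with ψ
  -- absent. For pairs the error is 3 * τ ^ 8 since (1 + τ ^ 8) ^ 2 ≤ 1 + 3 * τ ^ 8.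
  have v1 := variance_le (w := w) (v := v) a b c (by positivity) h10 h11 h12
  have v2 := variance_le (w := fun p : α × α => w p.1 * w p.2) (v := v)
    (fun p => a p.1 * a p.2) b (fun p y => c p.1 y * c p.2 y) (A := A ^ 2) (D := B * C ^ 2)
    (θ := 3 * τ ^ 8) (by positivity)
    (by
      rw [expect_prod]
      simp only [expect_const_mul, expect_mul_const]
      have h0 : 0 ≤ expect w a := hw.expect_nonneg ha
      calc expect w a * expect w a ≤ ((1 + τ ^ 8) * A) * ((1 + τ ^ 8) * A) :=
            mul_le_mul h10 h10 h0 (by positivity)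
        _ = (1 + 2 * τ ^ 8 + τ ^ 8 * τ ^ 8) * A ^ 2 := by ring
        _ ≤ (1 + 3 * τ ^ 8) * A ^ 2 := by
            refine mul_le_mul_of_nonneg_right ?_ (by positivity)
            nlinarith [show 0 ≤ τ ^ 8 by positivity])
    (by
      rw [expect_prod]
      refine le_trans ?_ h21
      refine mul_le_mul_of_nonneg_right ?_ (by positivity)
      nlinarith [show 0 ≤ τ ^ 8 by positivity])
    (by
      rw [expect_prod]
      refine h22.trans ?_
      refine mul_le_mul_of_nonneg_right ?_ (by positivity)
      nlinarith [show 0 ≤ τ ^ 8 by positivity])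
  -- A variance of order τ ^ 8 gives L¹ deviations of order τ ^ 4: the parameter s is the mean times
  -- τ ^ 4, which balances the two terms.
  have a1 := expect_abs_le hw a (fun x => expect v (fun y => b y * c x y) - B * C)
    (s := τ ^ 4 * (B * C)) (by positivity) ha
  have a2 := expect_abs_le (hw.prod hw) (fun p : α × α => a p.1 * a p.2)
    (fun p => expect v (fun y => b y * (c p.1 y * c p.2 y)) - B * C ^ 2)
    (s := τ ^ 4 * (B * C ^ 2)) (by positivity) (fun p => mul_nonneg (ha _) (ha _))
  have a1' : expect w (fun x => a x * |expect v (fun y => b y * c x y) - B * C|)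
      ≤ 3 * τ ^ 4 * (A * (B * C)) := by
    refine a1.trans ?_
    have i1 : τ ^ 4 * (B * C) * expect w a ≤ τ ^ 4 * (B * C) * (2 * A) :=
      mul_le_mul_of_nonneg_left (by nlinarith) (by positivity)
    have i2 : (τ ^ 4 * (B * C))⁻¹ *
        expect w (fun x => a x * (expect v (fun y => b y * c x y) - B * C) ^ 2)
        ≤ (τ ^ 4 * (B * C))⁻¹ * (4 * τ ^ 8 * (A * (B * C) ^ 2)) :=
      mul_le_mul_of_nonneg_left v1 (by positivity)
    have i3 : (τ ^ 4 * (B * C))⁻¹ * (4 * τ ^ 8 * (A * (B * C) ^ 2)) =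
        4 * τ ^ 4 * (A * (B * C)) := by
      field_simp
    linarith
  have a2' : expect (fun p : α × α => w p.1 * w p.2) (fun p => (a p.1 * a p.2) *
      |expect v (fun y => b y * (c p.1 y * c p.2 y)) - B * C ^ 2|)
      ≤ 8 * τ ^ 4 * (A ^ 2 * (B * C ^ 2)) := by
    refine a2.trans ?_
    have i0 : expect (fun p : α × α => w p.1 * w p.2) (fun p => a p.1 * a p.2) ≤ 4 * A ^ 2 := by
      rw [expect_prod]
      simp only [expect_const_mul, expect_mul_const]
      have h0 : 0 ≤ expect w a := hw.expect_nonneg ha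
      have h2A : expect w a ≤ 2 * A := by nlinarith
      nlinarith
    have i1 : τ ^ 4 * (B * C ^ 2) * expect (fun p : α × α => w p.1 * w p.2)
        (fun p => a p.1 * a p.2) ≤ τ ^ 4 * (B * C ^ 2) * (4 * A ^ 2) :=
      mul_le_mul_of_nonneg_left i0 (by positivity)
    have i2 := mul_le_mul_of_nonneg_left v2 (show 0 ≤ (τ ^ 4 * (B * C ^ 2))⁻¹ by positivity)
    have i3 : (τ ^ 4 * (B * C ^ 2))⁻¹ * (4 * (3 * τ ^ 8) * (A ^ 2 * (B * C ^ 2) ^ 2))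
        = 12 * τ ^ 4 * (A ^ 2 * (B * C ^ 2)) := by
      field_simp
      ring
    linarith
  have f1 := (sub_le_sub_left a1' _).trans (expect_weighted_ge hw a b c ψ ha hψ (B * C))
  have f2 := (expect_weighted_sq_le hw a b c ψ ha hψ (B * C ^ 2)).trans
    (add_le_add_right a2' _)
  rw [← hm] at f1 f2
  -- After expansion the main terms cancel. The errors are 8 from the codegrees, 2 * 2 * 3 from the
  -- degrees (as m ≤ 2 * A) and 4 from the count of b, which sum to 24.
  have e3 : expect v (fun y => b y * (expect w (fun x => ψ x * (a x * c x y)) - m * C) ^ 2)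
      = expect v (fun y => b y * expect w (fun x => ψ x * (a x * c x y)) ^ 2)
        - (2 * (m * C)) * expect v (fun y => b y * expect w (fun x => ψ x * (a x * c x y)))
        + (m * C) ^ 2 * expect v b := by
    rw [← expect_const_mul, ← expect_const_mul, ← expect_sub, ← expect_add]
    congr 1
    ext x
    ring
  rw [e3]
  have g1 := mul_le_mul_of_nonneg_left f1 (show 0 ≤ 2 * (m * C) by positivity)
  have g2 := mul_le_mul_of_nonneg_left h01 (sq_nonneg (m * C))
  have hBC : 0 < B * C ^ 2 := by positivity
  have g3 : m * A * (τ ^ 4 * (B * C ^ 2)) ≤ 2 * A * A * (τ ^ 4 * (B * C ^ 2)) :=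
    mul_le_mul_of_nonneg_right (mul_le_mul_of_nonneg_right hma hA.le) (by positivity)
  have g4 : m ^ 2 * (τ ^ 8 * (B * C ^ 2)) ≤ (2 * A) ^ 2 * (τ ^ 4 * (B * C ^ 2)) := by
    refine mul_le_mul (pow_le_pow_left₀ hm0 hma 2) (mul_le_mul_of_nonneg_right hτ8 hBC.le)
      (by positivity) (by positivity)
  linarith

/-- Chebyshev's inequality in the form used below. -/
lemma expect_exceptional_le (hv : IsWeight v) (b F : β → ℝ) (hb : ∀ y, 0 ≤ b y)
    {m s K : ℝ} (hs : 0 < s) (h : expect v (fun y => b y * (F y - m) ^ 2) ≤ K) :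
    expect v (fun y => if m + s < F y then b y else 0) ≤ K / s ^ 2 := by
  rw [le_div_iff₀ (by positivity), ← expect_mul_const]
  refine le_trans (hv.expect_mono fun y => ?_) h
  split_ifs with h1
  · refine mul_le_mul_of_nonneg_left ?_ (hb y)
    exact pow_le_pow_left₀ hs.le (by linarith) 2
  · rw [zero_mul]
    exact mul_nonneg (hb y) (sq_nonneg _)

lemma expect_exceptional_le' (hv : IsWeight v) (b F : β → ℝ) (hb : ∀ y, 0 ≤ b y)
    {m s K : ℝ} (hs : 0 < s) (h : expect v (fun y => b y * (F y - m) ^ 2) ≤ K) :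
    expect v (fun y => if F y < m - s then b y else 0) ≤ K / s ^ 2 := by
  rw [le_div_iff₀ (by positivity), ← expect_mul_const]
  refine le_trans (hv.expect_mono fun y => ?_) h
  split_ifs with h1
  · refine mul_le_mul_of_nonneg_left ?_ (hb y)
    nlinarith
  · rw [zero_mul]
    exact mul_nonneg (hb y) (sq_nonneg _)

/-- A rare event on `β` remains rare after weighting it with the number of extensions to `α`. -/
lemma expect_mul_extensions_le (hv : IsWeight v) (a : α → ℝ) (b : β → ℝ)
    (c : α → β → ℝ) (ψ : β → ℝ) (hψ : ∀ y, 0 ≤ ψ y) (hψb : ∀ y, ψ y ≤ b y)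
    {A B C τ : ℝ} (hA : 0 < A) (hB : 0 < B) (hC : 0 < C) (hτ : 0 < τ) (hτ1 : τ ≤ 1)
    (hr : expect v ψ ≤ 24 * τ ^ 2 * B)
    (h21 : (expect w fun x => expect w fun x' =>
      expect v fun y => (a x * a x') * (b y * (c x y * c x' y)))
        ≤ (1 + τ ^ 8) * (A ^ 2 * (B * C ^ 2))) :
    expect v (fun y => ψ y * expect w (fun x => a x * c x y)) ≤ 13 * τ * (A * B * C) := by
  have hτ8 : τ ^ 8 ≤ 1 := pow_le_one₀ hτ.le hτ1
  have e : (expect w fun x => expect w fun x' =>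
      expect v fun y => (a x * a x') * (b y * (c x y * c x' y)))
      = expect v (fun y => b y * expect w (fun x => a x * c x y) ^ 2) := by
    simp only [expect_sq, ← expect_const_mul]
    rw [expect_comm (w := v), expect_prod]
    congr 1; ext x; congr 1; ext x'; congr 1; ext y; ring
  rw [e] at h21
  -- The mass of ψ is O(τ ^ 2) and the second moment is O(1) relative to expectation. Scaling s by 1
  -- / τ makes both terms O(τ), with constant (24 + 2) / 2 = 13.
  have h := expect_abs_le hv ψ (fun y => expect w (fun x => a x * c x y))
    (s := A * C / τ) (by positivity) hψ
  have h1 : expect v (fun y => ψ y * expect w (fun x => a x * c x y) ^ 2)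
      ≤ 2 * (A ^ 2 * (B * C ^ 2)) :=
    (hv.expect_mono fun y => mul_le_mul_of_nonneg_right (hψb y) (sq_nonneg _)).trans
      (h21.trans (mul_le_mul_of_nonneg_right (by linarith) (by positivity)))
  have h2 : expect v (fun y => ψ y * expect w (fun x => a x * c x y))
      ≤ expect v (fun y => ψ y * |expect w (fun x => a x * c x y)|) :=
    hv.expect_mono fun y => mul_le_mul_of_nonneg_left (le_abs_self _) (hψ y)
  have h3 := mul_le_mul_of_nonneg_left hr (show 0 ≤ A * C / τ by positivity)
  have h4 := mul_le_mul_of_nonneg_left h1 (show 0 ≤ (A * C / τ)⁻¹ by positivity)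
  have h5 : A * C / τ * (24 * τ ^ 2 * B) = 24 * τ * (A * B * C) := by field_simp
  have h6 : (A * C / τ)⁻¹ * (2 * (A ^ 2 * (B * C ^ 2))) = 2 * τ * (A * B * C) := by field_simp
  linarith

end Weights

/-! ### Random maps and resampling of coordinates. -/

section Resample
open scoped Classical

variable {ι : Type u} [Fintype ι] {Ω : ι → Type v} [∀ i, Fintype (Ω i)]
  [∀ i, MeasurableSpace (Ω i)] [∀ i, DiscreteMeasurableSpace (Ω i)]
  (μ : (i : ι) → Measure (Ω i)) [∀ i, IsProbabilityMeasure (μ i)]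
  {W : ι → Type w} [∀ i, Fintype (W i)] {W' : ι → Type w} [∀ i, Fintype (W' i)]

/-- The probability of a single partitionwise map. -/
noncomputable def mapWeight (W : ι → Type w) [∀ i, Fintype (W i)] (φ : PartMap W Ω) : ℝ :=
  (randomMap μ W).real {φ}

/-- The expectation over a random partitionwise map. -/
noncomputable abbrev mapExpect (f : PartMap W Ω → ℝ) : ℝ := expect (mapWeight μ W) f

instance : IsProbabilityMeasure (randomMap μ W) := by
  unfold randomMap; infer_instance

lemma integral_randomMap (f : PartMap W Ω → ℝ) :
    ∫ φ, f φ ∂(randomMap μ W) = mapExpect μ f := by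
  rw [integral_fintype Integrable.of_finite]
  rfl

lemma isWeight_mapWeight : IsWeight (mapWeight μ W) where
  nonneg _ := measureReal_nonneg
  sum_eq_one := by
    have := integral_randomMap μ (W := W) (fun _ => 1)
    simpa [mapExpect, expect] using this.symm

/-- The map that agrees with `x ∘ σ` on `Z` and with `y` outside `Z`. -/
noncomputable def glue (Z : Finset (Vert W')) (σ : (a : Vert W') → a ∈ Z → W a.1) (x : PartMap W Ω)
    (y : PartMap W' Ω) : PartMap W' Ω :=
  fun a => if h : a ∈ Z then x ⟨a.1, σ a h⟩ else y a

/-- Injectivity of σ makes the coordinates read from x distinct, hence independent; since σ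
preserves the vertex class, they also have the right laws. It suffices to compare the two measures
on boxes. -/
lemma map_glue (Z : Finset (Vert W')) (σ : (a : Vert W') → a ∈ Z → W a.1)
    (hσ : ∀ a b (ha : a ∈ Z) (hb : b ∈ Z), (⟨a.1, σ a ha⟩ : Vert W) = ⟨b.1, σ b hb⟩ → a = b) :
    ((randomMap μ W).prod (randomMap μ W')).map
      (fun p : PartMap W Ω × PartMap W' Ω => glue Z σ p.1 p.2) = randomMap μ W' := by
  refine (Measure.pi_eq fun s _ => ?_).symm
  rw [Measure.map_apply Measurable.of_discrete (MeasurableSet.of_discrete)]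
  have hpre : (fun p : PartMap W Ω × PartMap W' Ω => glue Z σ p.1 p.2) ⁻¹' Set.univ.pi s
      = (⋂ a ∈ (Finset.univ : Finset Z),
          (fun x : PartMap W Ω => x ⟨a.1.1, σ a.1 a.2⟩) ⁻¹' s a.1) ×ˢ
        (Set.univ.pi fun a => if a ∈ Z then Set.univ else s a) := by
    ext ⟨x, y⟩
    simp only [Set.mem_preimage, Set.mem_pi, Set.mem_univ, true_imp_iff, Set.mem_prod,
      Set.mem_iInter, Finset.mem_univ]
    constructor
    · intro h
      refine ⟨fun a => ?_, fun a => ?_⟩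
      · have := h a.1
        simpa [glue, a.2] using this
      · split_ifs with ha
        · trivial
        · have := h a
          simpa [glue, ha] using this
    · rintro ⟨h1, h2⟩ a
      by_cases ha : a ∈ Z
      · simpa [glue, ha] using h1 ⟨a, ha⟩
      · have := h2 a
        simpa [glue, ha] using this
  rw [hpre, Measure.prod_prod]
  have hind : iIndepFun (fun (b : Vert W) (x : PartMap W Ω) => x b) (randomMap μ W) :=
    iIndepFun_pi (μ := fun b : Vert W => μ b.1) (X := fun _ => id) (fun _ => aemeasurable_id)
  have hind' := hind.precomp (g := fun a : Z => (⟨a.1.1, σ a.1 a.2⟩ : Vert W))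
    (fun a b hab => Subtype.ext (hσ _ _ _ _ hab))
  rw [hind'.measure_inter_preimage_eq_mul Finset.univ (sets := fun a => s a.1)
    (fun _ _ => MeasurableSet.of_discrete)]
  have h1 : ∀ a : Z, (randomMap μ W) ((fun x : PartMap W Ω => x ⟨a.1.1, σ a.1 a.2⟩) ⁻¹' s a.1)
      = μ a.1.1 (s a.1) := fun a =>
    (measurePreserving_eval (fun b : Vert W => μ b.1) ⟨a.1.1, σ a.1 a.2⟩).measure_preimage
      (MeasurableSet.of_discrete.nullMeasurableSet)
  have h2 : (randomMap μ W') (Set.univ.pi fun a => if a ∈ Z then Set.univ else s a)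
      = ∏ a, if a ∈ Z then 1 else μ a.1 (s a) := by
    unfold randomMap
    rw [Measure.pi_pi]
    refine Finset.prod_congr rfl fun a _ => ?_
    split_ifs <;> simp
  rw [h2, Finset.prod_congr rfl fun a _ => h1 a, Finset.prod_coe_sort Z (fun a => μ a.1 (s a)),
    ← Finset.univ_inter Z, ← Finset.prod_ite_mem, Finset.univ_inter, ← Finset.prod_mul_distrib]
  refine Finset.prod_congr rfl fun a _ => ?_
  split_ifs <;> simp

/-- The coordinates in `Z` of a random map can be sampled from an independent random map. -/
lemma mapExpect_glue (Z : Finset (Vert W')) (σ : (a : Vert W') → a ∈ Z → W a.1)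
    (hσ : ∀ a b (ha : a ∈ Z) (hb : b ∈ Z), (⟨a.1, σ a ha⟩ : Vert W) = ⟨b.1, σ b hb⟩ → a = b)
    (f : PartMap W' Ω → ℝ) :
    mapExpect μ f = mapExpect μ fun x : PartMap W Ω => mapExpect μ fun y => f (glue Z σ x y) := by
  simp only [← integral_randomMap]
  conv_lhs => rw [← map_glue μ Z σ hσ]
  rw [integral_map (Measurable.of_discrete.aemeasurable)
    (AEStronglyMeasurable.of_discrete)]
  exact integral_prod _ Integrable.of_finite

/-- The map that agrees with `x` on `T` and with `y` outside `T`. -/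
noncomputable def mix (T : Finset (Vert W)) (x y : PartMap W Ω) : PartMap W Ω :=
  fun a => if a ∈ T then x a else y a

lemma mapExpect_mix (T : Finset (Vert W)) (f : PartMap W Ω → ℝ) :
    mapExpect μ f = mapExpect μ fun x => mapExpect μ fun y => f (mix T x y) :=
  mapExpect_glue μ T (fun a _ => a.2) (fun _ _ _ _ h => h) f

/-- Functions of disjoint sets of coordinates are uncorrelated. -/
lemma mapExpect_mul_of_dependsOn {T : Finset (Vert W)} {f g : PartMap W Ω → ℝ}
    (hf : DependsOn f (T : Set (Vert W))) (hg : DependsOn g ((T : Set (Vert W))ᶜ)) :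
    mapExpect μ (fun φ => f φ * g φ) = mapExpect μ f * mapExpect μ g := by
  rw [mapExpect_mix μ T, mapExpect, mapExpect, mapExpect, expect_mul_expect]
  congr 1; ext x; congr 1; ext y
  rw [hf (x := mix T x y) (y := x) fun a ha => by simp [mix, Finset.mem_coe.1 ha],
    hg (x := mix T x y) (y := y) fun a ha => by
      simp [mix, show a ∉ T from fun h => ha (Finset.mem_coe.2 h)]]

end Resample

/-! ### Visible edges, their indicators and densities. -/

section Edges
open scoped Classical

variable {ι : Type u} [Fintype ι] {k : ℕ} {C : Idx ι k → Type x} {W : ι → Type w}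
  [∀ i, Fintype (W i)] {B : ColoredComplex k C W}

namespace ColoredComplex.VisibleEdge

/-- The set of vertices of a visible edge. -/
noncomputable def verts (e : B.VisibleEdge) : Finset (Vert W) :=
  Finset.univ.image fun i : e.idx.1 => (⟨i.1, e.1.2 i⟩ : Vert W)

lemma mem_verts {e : B.VisibleEdge} {a : Vert W} :
    a ∈ e.verts ↔ ∃ i : e.idx.1, (⟨i.1, e.1.2 i⟩ : Vert W) = a := by
  simp [verts]

lemma mk_mem_verts (e : B.VisibleEdge) (i : e.idx.1) : (⟨i.1, e.1.2 i⟩ : Vert W) ∈ e.verts :=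
  mem_verts.2 ⟨i, rfl⟩

lemma mem_iff_mem_verts {e : B.VisibleEdge} {a : Vert W} : e.Mem a ↔ a ∈ e.verts := by
  rw [mem_verts]
  constructor
  · rintro ⟨h, h'⟩
    exact ⟨⟨a.1, h⟩, Sigma.ext rfl (heq_of_eq h')⟩
  · rintro ⟨i, rfl⟩
    exact ⟨i.2, rfl⟩

lemma eq_of_mem_verts {e : B.VisibleEdge} {a b : Vert W} (ha : a ∈ e.verts) (hb : b ∈ e.verts)
    (h : a.1 = b.1) : a = b := by
  obtain ⟨i, rfl⟩ := mem_verts.1 ha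
  obtain ⟨i', rfl⟩ := mem_verts.1 hb
  obtain rfl : i = i' := Subtype.ext h
  rfl

lemma verts_nonempty (e : B.VisibleEdge) : e.verts.Nonempty := by
  obtain ⟨i, hi⟩ := e.idx.2.1
  exact ⟨_, mk_mem_verts e ⟨i, hi⟩⟩

/-- A vertex records its class, so the vertex set determines the index and then the edge. This is
what bounds numbers of edges by powers of two. -/
lemma verts_injective : Function.Injective (verts : B.VisibleEdge → Finset (Vert W)) := by
  intro e e' h
  have hidx : e.idx = e'.idx := by
    refine Subtype.ext (Finset.ext fun i => ⟨fun hi => ?_, fun hi => ?_⟩)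
    · obtain ⟨i', hi'⟩ := mem_verts.1 (h ▸ mk_mem_verts e ⟨i, hi⟩)
      exact (show i'.1 = i from congrArg Sigma.fst hi') ▸ i'.2
    · obtain ⟨i', hi'⟩ := mem_verts.1 (h.symm ▸ mk_mem_verts e' ⟨i, hi⟩)
      exact (show i'.1 = i from congrArg Sigma.fst hi') ▸ i'.2
  obtain ⟨⟨I, f⟩, hv⟩ := e
  obtain ⟨⟨I', f'⟩, hv'⟩ := e'
  obtain rfl : I = I' := hidx
  suffices f = f' by subst this; rfl
  funext i
  have h1 : (⟨i.1, f i⟩ : Vert W) ∈ verts (B := B) ⟨⟨I, f'⟩, hv'⟩ :=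
    h ▸ mk_mem_verts (B := B) ⟨⟨I, f⟩, hv⟩ i
  have h2 := mk_mem_verts (B := B) ⟨⟨I, f'⟩, hv'⟩ i
  have := eq_of_mem_verts h1 h2 rfl
  exact eq_of_heq (Sigma.mk.inj this).2

lemma one_le_size (e : B.VisibleEdge) : 1 ≤ e.size := Finset.card_pos.2 e.idx.2.1

lemma size_le (e : B.VisibleEdge) : e.size ≤ k := e.idx.2.2

variable {Ω : ι → Type v}

/-- The indicator of the event that a partitionwise map preserves the color of `e`. -/
noncomputable def ok (G : ColoredGraph k C Ω) (e : B.VisibleEdge) (φ : PartMap W Ω) : ℝ :=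
  if B.color e.1.1 e.1.2 = some (G.color e.1.1 (φ.mapEdge e.1.2)) then 1 else 0

lemma ok_nonneg (G : ColoredGraph k C Ω) (e : B.VisibleEdge) (φ : PartMap W Ω) :
    0 ≤ e.ok G φ := by
  unfold ok; split_ifs <;> norm_num

lemma ok_le_one (G : ColoredGraph k C Ω) (e : B.VisibleEdge) (φ : PartMap W Ω) :
    e.ok G φ ≤ 1 := by
  unfold ok; split_ifs <;> norm_num

lemma ok_congr (G : ColoredGraph k C Ω) (e : B.VisibleEdge) {φ φ' : PartMap W Ω}
    (h : ∀ a ∈ e.verts, φ a = φ' a) : e.ok G φ = e.ok G φ' := by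
  have : φ.mapEdge e.1.2 = φ'.mapEdge e.1.2 := funext fun i => h _ (mk_mem_verts e i)
  unfold ok
  rw [this]

end ColoredComplex.VisibleEdge

open ColoredComplex ColoredComplex.VisibleEdge

lemma embeds_iff {Ω : ι → Type v} (G : ColoredGraph k C Ω) (φ : PartMap W Ω) :
    B.Embeds G φ ↔ ∀ e : B.VisibleEdge,
      B.color e.1.1 e.1.2 = some (G.color e.1.1 (φ.mapEdge e.1.2)) := by
  constructor
  · intro h e
    obtain ⟨c, hc⟩ := Option.isSome_iff_exists.1 e.2
    rw [h _ _ c hc, hc]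
  · intro h I e c hc
    have := h ⟨⟨I, e⟩, by simp [hc]⟩
    exact (Option.some.inj (hc.symm.trans this)).symm

lemma prod_ok {Ω : ι → Type v} (G : ColoredGraph k C Ω) (φ : PartMap W Ω) :
    ∏ e : B.VisibleEdge, e.ok G φ = if B.Embeds G φ then 1 else 0 := by
  unfold ok
  rw [Finset.prod_boole]
  simp [embeds_iff]

variable {Ω : ι → Type v} [∀ i, Fintype (Ω i)]
  [∀ i, MeasurableSpace (Ω i)] [∀ i, DiscreteMeasurableSpace (Ω i)]
  (μ : (i : ι) → Measure (Ω i)) [∀ i, IsProbabilityMeasure (μ i)]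

lemma embedProb_eq (G : ColoredGraph k C Ω) :
    embedProb μ B G = mapExpect μ fun φ => ∏ e : B.VisibleEdge, e.ok G φ := by
  simp only [prod_ok]
  rw [← integral_randomMap, embedProb,
    ← integral_indicator_one (MeasurableSet.of_discrete)]
  congr 1

/-- Visible edges with the same total color have the same density. -/
lemma density_eq_of_color_eq {W' : ι → Type y} {B' : ColoredComplex k C W'}
    (G : ColoredGraph k C Ω) (I : Idx ι k) (f : Edge W I) (f' : Edge W' I)
    (h : (B.color I f).isSome) (h' : (B'.color I f').isSome)
    (hc : ∀ (J : Idx ι k) (hJ : J.1 ⊆ I.1),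
      B.color J (f.restrict hJ) = B'.color J (f'.restrict hJ)) :
    VisibleEdge.density (B := B) ⟨⟨I, f⟩, h⟩ G μ
      = VisibleEdge.density (B := B') ⟨⟨I, f'⟩, h'⟩ G μ := by
  unfold VisibleEdge.density
  have : VisibleEdge.totalColor (B := B) ⟨⟨I, f⟩, h⟩
      = VisibleEdge.totalColor (B := B') ⟨⟨I, f'⟩, h'⟩ := by
    funext J hJ
    simp only [VisibleEdge.totalColor]
    congr 1
    exact hc J hJ
  rw [this]
  rfl

lemma density_nonneg (G : ColoredGraph k C Ω) (e : B.VisibleEdge) : 0 ≤ e.density G μ :=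
  measureReal_nonneg

lemma density_le_one (G : ColoredGraph k C Ω) (e : B.VisibleEdge) : e.density G μ ≤ 1 := by
  unfold VisibleEdge.density ColoredGraph.relDensity
  have : IsProbabilityMeasure (randomEdge μ e.idx) := by unfold randomEdge; infer_instance
  by_cases h : randomEdge μ e.idx {e' | ∀ (J : Idx ι k) (h : J.1 ⊂ e.idx.1),
      G.color J (e'.restrict h.1) = e.totalColor J h.1} = 0
  · rw [cond_eq_zero_of_meas_eq_zero h]
    simp
  · have := cond_isProbabilityMeasure h
    exact measureReal_le_one

/-- The densities of a complex exceed the densities required of a complex it embeds in. -/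
lemma lt_density_of_embedsComplex {V : ι → Type y} {S : ColoredComplex k C V}
    (G : ColoredGraph k C Ω) {ρ : ℕ → ℝ} (hS : ∀ e : S.VisibleEdge, ρ e.size < e.density G μ)
    {φ : PartMap W V} (hφ : B.EmbedsComplex S φ) (e : B.VisibleEdge) :
    ρ e.size < e.density G μ := by
  obtain ⟨⟨I, f⟩, h⟩ := e
  have key : ∀ (J : Idx ι k) (hJ : J.1 ⊆ I.1),
      B.color J (f.restrict hJ) = S.color J (Edge.restrict hJ (φ.mapEdge f)) := by
    intro J hJ
    obtain ⟨c, hc⟩ := Option.isSome_iff_exists.1 (B.visible_restrict I J hJ f h)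
    rw [hc]
    exact (hφ J _ c hc).symm
  have h' : (S.color I (φ.mapEdge f)).isSome := (key I subset_rfl) ▸ h
  rw [density_eq_of_color_eq μ G I f (φ.mapEdge f) h h' key]
  exact hS ⟨⟨I, φ.mapEdge f⟩, h'⟩

variable (B)

/-- The visible edges of size at most `j` with all vertices in `X`. -/
noncomputable def edgesIn (X : Finset (Vert W)) (j : ℕ) : Finset B.VisibleEdge :=
  Finset.univ.filter fun e => e.verts ⊆ X ∧ e.size ≤ j

/-- The visible edges of size at most `j` inside `T ∪ R` that are neither inside `T` nor
inside `R`. -/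
noncomputable def crossing (T R : Finset (Vert W)) (j : ℕ) : Finset B.VisibleEdge :=
  Finset.univ.filter fun e => (e.verts ⊆ T ∪ R ∧ e.size ≤ j) ∧ ¬ e.verts ⊆ T ∧ ¬ e.verts ⊆ R

lemma card_le_of_verts_subset (E : Finset B.VisibleEdge) (Z : Finset (Vert W))
    (h : ∀ e ∈ E, e.verts ⊆ Z) : E.card ≤ 2 ^ Z.card := by
  rw [← Finset.card_powerset]
  exact Finset.card_le_card_of_injOn verts (fun e he => Finset.mem_powerset.2 (h e he))
    (verts_injective.injOn)

lemma card_visibleEdge_le : Fintype.card B.VisibleEdge ≤ 2 ^ Fintype.card (Vert W) :=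
  card_le_of_verts_subset B Finset.univ Finset.univ fun _ _ => Finset.subset_univ _

/-- The edge products over `T ∪ R` split into the parts inside `T`, inside `R` and crossing. -/
lemma prod_edgesIn_union {M : Type*} [CommMonoid M] {T R : Finset (Vert W)} (h : Disjoint T R)
    (j : ℕ) (f : B.VisibleEdge → M) :
    ∏ e ∈ edgesIn B (T ∪ R) j, f e
      = (∏ e ∈ edgesIn B T j, f e) * (∏ e ∈ edgesIn B R j, f e)
        * ∏ e ∈ crossing B T R j, f e := by
  rw [← Finset.prod_union, ← Finset.prod_union]
  · congr 1
    ext e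
    simp only [edgesIn, crossing, Finset.mem_union, Finset.mem_filter, Finset.mem_univ, true_and]
    constructor
    · tauto
    · rintro ((⟨h1, h2⟩ | ⟨h1, h2⟩) | h1)
      · exact ⟨h1.trans Finset.subset_union_left, h2⟩
      · exact ⟨h1.trans Finset.subset_union_right, h2⟩
      · exact h1.1
  · rw [Finset.disjoint_left]
    simp only [edgesIn, crossing, Finset.mem_union, Finset.mem_filter, Finset.mem_univ, true_and]
    tauto
  · rw [Finset.disjoint_left]
    simp only [edgesIn, Finset.mem_filter, Finset.mem_univ, true_and]
    rintro e ⟨h1, -⟩ ⟨h2, -⟩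
    obtain ⟨a, ha⟩ := e.verts_nonempty
    exact Finset.disjoint_left.1 h (h1 ha) (h2 ha)

/-- The hypothesis of the counting lemma: small blowups have the expected embedding
probabilities. -/
def CountsBlowups {V : ι → Type y} (S : ColoredComplex k C V) (G : ColoredGraph k C Ω)
    (D n : ℕ) (η : ℕ → ℝ) : Prop :=
  ∀ (W : ι → Type w) [∀ i, Fintype (W i)] (S' : ColoredComplex k C W),
    S'.IsBlowup D S → Fintype.card (Vert W) ≤ n →
    ∃ t : S'.VisibleEdge → ℝ,
      (∀ e, max 0 ((1 - η e.size) * e.density G μ) ≤ t e ∧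
        t e ≤ min 1 ((1 + η e.size) * e.density G μ)) ∧
      embedProb μ S' G = ∏ e, t e

end Edges

/-- Bernoulli's inequality gives the lower bound; the upper bound is (1 + η) ^ M ≤ exp (M * η) ≤ 1 +
2 * M * η, valid as M * η ≤ 1. -/
lemma abs_prod_sub_prod_le {α : Type*} (E : Finset α) (t d : α → ℝ) {η : ℝ} {M : ℕ}
    (hη : 0 ≤ η) (hM : E.card ≤ M) (hMη : M * η ≤ 1) (hη1 : η ≤ 1) (hd : ∀ e ∈ E, 0 ≤ d e)
    (h1 : ∀ e ∈ E, (1 - η) * d e ≤ t e) (h2 : ∀ e ∈ E, t e ≤ (1 + η) * d e) :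
    |∏ e ∈ E, t e - ∏ e ∈ E, d e| ≤ 2 * M * η * ∏ e ∈ E, d e := by
  have hD : 0 ≤ ∏ e ∈ E, d e := Finset.prod_nonneg hd
  have l : (1 - η) ^ E.card * ∏ e ∈ E, d e ≤ ∏ e ∈ E, t e := by
    rw [← Finset.prod_const, ← Finset.prod_mul_distrib]
    exact Finset.prod_le_prod (fun e he => mul_nonneg (by linarith) (hd e he)) h1
  have u : ∏ e ∈ E, t e ≤ (1 + η) ^ E.card * ∏ e ∈ E, d e := by
    rw [← Finset.prod_const, ← Finset.prod_mul_distrib]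
    exact Finset.prod_le_prod
      (fun e he => (mul_nonneg (by linarith) (hd e he)).trans (h1 e he)) h2
  have hc : (E.card : ℝ) * η ≤ M * η := mul_le_mul_of_nonneg_right (by exact_mod_cast hM) hη
  have l' : 1 - M * η ≤ (1 - η) ^ E.card := by
    have := one_add_mul_le_pow (a := -η) (by linarith) E.card
    rw [← sub_eq_add_neg] at this
    linarith
  have u' : (1 + η) ^ E.card ≤ 1 + 2 * (M * η) := by
    calc (1 + η) ^ E.card ≤ Real.exp η ^ E.card :=
          pow_le_pow_left₀ (by linarith) (by linarith [Real.add_one_le_exp η]) _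
      _ = Real.exp (E.card * η) := (Real.exp_nat_mul _ _).symm
      _ ≤ Real.exp (M * η) := Real.exp_le_exp.2 hc
      _ ≤ 1 + 2 * (M * η) := by
          have h0 : 0 ≤ (M : ℝ) * η := by positivity
          have := Real.abs_exp_sub_one_le (x := M * η) (by rwa [abs_of_nonneg h0])
          rw [abs_of_nonneg h0] at this
          linarith [le_abs_self (Real.exp (M * η) - 1)]
  rw [abs_le]
  have h0 : 0 ≤ (M : ℝ) * η := by positivity
  constructor
  · nlinarith [mul_le_mul_of_nonneg_right l' hD]
  · nlinarith [mul_le_mul_of_nonneg_right u' hD]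

/-! ### The complex made of up to two copies of T and of R. -/

section Copies
open scoped Classical
open ColoredComplex ColoredComplex.VisibleEdge

variable {ι : Type u} [Fintype ι] {k : ℕ} {C : Idx ι k → Type x} {W : ι → Type w}
  [∀ i, Fintype (W i)] (B : ColoredComplex k C W)

/-- The vertices of the complex that consists of a copy of `T` for every element of `s` and of a
copy of `R` for every element of `t`. -/
def CopyVert (T R : Finset (Vert W)) (s t : Finset Bool) (i : ι) : Type w :=
  {p : W i × Bool // ((⟨i, p.1⟩ : Vert W) ∈ T ∧ p.2 ∈ s) ∨ ((⟨i, p.1⟩ : Vert W) ∈ R ∧ p.2 ∈ t)}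

noncomputable instance (T R : Finset (Vert W)) (s t : Finset Bool) (i : ι) :
    Fintype (CopyVert T R s t i) :=
  inferInstanceAs (Fintype {p : W i × Bool //
    ((⟨i, p.1⟩ : Vert W) ∈ T ∧ p.2 ∈ s) ∨ ((⟨i, p.1⟩ : Vert W) ∈ R ∧ p.2 ∈ t)})

variable (T R : Finset (Vert W)) (s t : Finset Bool) (j : ℕ)

/-- The complex of copies of `T` and `R`, in which any two copies of `T` and `R` are joined as in
`B` by edges of size at most `j`. -/
noncomputable def copies : ColoredComplex k C (CopyVert T R s t) where
  color I e :=
    if I.size ≤ j ∧ ∃ b c : Bool,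
        ∀ i : I.1, (e i).1.2 = if (⟨i.1, (e i).1.1⟩ : Vert W) ∈ T then b else c
    then B.color I fun i => (e i).1.1 else none
  visible_restrict I J h e := by
    intro he
    split_ifs at he with hI
    · obtain ⟨hI, b, c, hbc⟩ := hI
      rw [if_pos ⟨(Finset.card_le_card h).trans hI, b, c, fun i => hbc ⟨i.1, h i.2⟩⟩]
      exact B.visible_restrict I J h (fun i => (e i).1.1) he
    · simp at he

variable {T R s t j}

/-- The vertex of which a vertex of `copies` is a copy. -/
def CopyVert.base (a : Vert (CopyVert T R s t)) : W a.1 := a.2.1.1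

/-- The index of the copy that contains a vertex of `copies`. -/
def CopyVert.label (a : Vert (CopyVert T R s t)) : Bool := a.2.1.2

/-- The projection of the vertices of `copies`. -/
abbrev CopyVert.proj (a : Vert (CopyVert T R s t)) : Vert W := ⟨a.1, CopyVert.base a⟩

lemma copies_color_isSome {I : Idx ι k} {e : Edge (CopyVert T R s t) I}
    (h : ((copies B T R s t j).color I e).isSome) :
    (I.size ≤ j ∧ ∃ b c : Bool,
        ∀ i : I.1, (e i).1.2 = if (⟨i.1, (e i).1.1⟩ : Vert W) ∈ T then b else c) ∧
      (copies B T R s t j).color I e = B.color I fun i => (e i).1.1 := by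
  unfold copies at h ⊢
  dsimp only at h ⊢
  split_ifs at h with hI
  · exact ⟨hI, if_pos hI⟩
  · simp at h

variable {B}

/-- The projection of the visible edges of `copies`. -/
def projEdge (e : (copies B T R s t j).VisibleEdge) : B.VisibleEdge :=
  ⟨⟨e.1.1, fun i => (e.1.2 i).1.1⟩, by
    rw [← (copies_color_isSome B e.2).2]; exact e.2⟩

lemma CopyVert.ext {a b : Vert (CopyVert T R s t)} (h : CopyVert.proj a = CopyVert.proj b)
    (h' : CopyVert.label a = CopyVert.label b) : a = b := by
  obtain ⟨i, p, hp⟩ := a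
  obtain ⟨i', p', hp'⟩ := b
  simp only [CopyVert.proj, Sigma.mk.injEq] at h
  obtain ⟨rfl, h⟩ := h
  have : p = p' := Prod.ext (eq_of_heq h) h'
  subst this
  rfl

/-- A neighbor of a copied vertex projects to a neighbor of that vertex in B, and each vertex has at
most two copies; this doubles the degree. An embedding in S is obtained by composing with the
projection. -/
lemma copies_isBlowup {V : ι → Type y} {S : ColoredComplex k C V} {D : ℕ} (hB : B.IsBlowup D S) :
    (copies B T R s t j).IsBlowup (2 * D) S := by
  refine ⟨fun a => ?_, ?_⟩
  · refine le_trans ?_ (Nat.mul_le_mul_left 2 (hB.1 (CopyVert.proj a)))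
    unfold ColoredComplex.degree
    set Nb := {b : Vert W | b ≠ CopyVert.proj a ∧
      ∃ e : B.VisibleEdge, e.size = 2 ∧ e.Mem (CopyVert.proj a) ∧ e.Mem b}
    have : (Nb ×ˢ (Set.univ : Set Bool)).ncard = 2 * Nb.ncard := by
      rw [Set.ncard_prod, Set.ncard_univ]
      simp [mul_comm]
    rw [← this]
    refine Set.ncard_le_ncard_of_injOn (fun b => (CopyVert.proj b, CopyVert.label b)) ?_ ?_
      (Set.toFinite _)
    · rintro b ⟨hab, e, he, hea, heb⟩
      have hpa : (projEdge e).Mem (CopyVert.proj a) := by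
        obtain ⟨h, h'⟩ := hea
        exact ⟨h, congrArg (fun z => z.1.1) h'⟩
      have hpb : (projEdge e).Mem (CopyVert.proj b) := by
        obtain ⟨h, h'⟩ := heb
        exact ⟨h, congrArg (fun z => z.1.1) h'⟩
      refine ⟨⟨fun hp => hab ?_, projEdge e, he, hpa, hpb⟩, trivial⟩
      exact eq_of_mem_verts (mem_iff_mem_verts.1 heb) (mem_iff_mem_verts.1 hea)
        (show (CopyVert.proj b).1 = (CopyVert.proj a).1 from congrArg Sigma.fst hp)
    · exact fun b _ b' _ h => CopyVert.ext (congrArg Prod.fst h) (congrArg Prod.snd h)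
  · obtain ⟨φ, hφ⟩ := hB.2
    refine ⟨fun a => φ (CopyVert.proj a), fun I e c hc => ?_⟩
    have h := copies_color_isSome B (e := e) (I := I) (j := j) (by simp [hc])
    exact hφ I _ c (h.2 ▸ hc)

lemma card_copyVert_le :
    Fintype.card (Vert (CopyVert T R s t)) ≤ T.card * s.card + R.card * t.card := by
  rw [← Finset.card_product, ← Finset.card_product]
  refine le_trans ?_ (Finset.card_union_le _ _)
  rw [← Finset.card_univ]
  refine Finset.card_le_card_of_injOn (fun b => (CopyVert.proj b, CopyVert.label b)) ?_ ?_
  · rintro ⟨i, b, hb⟩ -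
    simpa [CopyVert.proj, CopyVert.base, CopyVert.label] using hb
  · exact fun b _ b' _ h => CopyVert.ext (congrArg Prod.fst h) (congrArg Prod.snd h)

/-- The condition under which the copy of `e` in the `b`-th copy of `T` and the `c`-th copy of `R`
is an edge of `copies`. -/
def Liftable (T R : Finset (Vert W)) (s t : Finset Bool) (j : ℕ) (e : B.VisibleEdge)
    (b c : Bool) : Prop :=
  e.size ≤ j ∧ ∀ a ∈ e.verts, (a ∈ T ∧ b ∈ s) ∨ (a ∉ T ∧ a ∈ R ∧ c ∈ t)

/-- The copy of the edge `e` in the `b`-th copy of `T` and the `c`-th copy of `R`. -/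
noncomputable def liftEdge (e : B.VisibleEdge) (b c : Bool) (h : Liftable T R s t j e b c) :
    (copies B T R s t j).VisibleEdge :=
  ⟨⟨e.1.1, fun i => ⟨(e.1.2 i, if (⟨i.1, e.1.2 i⟩ : Vert W) ∈ T then b else c), by
      rcases h.2 _ (mk_mem_verts e i) with ⟨h1, h2⟩ | ⟨h1, h2, h3⟩
      · exact Or.inl ⟨h1, by simpa [h1] using h2⟩
      · exact Or.inr ⟨h2, by simpa [h1] using h3⟩⟩⟩, by
    unfold copies
    dsimp only
    rw [if_pos ⟨h.1, b, c, fun i => rfl⟩]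
    exact e.2⟩

/-- The copies of `T` and `R` used by the copies of an edge; the label `false` is used for the
classes that the edge does not meet. -/
noncomputable def labels (T R : Finset (Vert W)) (s t : Finset Bool) (e : B.VisibleEdge) :
    Finset (Bool × Bool) :=
  (if e.verts ⊆ R then {false} else s) ×ˢ (if e.verts ⊆ T then {false} else t)

lemma liftable_of_mem_labels (hTR : Disjoint T R) {e : B.VisibleEdge}
    (he : e ∈ edgesIn B (T ∪ R) j) {p : Bool × Bool} (hp : p ∈ labels T R s t e) :
    Liftable T R s t j e p.1 p.2 := by
  simp only [edgesIn, Finset.mem_filter, Finset.mem_univ, true_and] at he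
  simp only [labels, Finset.mem_product] at hp
  refine ⟨he.2, fun a ha => ?_⟩
  by_cases haT : a ∈ T
  · refine Or.inl ⟨haT, ?_⟩
    have := hp.1
    rwa [if_neg fun h => Finset.disjoint_left.1 hTR haT (h ha)] at this
  · refine Or.inr ⟨haT, ?_, ?_⟩
    · exact (Finset.mem_union.1 (he.1 ha)).resolve_left haT
    · have := hp.2
      rwa [if_neg fun h => haT (h ha)] at this

/-- A product over the visible edges of `copies` in terms of the edges of `B`. -/
lemma prod_copies {M : Type*} [CommMonoid M] (hTR : Disjoint T R)
    (H : (copies B T R s t j).VisibleEdge → M) (h : B.VisibleEdge → Bool → Bool → M)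
    (hH : ∀ e b c (hl : Liftable T R s t j e b c), H (liftEdge e b c hl) = h e b c) :
    ∏ e, H e = ∏ e ∈ edgesIn B (T ∪ R) j, ∏ p ∈ labels T R s t e, h e p.1 p.2 := by
  rw [Finset.prod_sigma' (edgesIn B (T ∪ R) j) (fun e => labels T R s t e)
    (fun e p => h e p.1 p.2)]
  symm
  have hl : ∀ q ∈ (edgesIn B (T ∪ R) j).sigma (fun e => labels T R s t e),
      Liftable T R s t j q.1 q.2.1 q.2.2 := fun q hq =>
    liftable_of_mem_labels hTR (Finset.mem_sigma.1 hq).1 (Finset.mem_sigma.1 hq).2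
  -- The label of a class that e does not meet has no influence on the lifted edge. Fixing it to
  -- `false` in `labels` makes the correspondence injective.
  refine Finset.prod_bij (fun q hq => liftEdge q.1 q.2.1 q.2.2 (hl q hq))
    (fun _ _ => Finset.mem_univ _) ?_ ?_ fun q hq => (hH _ _ _ _).symm
  · rintro ⟨e, b, c⟩ hq ⟨e', b', c'⟩ hq' heq
    have he : e = e' := congrArg projEdge heq
    subst he
    have hq1 := (Finset.mem_sigma.1 hq).2
    have hq1' := (Finset.mem_sigma.1 hq').2
    have hE := (Finset.mem_filter.1 (Finset.mem_sigma.1 hq).1).2.1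
    simp only [labels, Finset.mem_product] at hq1 hq1'
    have hlab : ∀ i : e.1.1.1, (if (⟨i.1, e.1.2 i⟩ : Vert W) ∈ T then b else c)
        = if (⟨i.1, e.1.2 i⟩ : Vert W) ∈ T then b' else c' := by
      intro i
      have h1 := Subtype.ext_iff.1 heq
      have h2 := eq_of_heq (Sigma.mk.inj h1).2
      exact congrArg (fun z : CopyVert T R s t i.1 => z.1.2) (congrFun h2 i)
    have hb : b = b' := by
      by_cases h : e.verts ⊆ R
      · have h1 := hq1.1
        have h2 := hq1'.1
        rw [if_pos h, Finset.mem_singleton] at h1 h2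
        rw [h1, h2]
      · obtain ⟨a, ha, haR⟩ := Finset.not_subset.1 h
        obtain ⟨i, rfl⟩ := mem_verts.1 ha
        have := hlab i
        have haT := (Finset.mem_union.1 (hE ha)).resolve_right haR
        rwa [if_pos haT, if_pos haT] at this
    have hc : c = c' := by
      by_cases h : e.verts ⊆ T
      · have h1 := hq1.2
        have h2 := hq1'.2
        rw [if_pos h, Finset.mem_singleton] at h1 h2
        rw [h1, h2]
      · obtain ⟨a, ha, haT⟩ := Finset.not_subset.1 h
        obtain ⟨i, rfl⟩ := mem_verts.1 ha
        have := hlab i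
        rwa [if_neg haT, if_neg haT] at this
    rw [hb, hc]
  · intro e' _
    obtain ⟨⟨hj, b, c, hbc⟩, -⟩ := copies_color_isSome B e'.2
    set e := projEdge e' with he
    have hmem : ∀ i : e'.1.1.1, ((⟨i.1, (e'.1.2 i).1.1⟩ : Vert W) ∈ T ∧ (e'.1.2 i).1.2 ∈ s) ∨
        ((⟨i.1, (e'.1.2 i).1.1⟩ : Vert W) ∈ R ∧ (e'.1.2 i).1.2 ∈ t) := fun i => (e'.1.2 i).2
    have hq : (⟨e, (if e.verts ⊆ R then false else b, if e.verts ⊆ T then false else c)⟩ :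
        (_ : B.VisibleEdge) × (Bool × Bool)) ∈
        (edgesIn B (T ∪ R) j).sigma (fun e => labels T R s t e) := by
      simp only [Finset.mem_sigma, edgesIn, labels, Finset.mem_product, Finset.mem_filter,
        Finset.mem_univ, true_and]
      refine ⟨⟨fun a ha => ?_, hj⟩, ?_, ?_⟩
      · obtain ⟨i, rfl⟩ := mem_verts.1 ha
        rcases hmem i with h | h
        · exact Finset.mem_union_left _ h.1
        · exact Finset.mem_union_right _ h.1
      · split_ifs with h
        · simp
        · obtain ⟨a, ha, haR⟩ := Finset.not_subset.1 h
          obtain ⟨i, rfl⟩ := mem_verts.1 ha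
          rcases hmem i with h | h
          · have := h.2
            rwa [(hbc i).trans (if_pos h.1)] at this
          · exact absurd h.1 haR
      · split_ifs with h
        · simp
        · obtain ⟨a, ha, haT⟩ := Finset.not_subset.1 h
          obtain ⟨i, rfl⟩ := mem_verts.1 ha
          rcases hmem i with h | h
          · exact absurd h.1 haT
          · have := h.2
            rwa [(hbc i).trans (if_neg haT)] at this
    refine ⟨_, hq, ?_⟩
    refine Subtype.ext (Sigma.ext rfl (heq_of_eq (funext fun i => Subtype.ext (Prod.ext rfl ?_))))
    show (if (⟨i.1, (e'.1.2 i).1.1⟩ : Vert W) ∈ T then (if e.verts ⊆ R then false else b)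
      else (if e.verts ⊆ T then false else c)) = (e'.1.2 i).1.2
    have hi : (⟨i.1, (e'.1.2 i).1.1⟩ : Vert W) ∈ e.verts := mk_mem_verts e i
    rw [hbc i]
    by_cases hT : (⟨i.1, (e'.1.2 i).1.1⟩ : Vert W) ∈ T
    · rw [if_pos hT, if_pos hT, if_neg fun h => Finset.disjoint_left.1 hTR hT (h hi)]
    · rw [if_neg hT, if_neg hT, if_neg fun h => hT (h hi)]

/-- An edge inside T is copied once for each copy of T, an edge inside R once for each copy of R,
and a crossing edge once for each pair of copies. -/
lemma prod_labels {M : Type*} [CommMonoid M] (hTR : Disjoint T R)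
    (h : B.VisibleEdge → Bool → Bool → M) (f : Bool → B.VisibleEdge → M)
    (g : Bool → B.VisibleEdge → M)
    (hf : ∀ e ∈ edgesIn B T j, ∀ b c, h e b c = f b e)
    (hg : ∀ e ∈ edgesIn B R j, ∀ b c, h e b c = g c e) :
    ∏ e ∈ edgesIn B (T ∪ R) j, ∏ p ∈ labels T R s t e, h e p.1 p.2
      = (∏ b ∈ s, ∏ e ∈ edgesIn B T j, f b e) * (∏ c ∈ t, ∏ e ∈ edgesIn B R j, g c e)
        * ∏ b ∈ s, ∏ c ∈ t, ∏ e ∈ crossing B T R j, h e b c := by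
  have hne : ∀ e : B.VisibleEdge, e.verts ⊆ T → e.verts ⊆ R → False := by
    intro e h1 h2
    obtain ⟨a, ha⟩ := e.verts_nonempty
    exact Finset.disjoint_left.1 hTR (h1 ha) (h2 ha)
  rw [prod_edgesIn_union B hTR]
  congr 1
  · congr 1
    · rw [Finset.prod_comm]
      refine Finset.prod_congr rfl fun e he => ?_
      have h1 := (Finset.mem_filter.1 he).2.1
      rw [labels, if_pos h1, if_neg fun h2 => hne e h1 h2, Finset.prod_product]
      refine Finset.prod_congr rfl fun b _ => ?_
      simp [hf e he]
    · rw [Finset.prod_comm]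
      refine Finset.prod_congr rfl fun e he => ?_
      have h1 := (Finset.mem_filter.1 he).2.1
      rw [labels, if_pos h1, if_neg fun h2 => hne e h2 h1, Finset.prod_product]
      simp [hg e he]
  · have : ∀ e ∈ crossing B T R j, ∏ p ∈ labels T R s t e, h e p.1 p.2
        = ∏ b ∈ s, ∏ c ∈ t, h e b c := by
      intro e he
      have h1 := (Finset.mem_filter.1 he).2.2
      rw [labels, if_neg h1.1, if_neg h1.2, Finset.prod_product]
    rw [Finset.prod_congr rfl this, Finset.prod_comm]
    refine Finset.prod_congr rfl fun b _ => Finset.prod_comm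

end Copies

/-! ### Embedding probabilities of copies as mixed moments. -/

section CopyExpect
open scoped Classical
open ColoredComplex ColoredComplex.VisibleEdge

variable {ι : Type u} [Fintype ι] {k : ℕ} {C : Idx ι k → Type x} {W : ι → Type w}
  [∀ i, Fintype (W i)] {B : ColoredComplex k C W}
  {Ω : ι → Type v} [∀ i, Fintype (Ω i)]
  [∀ i, MeasurableSpace (Ω i)] [∀ i, DiscreteMeasurableSpace (Ω i)]
  (μ : (i : ι) → Measure (Ω i)) [∀ i, IsProbabilityMeasure (μ i)]
  {T R : Finset (Vert W)} {s t : Finset Bool} {j : ℕ}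

/-- The map on the copies of `T` and `R` given by one map for each copy. -/
noncomputable def assemble (x y : Bool → PartMap W Ω) : PartMap (CopyVert T R s t) Ω :=
  fun a => if CopyVert.proj a ∈ T then x (CopyVert.label a) (CopyVert.proj a)
    else y (CopyVert.label a) (CopyVert.proj a)

lemma mapExpect_copies (f : PartMap (CopyVert T R s t) Ω → ℝ) :
    mapExpect μ f = mapExpect μ fun x₀ : PartMap W Ω => mapExpect μ fun x₁ : PartMap W Ω =>
      mapExpect μ fun y₀ : PartMap W Ω => mapExpect μ fun y₁ : PartMap W Ω =>
        f (assemble (fun b => cond b x₁ x₀) (fun b => cond b y₁ y₀)) := by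
  have key : ∀ (P : Vert (CopyVert T R s t) → Prop) (b : Bool) 
      (g : PartMap (CopyVert T R s t) Ω → ℝ),
      mapExpect μ g = mapExpect μ fun x : PartMap W Ω => mapExpect μ fun y =>
        g (fun a => if P a ∧ CopyVert.label a = b then x (CopyVert.proj a) else y a) := by
    intro P b g
    rw [mapExpect_glue μ (W := W) (Finset.univ.filter fun a => P a ∧ CopyVert.label a = b)
      (fun a _ => CopyVert.base a)
      (fun a a' ha ha' h => CopyVert.ext h
        ((Finset.mem_filter.1 ha).2.2.trans (Finset.mem_filter.1 ha').2.2.symm)) g]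
    congr 1; ext x; congr 1; ext y; congr 1
    funext a
    by_cases h : P a ∧ CopyVert.label a = b
    · rw [if_pos h, glue, dif_pos (by simpa using h)]
    · rw [if_neg h, glue, dif_neg (by simpa using h)]
  -- The four pairs (class, label) are resampled in turn. Together they exhaust the vertices, so the
  -- original map `z` no longer occurs and is integrated out at the end.
  rw [key (fun a => CopyVert.proj a ∈ T) false]
  congr 1; ext x₀
  rw [key (fun a => CopyVert.proj a ∈ T) true]
  congr 1; ext x₁
  rw [key (fun a => CopyVert.proj a ∉ T) false]
  congr 1; ext y₀
  rw [key (fun a => CopyVert.proj a ∉ T) true]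
  congr 1; ext y₁
  refine Eq.trans ?_ ((isWeight_mapWeight μ (W := CopyVert T R s t)).expect_const _)
  congr 1; ext z; congr 1
  funext a
  unfold assemble
  by_cases h : CopyVert.proj a ∈ T <;> cases h' : CopyVert.label a <;> simp [h, h']

variable (G : ColoredGraph k C Ω)

lemma ok_liftEdge (e : B.VisibleEdge) (b c : Bool) (h : Liftable T R s t j e b c)
    (x y : Bool → PartMap W Ω) :
    (liftEdge e b c h).ok G (assemble x y) = e.ok G (mix T (x b) (y c)) := by
  have h1 : PartMap.mapEdge (assemble x y) (liftEdge e b c h).1.2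
      = (mix T (x b) (y c)).mapEdge e.1.2 := by
    funext i
    show (if (⟨i.1, e.1.2 i⟩ : Vert W) ∈ T then
        x (if (⟨i.1, e.1.2 i⟩ : Vert W) ∈ T then b else c) ⟨i.1, e.1.2 i⟩ else
        y (if (⟨i.1, e.1.2 i⟩ : Vert W) ∈ T then b else c) ⟨i.1, e.1.2 i⟩)
      = if (⟨i.1, e.1.2 i⟩ : Vert W) ∈ T then x b ⟨i.1, e.1.2 i⟩ else y c ⟨i.1, e.1.2 i⟩
    split_ifs <;> rfl
  have h2 := (copies_color_isSome B (liftEdge e b c h).2).2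
  unfold ok
  rw [h1, h2]
  rfl

lemma density_projEdge (e : (copies B T R s t j).VisibleEdge) :
    e.density G μ = (projEdge e).density G μ := by
  obtain ⟨⟨I, f⟩, h⟩ := e
  exact density_eq_of_color_eq μ G I f _ h _ fun J hJ =>
    (copies_color_isSome B ((copies B T R s t j).visible_restrict I J hJ f h)).2

/-- The product of the densities of the edges in `E`. -/
noncomputable def dens (E : Finset B.VisibleEdge) : ℝ := ∏ e ∈ E, e.density G μ

/-- The indicator of the event that a map preserves the colors of the edges in `E`. -/
noncomputable def okProd (E : Finset B.VisibleEdge) (φ : PartMap W Ω) : ℝ := ∏ e ∈ E, e.ok G φ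

variable (B T R j) in
/-- The expected number of embedded copies of `T` and `R`. -/
noncomputable def copyExpect (s t : Finset Bool) : ℝ :=
  mapExpect μ fun x₀ : PartMap W Ω => mapExpect μ fun x₁ : PartMap W Ω =>
      mapExpect μ fun y₀ : PartMap W Ω => mapExpect μ fun y₁ : PartMap W Ω =>
        (∏ b ∈ s, okProd G (edgesIn B T j) (cond b x₁ x₀))
          * (∏ c ∈ t, okProd G (edgesIn B R j) (cond c y₁ y₀))
          * ∏ b ∈ s, ∏ c ∈ t, okProd G (crossing B T R j) (mix T (cond b x₁ x₀) (cond c y₁ y₀))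

lemma embedProb_copies (hTR : Disjoint T R) :
    embedProb μ (copies B T R s t j) G = copyExpect B μ T R j G s t := by
  rw [embedProb_eq, mapExpect_copies, copyExpect]
  congr 1; ext x₀; congr 1; ext x₁; congr 1; ext y₀; congr 1; ext y₁
  set x : Bool → PartMap W Ω := fun b => cond b x₁ x₀
  set y : Bool → PartMap W Ω := fun b => cond b y₁ y₀
  rw [prod_copies hTR _ (fun e b c => e.ok G (mix T (x b) (y c)))
    (fun e b c h => ok_liftEdge G e b c h x y),
    prod_labels hTR (fun e b c => e.ok G (mix T (x b) (y c))) (fun b e => e.ok G (x b))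
      (fun c e => e.ok G (y c))]
  · rfl
  · intro e he b c
    refine ok_congr G e fun a ha => ?_
    simp [mix, (Finset.mem_filter.1 he).2.1 ha]
  · intro e he b c
    refine ok_congr G e fun a ha => ?_
    simp [mix, Finset.disjoint_right.1 hTR ((Finset.mem_filter.1 he).2.1 ha)]

lemma prod_density_copies (hTR : Disjoint T R) :
    ∏ e : (copies B T R s t j).VisibleEdge, e.density G μ
      = dens μ G (edgesIn B T j) ^ s.card * dens μ G (edgesIn B R j) ^ t.card
        * dens μ G (crossing B T R j) ^ (s.card * t.card) := by
  rw [prod_copies hTR _ (fun e _ _ => e.density G μ)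
    (fun e b c h => density_projEdge μ G (liftEdge e b c h)),
    prod_labels hTR (fun e _ _ => e.density G μ) (fun _ e => e.density G μ)
      (fun _ e => e.density G μ) (fun _ _ _ _ => rfl) (fun _ _ _ _ => rfl)]
  simp only [Finset.prod_const]
  rw [mul_comm s.card, pow_mul]
  rfl

/-- Small configurations of copies of `T` and `R` have the expected frequencies. -/
lemma abs_copyExpect_sub_le {V : ι → Type y} {S : ColoredComplex k C V} {D n M : ℕ} {η : ℕ → ℝ}
    (hcount : CountsBlowups.{u, v, w, x, y} μ S G (2 * D) n η) (hB : B.IsBlowup D S)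
    (hTR : Disjoint T R) (hn : T.card * s.card + R.card * t.card ≤ n) (hM : 2 ^ n ≤ M)
    {θ : ℝ} (hθ : 0 ≤ θ) (hθ1 : θ ≤ 1) (hMθ : M * θ ≤ 1) (hη : ∀ i ∈ Set.Icc 1 j, η i ≤ θ) :
    |copyExpect B μ T R j G s t - dens μ G (edgesIn B T j) ^ s.card
        * dens μ G (edgesIn B R j) ^ t.card * dens μ G (crossing B T R j) ^ (s.card * t.card)|
      ≤ 2 * M * θ * (dens μ G (edgesIn B T j) ^ s.card
        * dens μ G (edgesIn B R j) ^ t.card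
        * dens μ G (crossing B T R j) ^ (s.card * t.card)) := by
  obtain ⟨τ, hτ, hp⟩ := hcount _ (copies B T R s t j) (copies_isBlowup hB)
    (card_copyVert_le.trans hn)
  rw [← embedProb_copies μ G hTR, ← prod_density_copies μ G hTR, hp]
  have hle : ∀ e : (copies B T R s t j).VisibleEdge, η e.size ≤ θ := fun e =>
    hη _ ⟨e.one_le_size, (copies_color_isSome B e.2).1.1⟩
  refine abs_prod_sub_prod_le _ _ _ hθ ?_ hMθ hθ1 (fun e _ => density_nonneg μ G e) ?_ ?_
  · rw [Finset.card_univ]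
    exact (card_visibleEdge_le _).trans
      ((Nat.pow_le_pow_right (by norm_num) (card_copyVert_le.trans hn)).trans hM)
  · intro e _
    have h0 := density_nonneg μ G e
    have h1 := (le_max_right _ _).trans (hτ e).1
    nlinarith [hle e]
  · intro e _
    have h0 := density_nonneg μ G e
    have h1 := (hτ e).2.trans (min_le_right _ _)
    nlinarith [hle e]

end CopyExpect

/-! ### Edge products, neighborhoods and the moments needed for concentration. -/

section EdgeProducts
open scoped Classical
open ColoredComplex ColoredComplex.VisibleEdge

variable {ι : Type u} [Fintype ι] {k : ℕ} {C : Idx ι k → Type x} {W : ι → Type w}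
  [∀ i, Fintype (W i)] {B : ColoredComplex k C W}
  {Ω : ι → Type v} [∀ i, Fintype (Ω i)]
  [∀ i, MeasurableSpace (Ω i)] [∀ i, DiscreteMeasurableSpace (Ω i)]
  (μ : (i : ι) → Measure (Ω i)) [∀ i, IsProbabilityMeasure (μ i)]
  {T R X : Finset (Vert W)} {s t : Finset Bool} {i j : ℕ} (G : ColoredGraph k C Ω)

/-- Indicators are idempotent, so the two edge sets may overlap. Comparisons of events thereby
become inclusions of edge sets, through `okProd_anti`. -/
lemma okProd_mul (E E' : Finset B.VisibleEdge) (φ : PartMap W Ω) :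
    okProd G E φ * okProd G E' φ = okProd G (E ∪ E') φ := by
  unfold okProd ok
  simp only [Finset.prod_boole]
  simp only [Finset.mem_union, or_imp, forall_and]
  split_ifs <;> simp_all

lemma okProd_nonneg (E : Finset B.VisibleEdge) (φ : PartMap W Ω) : 0 ≤ okProd G E φ :=
  Finset.prod_nonneg fun e _ => ok_nonneg G e φ

lemma okProd_le_one (E : Finset B.VisibleEdge) (φ : PartMap W Ω) : okProd G E φ ≤ 1 :=
  Finset.prod_le_one (fun e _ => ok_nonneg G e φ) fun e _ => ok_le_one G e φ

lemma okProd_anti {E E' : Finset B.VisibleEdge} (h : E ⊆ E') (φ : PartMap W Ω) :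
    okProd G E' φ ≤ okProd G E φ := by
  rw [← Finset.union_eq_right.2 h, ← okProd_mul]
  exact mul_le_of_le_one_right (okProd_nonneg G E φ) (okProd_le_one G E' φ)

lemma okProd_congr {E : Finset B.VisibleEdge} {φ φ' : PartMap W Ω}
    (h : ∀ e ∈ E, ∀ a ∈ e.verts, φ a = φ' a) : okProd G E φ = okProd G E φ' :=
  Finset.prod_congr rfl fun e he => ok_congr G e (h e he)

lemma mem_edgesIn {e : B.VisibleEdge} : e ∈ edgesIn B X j ↔ e.verts ⊆ X ∧ e.size ≤ j := by
  simp [edgesIn]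

lemma mem_crossing {e : B.VisibleEdge} : e ∈ crossing B T R j ↔
    (e.verts ⊆ T ∪ R ∧ e.size ≤ j) ∧ ¬ e.verts ⊆ T ∧ ¬ e.verts ⊆ R := by
  simp [crossing]

lemma edgesIn_mono {X' : Finset (Vert W)} {j' : ℕ} (h : X ⊆ X') (hj : j ≤ j') :
    edgesIn B X j ⊆ edgesIn B X' j' := fun _ he =>
  mem_edgesIn.2 ⟨(mem_edgesIn.1 he).1.trans h, (mem_edgesIn.1 he).2.trans hj⟩

lemma edgesIn_zero : edgesIn B X 0 = ∅ := by
  ext e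
  have := e.one_le_size
  simp only [mem_edgesIn, Finset.notMem_empty, iff_false]
  omega

lemma crossing_zero : crossing B T R 0 = ∅ := by
  ext e
  have := e.one_le_size
  simp only [mem_crossing, Finset.notMem_empty, iff_false]
  omega

lemma okProd_edgesIn_congr {φ φ' : PartMap W Ω} (h : ∀ a ∈ X, φ a = φ' a) :
    okProd G (edgesIn B X j) φ = okProd G (edgesIn B X j) φ' :=
  okProd_congr G fun _ he a ha => h a ((mem_edgesIn.1 he).1 ha)

lemma okProd_crossing_congr {φ φ' : PartMap W Ω} (h : ∀ a ∈ T ∪ R, φ a = φ' a) :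
    okProd G (crossing B T R j) φ = okProd G (crossing B T R j) φ' :=
  okProd_congr G fun _ he a ha => h a ((mem_crossing.1 he).1.1 ha)

lemma okProd_edgesIn_union (h : Disjoint T R) (φ : PartMap W Ω) :
    okProd G (edgesIn B (T ∪ R) j) φ = okProd G (edgesIn B T j) φ * okProd G (edgesIn B R j) φ
      * okProd G (crossing B T R j) φ :=
  prod_edgesIn_union B h j _

lemma dens_edgesIn_union (h : Disjoint T R) :
    dens μ G (edgesIn B (T ∪ R) j) = dens μ G (edgesIn B T j) * dens μ G (edgesIn B R j)
      * dens μ G (crossing B T R j) :=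
  prod_edgesIn_union B h j _

lemma dens_nonneg (E : Finset B.VisibleEdge) : 0 ≤ dens μ G E :=
  Finset.prod_nonneg fun e _ => density_nonneg μ G e

lemma dens_le_one (E : Finset B.VisibleEdge) : dens μ G E ≤ 1 :=
  Finset.prod_le_one (fun e _ => density_nonneg μ G e) fun e _ => density_le_one μ G e

lemma dens_union {E E' : Finset B.VisibleEdge} (h : Disjoint E E') :
    dens μ G (E ∪ E') = dens μ G E * dens μ G E' := Finset.prod_union h

lemma dens_anti {E E' : Finset B.VisibleEdge} (h : E ⊆ E') : dens μ G E' ≤ dens μ G E := by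
  rw [← Finset.union_sdiff_of_subset h, dens_union μ G Finset.disjoint_sdiff]
  exact mul_le_of_le_one_right (dens_nonneg μ G E) (dens_le_one μ G _)

/-- Two vertices are adjacent if they lie on a common visible edge. -/
def Adj (B : ColoredComplex k C W) (a b : Vert W) : Prop :=
  ∃ e : B.VisibleEdge, a ∈ e.verts ∧ b ∈ e.verts

/-- The degree only sees edges of size two, but in a complex the pair {a, b} inside a visible edge
is itself visible. -/
lemma card_adj_le (a : Vert W) :
    (Finset.univ.filter fun b => b ≠ a ∧ Adj B a b).card ≤ B.degree a := by
  unfold ColoredComplex.degree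
  rw [← Set.ncard_coe_finset]
  refine Set.ncard_le_ncard ?_ (Set.toFinite _)
  intro b hb
  obtain ⟨hba, e, ha, hb⟩ := (Finset.mem_filter.1 (Finset.mem_coe.1 hb)).2
  have hne : a.1 ≠ b.1 := fun h => hba (eq_of_mem_verts hb ha h.symm)
  obtain ⟨ha1, ha2⟩ := mem_iff_mem_verts.2 ha
  obtain ⟨hb1, hb2⟩ := mem_iff_mem_verts.2 hb
  have hsub : ({a.1, b.1} : Finset ι) ⊆ e.idx.1 := by
    intro i hi
    rcases Finset.mem_insert.1 hi with rfl | hi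
    · exact ha1
    · rw [Finset.mem_singleton.1 hi]; exact hb1
  have hcard : ({a.1, b.1} : Finset ι).card = 2 := Finset.card_pair hne
  let J : Idx ι k := ⟨{a.1, b.1}, ⟨a.1, by simp⟩, (Finset.card_le_card hsub).trans e.idx.2.2⟩
  exact ⟨hba, ⟨⟨J, Edge.restrict (J := J) hsub e.1.2⟩, B.visible_restrict _ J hsub _ e.2⟩, hcard,
    ⟨by simp [J, VisibleEdge.idx], ha2⟩, ⟨by simp [J, VisibleEdge.idx], hb2⟩⟩

/-- The neighbors of `T` in `X`. -/
noncomputable def nbrs (B : ColoredComplex k C W) (T X : Finset (Vert W)) : Finset (Vert W) :=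
  (X \ T).filter fun b => ∃ a ∈ T, Adj B a b

lemma nbrs_subset : nbrs B T X ⊆ X \ T := Finset.filter_subset _ _

lemma disjoint_nbrs : Disjoint T (nbrs B T X) :=
  Finset.disjoint_of_subset_right nbrs_subset Finset.disjoint_sdiff

lemma card_nbrs_le {Δ : ℕ} (h : ∀ a, B.degree a ≤ Δ) : (nbrs B T X).card ≤ T.card * Δ := by
  have : nbrs B T X ⊆ T.biUnion fun a => Finset.univ.filter fun b => b ≠ a ∧ Adj B a b := by
    intro b hb
    obtain ⟨hb, a, ha, hab⟩ := Finset.mem_filter.1 hb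
    refine Finset.mem_biUnion.2 ⟨a, ha, Finset.mem_filter.2 ⟨Finset.mem_univ _, ?_, hab⟩⟩
    rintro rfl
    exact (Finset.mem_sdiff.1 hb).2 ha
  exact (Finset.card_le_card this).trans
    (Finset.card_biUnion_le_card_mul _ _ _ fun a _ => (card_adj_le a).trans (h a))

/-- An edge in `X` that meets `T` is contained in `T` and its neighbors. -/
lemma verts_subset_union_nbrs {e : B.VisibleEdge} (h : e.verts ⊆ X) {a : Vert W}
    (ha : a ∈ e.verts) (haT : a ∈ T) : e.verts ⊆ T ∪ nbrs B T X := by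
  intro b hb
  by_cases hbT : b ∈ T
  · exact Finset.mem_union_left _ hbT
  · exact Finset.mem_union_right _ (Finset.mem_filter.2
      ⟨Finset.mem_sdiff.2 ⟨h hb, hbT⟩, a, haT, e, ha, hb⟩)

/-- This locality is what replaces the unbounded set X ∖ T by a set of bounded size. -/
lemma crossing_sdiff (hT : T ⊆ X) : crossing B T (X \ T) j = crossing B T (nbrs B T X) j := by
  ext e
  simp only [mem_crossing, Finset.union_sdiff_of_subset hT]
  constructor
  · rintro ⟨⟨h1, h2⟩, h3, h4⟩
    obtain ⟨a, ha, haX⟩ := Finset.not_subset.1 h4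
    have haT : a ∈ T := by
      by_contra h
      exact haX (Finset.mem_sdiff.2 ⟨h1 ha, h⟩)
    exact ⟨⟨verts_subset_union_nbrs h1 ha haT, h2⟩, h3, fun h => h4 (h.trans nbrs_subset)⟩
  · rintro ⟨⟨h1, h2⟩, h3, h4⟩
    refine ⟨⟨h1.trans (Finset.union_subset hT (nbrs_subset.trans Finset.sdiff_subset)), h2⟩, h3,
      fun h => ?_⟩
    refine h4 fun a ha => (Finset.mem_union.1 (h1 ha)).resolve_left ?_
    exact (Finset.mem_sdiff.1 (h ha)).2

section Moments

variable (B T R j)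

/-- This lemma and the next five rewrite the counts of copies in the form of the hypotheses of
`concentration`; the numbers in the names are those of the copies of T and of R. -/
lemma copyExpect_one_zero : copyExpect B μ T R j G {false} ∅
    = mapExpect μ (okProd G (edgesIn B T j)) := by
  simp [copyExpect, mapExpect, (isWeight_mapWeight μ (W := W)).expect_const]

lemma copyExpect_zero_one : copyExpect B μ T R j G ∅ {false}
    = mapExpect μ (okProd G (edgesIn B R j)) := by
  simp [copyExpect, mapExpect, (isWeight_mapWeight μ (W := W)).expect_const]

lemma copyExpect_one_one : copyExpect B μ T R j G {false} {false}
    = mapExpect μ fun x => mapExpect μ fun y => okProd G (edgesIn B T j) x *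
      (okProd G (edgesIn B R j) y * okProd G (crossing B T R j) (mix T x y)) := by
  simp [copyExpect, mapExpect, (isWeight_mapWeight μ (W := W)).expect_const, mul_assoc]

lemma copyExpect_one_two : copyExpect B μ T R j G {false} {false, true}
    = mapExpect μ fun x => mapExpect μ fun y => mapExpect μ fun y' =>
      okProd G (edgesIn B T j) x *
      ((okProd G (edgesIn B R j) y * okProd G (crossing B T R j) (mix T x y)) *
        (okProd G (edgesIn B R j) y' * okProd G (crossing B T R j) (mix T x y'))) := by
  simp only [copyExpect, mapExpect, Finset.prod_singleton, Finset.prod_pair Bool.false_ne_true,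
    cond_true, cond_false, (isWeight_mapWeight μ (W := W)).expect_const]
  congr 1; ext x; congr 1; ext y; congr 1; ext y'
  ring

lemma copyExpect_two_one : copyExpect B μ T R j G {false, true} {false}
    = mapExpect μ fun x => mapExpect μ fun x' => mapExpect μ fun y =>
      (okProd G (edgesIn B T j) x * okProd G (edgesIn B T j) x') *
        (okProd G (edgesIn B R j) y * (okProd G (crossing B T R j) (mix T x y) *
          okProd G (crossing B T R j) (mix T x' y))) := by
  simp only [copyExpect, mapExpect, Finset.prod_singleton, Finset.prod_pair Bool.false_ne_true,
    cond_true, cond_false, (isWeight_mapWeight μ (W := W)).expect_const]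
  congr 1; ext x; congr 1; ext x'; congr 1; ext y
  ring

lemma copyExpect_two_two : copyExpect B μ T R j G {false, true} {false, true}
    = mapExpect μ fun x => mapExpect μ fun x' => mapExpect μ fun y => mapExpect μ fun y' =>
      (okProd G (edgesIn B T j) x * okProd G (edgesIn B T j) x') *
        ((okProd G (edgesIn B R j) y * (okProd G (crossing B T R j) (mix T x y) *
          okProd G (crossing B T R j) (mix T x' y))) *
        (okProd G (edgesIn B R j) y' * (okProd G (crossing B T R j) (mix T x y') *
          okProd G (crossing B T R j) (mix T x' y')))) := by
  simp only [copyExpect, mapExpect, Finset.prod_pair Bool.false_ne_true,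
    cond_true, cond_false]
  congr 1; ext x; congr 1; ext x'; congr 1; ext y; congr 1; ext y'
  ring

end Moments

/-- The probability that the subcomplex on `X` is embedded. -/
noncomputable def prob (B : ColoredComplex k C W) (X : Finset (Vert W)) : ℝ :=
  mapExpect μ (okProd G (edgesIn B X k))

lemma prob_nonneg (X : Finset (Vert W)) : 0 ≤ prob μ G B X :=
  (isWeight_mapWeight μ).expect_nonneg fun _ => okProd_nonneg G _ _

lemma prob_empty : prob μ G B ∅ = 1 := by
  have : edgesIn B ∅ k = ∅ := by
    ext e
    simp only [mem_edgesIn, Finset.notMem_empty, iff_false, Finset.subset_empty]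
    exact fun h => e.verts_nonempty.ne_empty h.1
  unfold prob
  rw [this]
  exact (isWeight_mapWeight μ).expect_const 1

end EdgeProducts

/-! ### Regular complexes, and rare events on small sets. -/

section Transfer
open scoped Classical
open ColoredComplex ColoredComplex.VisibleEdge

variable {ι : Type u} [Fintype ι] {k : ℕ} {C : Idx ι k → Type x} {W : ι → Type w}
  [∀ i, Fintype (W i)] {B : ColoredComplex k C W}
  {Ω : ι → Type v} [∀ i, Fintype (Ω i)]
  [∀ i, MeasurableSpace (Ω i)] [∀ i, DiscreteMeasurableSpace (Ω i)]
  {μ : (i : ι) → Measure (Ω i)} [∀ i, IsProbabilityMeasure (μ i)]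
  {T R X : Finset (Vert W)} {i j : ℕ} {G : ColoredGraph k C Ω}
  {Δ n M : ℕ} {ρ τ : ℕ → ℝ}

/-- The quantitative assumptions on a complex `B` of bounded degree: configurations of at most
`2 * n` vertices have the expected frequencies, and the densities are bounded from below. -/
structure Regular (B : ColoredComplex k C W) (μ : (i : ι) → Measure (Ω i))
    (G : ColoredGraph k C Ω) (Δ n M : ℕ) (ρ τ : ℕ → ℝ) : Prop where
  count : ∀ (T R : Finset (Vert W)) (s t : Finset Bool) (i j : ℕ), Disjoint T R →
    T.card * s.card + R.card * t.card ≤ 2 * n → 1 ≤ j → j ≤ k → i ≤ j →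
    |copyExpect B μ T R i G s t - dens μ G (edgesIn B T i) ^ s.card
        * dens μ G (edgesIn B R i) ^ t.card * dens μ G (crossing B T R i) ^ (s.card * t.card)|
      ≤ τ j ^ 8 * (dens μ G (edgesIn B T i) ^ s.card
        * dens μ G (edgesIn B R i) ^ t.card
        * dens μ G (crossing B T R i) ^ (s.card * t.card))
  lt_density : ∀ e : B.VisibleEdge, ρ e.size < e.density G μ
  degree_le : ∀ a, B.degree a ≤ Δ
  rho_pos : ∀ i ∈ Set.Icc 1 k, 0 < ρ i
  rho_mono : MonotoneOn ρ (Set.Icc 1 k)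
  rho_le_one : ∀ i ∈ Set.Icc 1 k, ρ i ≤ 1
  tau_pos : ∀ i ∈ Set.Icc 1 k, 0 < τ i
  tau_le_one : ∀ i ∈ Set.Icc 1 k, τ i ≤ 1
  card_le : 2 ^ ((Δ + 1) * n) ≤ M

namespace Regular

variable (h : Regular B μ G Δ n M ρ τ)
include h

lemma density_pos (e : B.VisibleEdge) : 0 < e.density G μ :=
  (h.rho_pos _ ⟨e.one_le_size, e.size_le⟩).trans (h.lt_density e)

lemma dens_pos (E : Finset B.VisibleEdge) : 0 < dens μ G E :=
  Finset.prod_pos fun e _ => h.density_pos e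

/-- Dropping edges of size at least `j` near a small set changes the product of the densities by
a factor that depends on `ρ j` only. -/
lemma dens_mul_rho_pow_le {Z : Finset (Vert W)} (hj : 1 ≤ j) (hjk : j ≤ k)
    {E E' : Finset B.VisibleEdge} (hE : E ⊆ E') (hsize : ∀ e ∈ E', e ∉ E → j ≤ e.size)
    (hZ : Z.card ≤ (Δ + 1) * n) (hEZ : ∀ e ∈ E', e.verts ⊆ Z) :
    dens μ G E * ρ j ^ M ≤ dens μ G E' := by
  have hρ := h.rho_pos j ⟨hj, hjk⟩
  -- All edges of E' lie in the small set Z, so at most M of them were dropped; each has density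
  -- above ρ at its own size, hence above ρ j by monotonicity.
  have hcard : (E' \ E).card ≤ M :=
    (card_le_of_verts_subset B (E' \ E) Z fun e he => hEZ e (Finset.mem_sdiff.1 he).1).trans
      ((Nat.pow_le_pow_right (by norm_num) hZ).trans h.card_le)
  rw [← Finset.union_sdiff_of_subset hE, dens_union μ G Finset.disjoint_sdiff]
  refine mul_le_mul_of_nonneg_left ?_ (dens_nonneg μ G E)
  calc ρ j ^ M ≤ ρ j ^ (E' \ E).card :=
        pow_le_pow_of_le_one hρ.le (h.rho_le_one j ⟨hj, hjk⟩) hcard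
    _ ≤ dens μ G (E' \ E) := by
        rw [← Finset.prod_const]
        refine Finset.prod_le_prod (fun _ _ => hρ.le) fun e he => ?_
        have he := Finset.mem_sdiff.1 he
        have hje := hsize e he.1 he.2
        exact (h.rho_mono ⟨hj, hjk⟩ ⟨e.one_le_size, e.size_le⟩ hje).trans (h.lt_density e).le

end Regular

variable (μ G) in
/-- The probability of embedding the complex on `X` is at least half of what is expected given
the probability of embedding it without `a`. -/
def Extends (B : ColoredComplex k C W) (X : Finset (Vert W)) (a : Vert W) : Prop :=
  1 / 2 * dens μ G (edgesIn B X k \ edgesIn B (X.erase a) k) * prob μ G B (X.erase a)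
    ≤ prob μ G B X

/-- Removing several vertices one after the other. -/
lemma prob_sdiff_le (R X : Finset (Vert W)) (hR : R ⊆ X)
    (hext : ∀ Y ⊆ X, ∀ a ∈ Y, Extends μ G B Y a) :
    (1 / 2) ^ R.card * dens μ G (edgesIn B X k \ edgesIn B (X \ R) k) * prob μ G B (X \ R)
      ≤ prob μ G B X := by
  induction R using Finset.induction_on with
  | empty => simp [dens]
  | insert a R ha ih =>
    have haX : a ∈ X := hR (Finset.mem_insert_self a R)
    have ih := ih fun b hb => hR (Finset.mem_insert_of_mem hb)
    have hX : X \ insert a R = (X \ R).erase a := by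
      ext b; simp only [Finset.mem_sdiff, Finset.mem_insert, Finset.mem_erase]; tauto
    have hstep := hext (X \ R) Finset.sdiff_subset a (Finset.mem_sdiff.2 ⟨haX, ha⟩)
    unfold Extends at hstep
    rw [← hX] at hstep
    have hs1 : edgesIn B (X \ R) k ⊆ edgesIn B X k := edgesIn_mono Finset.sdiff_subset le_rfl
    have hs2 : edgesIn B (X \ insert a R) k ⊆ edgesIn B (X \ R) k :=
      edgesIn_mono (Finset.sdiff_subset_sdiff subset_rfl (Finset.subset_insert a R)) le_rfl
    have hd : dens μ G (edgesIn B X k \ edgesIn B (X \ insert a R) k)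
        = dens μ G (edgesIn B X k \ edgesIn B (X \ R) k)
          * dens μ G (edgesIn B (X \ R) k \ edgesIn B (X \ insert a R) k) := by
      rw [← dens_union μ G, Finset.sdiff_union_sdiff_cancel hs1 hs2]
      exact Finset.disjoint_of_subset_right Finset.sdiff_subset Finset.sdiff_disjoint
    rw [Finset.card_insert_of_notMem ha, hd, pow_succ]
    refine le_trans ?_ ih
    have := mul_le_mul_of_nonneg_left hstep
      (mul_nonneg (pow_nonneg (by norm_num : (0 : ℝ) ≤ 1 / 2) R.card)
        (dens_nonneg μ G (edgesIn B X k \ edgesIn B (X \ R) k)))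
    linarith

/-- The error terms in `Regular.expect_le`. -/
noncomputable def errBound (n M : ℕ) (ρ τ : ℕ → ℝ) : ℕ → ℝ
  | 0 => 0
  | j + 1 => τ (j + 1) + 2 ^ n * (ρ (j + 1) ^ M)⁻¹ * (13 * τ (j + 1) + errBound n M ρ τ j)

namespace Regular

variable (h : Regular B μ G Δ n M ρ τ)
include h

/-- There are at most two copies of each class, hence at most 2 * n vertices. Counting edges up to
size i with the error of a larger size j is needed where edges of the top size are discarded. -/
lemma count_bounds (hTR : Disjoint T R) (hn : T.card + R.card ≤ n) (hj : 1 ≤ j) (hjk : j ≤ k)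
    (hij : i ≤ j) (s t : Finset Bool) :
    (1 - τ j ^ 8) * (dens μ G (edgesIn B T i) ^ s.card * dens μ G (edgesIn B R i) ^ t.card
        * dens μ G (crossing B T R i) ^ (s.card * t.card)) ≤ copyExpect B μ T R i G s t ∧
    copyExpect B μ T R i G s t ≤ (1 + τ j ^ 8) * (dens μ G (edgesIn B T i) ^ s.card
        * dens μ G (edgesIn B R i) ^ t.card
        * dens μ G (crossing B T R i) ^ (s.card * t.card)) := by
  have hs : s.card ≤ 2 := Finset.card_le_univ s
  have ht : t.card ≤ 2 := Finset.card_le_univ t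
  have := h.count T R s t i j hTR (by nlinarith) hj hjk hij
  rw [abs_le] at this
  constructor <;> linarith [this.1, this.2]

/-- Off a rare event, the weighted number of extensions of a map on `R` to `T` is not much larger
than expected. -/
lemma exceptional_le (hTR : Disjoint T R) (hn : T.card + R.card ≤ n) (hj : 1 ≤ j) (hjk : j ≤ k)
    (ψ : PartMap W Ω → ℝ) (hψ : ∀ φ, 0 ≤ ψ φ ∧ ψ φ ≤ 1) :
    (mapExpect μ fun y => if (mapExpect μ fun x => ψ x * okProd G (edgesIn B T j) x)
          * dens μ G (crossing B T R j)
          + τ j * dens μ G (edgesIn B T j) * dens μ G (crossing B T R j)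
        < mapExpect μ fun x => ψ x * (okProd G (edgesIn B T j) x
          * okProd G (crossing B T R j) (mix T x y))
      then okProd G (edgesIn B R j) y else 0) ≤ 24 * τ j ^ 2 * dens μ G (edgesIn B R j) := by
  have hw := isWeight_mapWeight μ (W := W)
  have hA := h.dens_pos (edgesIn B T j)
  have hR := h.dens_pos (edgesIn B R j)
  have hC := h.dens_pos (crossing B T R j)
  have hτ := h.tau_pos j ⟨hj, hjk⟩
  have hτ1 := h.tau_le_one j ⟨hj, hjk⟩
  have cb := fun s t => h.count_bounds hTR hn hj hjk le_rfl s t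
  have c10 := (cb {false} ∅).2
  have c01 := (cb ∅ {false}).2
  have c11 := (cb {false} {false}).1
  have c12 := (cb {false} {false, true}).2
  have c21 := (cb {false, true} {false}).1
  have c22 := (cb {false, true} {false, true}).2
  rw [copyExpect_one_zero] at c10
  rw [copyExpect_zero_one] at c01
  rw [copyExpect_one_one] at c11
  rw [copyExpect_one_two] at c12
  rw [copyExpect_two_one] at c21
  rw [copyExpect_two_two] at c22
  simp only [Finset.card_singleton, Finset.card_empty, Finset.card_pair Bool.false_ne_true,
    pow_one, pow_zero, mul_one, one_mul, mul_zero] at c10 c01 c11 c12 c21 c22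
  have key := concentration hw (okProd G (edgesIn B T j)) (okProd G (edgesIn B R j))
    (fun x y => okProd G (crossing B T R j) (mix T x y)) ψ (fun _ => okProd_nonneg G _ _) hψ
    hA hR hC hτ hτ1 c10 c01 (by rw [← mul_assoc]; convert c11 using 1; ring)
    (by convert c12 using 1; ring) (by convert c21 using 1; ring) (by convert c22 using 1; ring)
  -- Chebyshev's inequality with threshold τ * A * C turns the variance 24 * τ ^ 4 * A ^ 2 * B * C ^
  -- 2 into 24 * τ ^ 2 * B.
  refine (expect_exceptional_le hw _ _ (fun _ => okProd_nonneg G _ _) (by positivity) key).trans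
    (le_of_eq ?_)
  field_simp

/-- A rare event on `R` stays rare after weighting it with the extensions to `T`. -/
lemma expect_mul_le (hTR : Disjoint T R) (hn : T.card + R.card ≤ n) (hj : 1 ≤ j) (hjk : j ≤ k)
    (hij : i ≤ j) (ψ : PartMap W Ω → ℝ) (hψ : ∀ φ, 0 ≤ ψ φ)
    (hψR : ∀ φ, ψ φ ≤ okProd G (edgesIn B R i) φ)
    (hr : mapExpect μ ψ ≤ 24 * τ j ^ 2 * dens μ G (edgesIn B R i)) :
    (mapExpect μ fun y => ψ y * mapExpect μ fun x => okProd G (edgesIn B T i) x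
      * okProd G (crossing B T R i) (mix T x y))
      ≤ 13 * τ j * dens μ G (edgesIn B (T ∪ R) i) := by
  have hw := isWeight_mapWeight μ (W := W)
  have c21 := (h.count_bounds hTR hn hj hjk hij {false, true} {false}).2
  rw [copyExpect_two_one] at c21
  simp only [Finset.card_singleton, Finset.card_pair Bool.false_ne_true,
    pow_one, mul_one] at c21
  rw [dens_edgesIn_union μ G hTR]
  exact expect_mul_extensions_le hw _ _ (fun x y => okProd G (crossing B T R i) (mix T x y)) ψ hψ
    hψR (h.dens_pos _) (h.dens_pos _) (h.dens_pos _) (h.tau_pos j ⟨hj, hjk⟩)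
    (h.tau_le_one j ⟨hj, hjk⟩) hr (by convert c21 using 1; ring)

end Regular

end Transfer

/-! ### Conditioning on the rest of the complex: the upper bound. -/

section Upper
open scoped Classical
open ColoredComplex ColoredComplex.VisibleEdge

variable {ι : Type u} [Fintype ι] {k : ℕ} {C : Idx ι k → Type x} {W : ι → Type w}
  [∀ i, Fintype (W i)] {B : ColoredComplex k C W}
  {Ω : ι → Type v} [∀ i, Fintype (Ω i)]
  [∀ i, MeasurableSpace (Ω i)] [∀ i, DiscreteMeasurableSpace (Ω i)]
  {μ : (i : ι) → Measure (Ω i)} [∀ i, IsProbabilityMeasure (μ i)]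
  {T R X N : Finset (Vert W)} {i j : ℕ} {G : ColoredGraph k C Ω}
  {Δ n M : ℕ} {ρ τ : ℕ → ℝ}

/-- The edges in `X` that meet `N`. -/
lemma edgesIn_union_crossing (hN : N ⊆ X) :
    edgesIn B N j ∪ crossing B N (X \ N) j = edgesIn B X j \ edgesIn B (X \ N) j := by
  ext e
  simp only [Finset.mem_union, Finset.mem_sdiff, mem_edgesIn, mem_crossing,
    Finset.union_sdiff_of_subset hN]
  constructor
  · rintro (⟨h1, h2⟩ | ⟨⟨h1, h2⟩, h3, h4⟩)
    · refine ⟨⟨h1.trans hN, h2⟩, fun h => ?_⟩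
      obtain ⟨a, ha⟩ := e.verts_nonempty
      exact (Finset.mem_sdiff.1 (h.1 ha)).2 (h1 ha)
    · exact ⟨⟨h1, h2⟩, fun h => h4 h.1⟩
  · rintro ⟨⟨h1, h2⟩, h3⟩
    by_cases h : e.verts ⊆ N
    · exact Or.inl ⟨h, h2⟩
    · exact Or.inr ⟨⟨h1, h2⟩, h, fun h' => h3 ⟨h', h2⟩⟩

lemma disjoint_edgesIn_crossing : Disjoint (edgesIn B T j) (crossing B T R j) :=
  Finset.disjoint_left.2 fun _ h h' => (mem_crossing.1 h').2.1 (mem_edgesIn.1 h).1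

lemma exists_mem_of_mem_sdiff {e : B.VisibleEdge}
    (he : e ∈ edgesIn B X j \ edgesIn B (X \ N) j) :
    (e.verts ⊆ X ∧ e.size ≤ j) ∧ ∃ a ∈ e.verts, a ∈ N := by
  obtain ⟨h1, h2⟩ := Finset.mem_sdiff.1 he
  have h1 := mem_edgesIn.1 h1
  refine ⟨h1, ?_⟩
  by_contra! h
  exact h2 (mem_edgesIn.2 ⟨fun a ha => Finset.mem_sdiff.2 ⟨h1.1 ha, h a ha⟩, h1.2⟩)

lemma mem_sdiff_of_mem {e : B.VisibleEdge} {a : Vert W} (h : e.verts ⊆ X) (hj : e.size ≤ j)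
    (ha : a ∈ e.verts) (haN : a ∈ N) : e ∈ edgesIn B X j \ edgesIn B (X \ N) j :=
  Finset.mem_sdiff.2 ⟨mem_edgesIn.2 ⟨h, hj⟩,
    fun h' => (Finset.mem_sdiff.1 ((mem_edgesIn.1 h').1 ha)).2 haN⟩

lemma mix_of_mem {x y : PartMap W Ω} {a : Vert W} (h : a ∈ T) : mix T x y a = x a := if_pos h

lemma mix_of_notMem {x y : PartMap W Ω} {a : Vert W} (h : a ∉ T) : mix T x y a = y a := if_neg h

lemma okProd_mix_left (x y : PartMap W Ω) :
    okProd G (edgesIn B T j) (mix T x y) = okProd G (edgesIn B T j) x :=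
  okProd_edgesIn_congr G fun _ ha => mix_of_mem ha

lemma okProd_mix_right (hTR : Disjoint T R) (x y : PartMap W Ω) :
    okProd G (edgesIn B R j) (mix T x y) = okProd G (edgesIn B R j) y :=
  okProd_edgesIn_congr G fun _ ha => mix_of_notMem (Finset.disjoint_right.1 hTR ha)

variable (μ) in
lemma mapExpect_mix_swap (T : Finset (Vert W)) (f : PartMap W Ω → ℝ) :
    mapExpect μ f = mapExpect μ fun y => mapExpect μ fun x => f (mix T x y) := by
  rw [mapExpect_mix μ T f]
  exact expect_comm _

namespace Regular

variable (h : Regular B μ G Δ n M ρ τ)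
include h

lemma errBound_nonneg (hj : j ≤ k) : 0 ≤ errBound n M ρ τ j := by
  induction j with
  | zero => exact le_rfl
  | succ j ih =>
    have h1 := h.tau_pos (j + 1) ⟨by omega, hj⟩
    have h2 := h.rho_pos (j + 1) ⟨by omega, hj⟩
    have h3 := ih (by omega)
    unfold errBound
    positivity

lemma card_union_nbrs_le : (T ∪ nbrs B T X).card ≤ T.card * (Δ + 1) := by
  have h1 := Finset.card_union_le T (nbrs B T X)
  have h2 := card_nbrs_le (T := T) (X := X) h.degree_le
  have h3 : T.card * (Δ + 1) = T.card * Δ + T.card := by ring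
  omega

/-- The comparison of the probabilities after removing a set `R`, in which the edges of size
greater than `j` have been dropped on the left-hand side. -/
lemma dens_mul_prob_le (hT : T ⊆ X) (hRX : R ⊆ X \ T) (hUn : (T ∪ R).card ≤ n) (hj : j + 1 ≤ k)
    (hext : ∀ Y ⊆ X, ∀ a ∈ Y, Extends μ G B Y a) :
    dens μ G (edgesIn B (T ∪ R) j) * dens μ G (crossing B (T ∪ R) (X \ (T ∪ R)) j)
      * prob μ G B (X \ (T ∪ R)) ≤ 2 ^ n * (ρ (j + 1) ^ M)⁻¹
      * (dens μ G (edgesIn B T (j + 1)) * dens μ G (crossing B T (X \ T) (j + 1))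
        * prob μ G B (X \ T)) := by
  have hU : T ∪ R ⊆ X := Finset.union_subset hT (hRX.trans Finset.sdiff_subset)
  have hX : (X \ T) \ R = X \ (T ∪ R) := by
    ext a; simp only [Finset.mem_sdiff, Finset.mem_union]; tauto
  have hRn : R.card ≤ n := (Finset.card_le_card Finset.subset_union_right).trans hUn
  have h1 := prob_sdiff_le R (X \ T) hRX
    fun Y hY => hext Y (hY.trans Finset.sdiff_subset)
  rw [hX] at h1
  rw [← dens_union μ G disjoint_edgesIn_crossing, ← dens_union μ G disjoint_edgesIn_crossing,
    edgesIn_union_crossing hU, edgesIn_union_crossing hT]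
  rw [← hX] at h1 ⊢
  -- E₁ consists of the edges at T of size at most j + 1, E₂ of all edges at R that avoid T, and E
  -- of the edges at T ∪ R of size at most j. Thus E lies in E₁ ∪ E₂, and what is missing has size
  -- at least j + 1, so it costs only a power of ρ (j + 1).
  set E₁ := edgesIn B X (j + 1) \ edgesIn B (X \ T) (j + 1) with hE₁
  set E₂ := edgesIn B (X \ T) k \ edgesIn B ((X \ T) \ R) k with hE₂
  set E := edgesIn B X j \ edgesIn B ((X \ T) \ R) j with hE
  have hE' : E = edgesIn B X j \ edgesIn B (X \ (T ∪ R)) j := by rw [hE, hX]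
  have hdisj : Disjoint E₁ E₂ := by
    rw [Finset.disjoint_left]
    intro e he he'
    obtain ⟨-, a, ha, haT⟩ := exists_mem_of_mem_sdiff he
    exact (Finset.mem_sdiff.1 ((exists_mem_of_mem_sdiff he').1.1 ha)).2 haT
  have hin : ∀ e ∈ E₁ ∪ E₂, e.verts ⊆ X ∧ ∃ a ∈ e.verts, a ∈ T ∪ R := by
    intro e he
    rcases Finset.mem_union.1 he with he | he
    · obtain ⟨⟨h1, -⟩, a, ha, haT⟩ := exists_mem_of_mem_sdiff he
      exact ⟨h1, a, ha, Finset.mem_union_left _ haT⟩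
    · obtain ⟨⟨h1, -⟩, a, ha, haT⟩ := exists_mem_of_mem_sdiff he
      exact ⟨h1.trans Finset.sdiff_subset, a, ha, Finset.mem_union_right _ haT⟩
  have hsub : E ⊆ E₁ ∪ E₂ := by
    intro e he
    rw [hE'] at he
    obtain ⟨⟨h1, h2⟩, a, ha, haU⟩ := exists_mem_of_mem_sdiff he
    by_cases hTe : ∃ b ∈ e.verts, b ∈ T
    · obtain ⟨b, hb, hbT⟩ := hTe
      exact Finset.mem_union_left _ (mem_sdiff_of_mem h1 (by omega) hb hbT)
    · push Not at hTe
      refine Finset.mem_union_right _ (mem_sdiff_of_mem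
        (fun b hb => Finset.mem_sdiff.2 ⟨h1 hb, hTe b hb⟩) e.size_le ha ?_)
      exact (Finset.mem_union.1 haU).resolve_left (hTe a ha)
  have hd := h.dens_mul_rho_pow_le (Z := (T ∪ R) ∪ nbrs B (T ∪ R) X) (j := j + 1) (by omega) hj
    hsub
    (fun e he he' => by
      obtain ⟨h1, a, ha, haU⟩ := hin e he
      by_contra hlt
      exact he' (hE' ▸ mem_sdiff_of_mem h1 (by omega) ha haU))
    (h.card_union_nbrs_le.trans (by rw [mul_comm]; exact Nat.mul_le_mul_left _ hUn))
    (fun e he => by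
      obtain ⟨h1, a, ha, haU⟩ := hin e he
      exact verts_subset_union_nbrs h1 ha haU)
  rw [dens_union μ G hdisj] at hd
  have hρ : 0 < ρ (j + 1) ^ M := pow_pos (h.rho_pos _ ⟨by omega, hj⟩) M
  have hp := prob_nonneg μ G (B := B) ((X \ T) \ R)
  have hE₁0 := dens_nonneg μ G E₁
  have hE₂0 := dens_nonneg μ G E₂
  have h2 : (1 / 2 : ℝ) ^ n ≤ (1 / 2) ^ R.card :=
    pow_le_pow_of_le_one (by norm_num) (by norm_num) hRn
  -- The vertices of R are put back one at a time, each at the cost of a factor 2.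
  have h3 : dens μ G E₂ * prob μ G B ((X \ T) \ R) ≤ 2 ^ n * prob μ G B (X \ T) := by
    have h4 : (1 / 2 : ℝ) ^ n * (dens μ G E₂ * prob μ G B ((X \ T) \ R))
        ≤ prob μ G B (X \ T) := by
      refine le_trans ?_ h1
      rw [mul_assoc]
      exact mul_le_mul_of_nonneg_right h2 (mul_nonneg hE₂0 hp)
    calc dens μ G E₂ * prob μ G B ((X \ T) \ R)
        = 2 ^ n * ((1 / 2 : ℝ) ^ n * (dens μ G E₂ * prob μ G B ((X \ T) \ R))) := by
          rw [← mul_assoc, ← mul_pow]; norm_num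
      _ ≤ _ := mul_le_mul_of_nonneg_left h4 (by positivity)
  calc dens μ G E * prob μ G B ((X \ T) \ R)
      = (ρ (j + 1) ^ M)⁻¹ * ((dens μ G E * ρ (j + 1) ^ M) * prob μ G B ((X \ T) \ R)) := by
        field_simp
    _ ≤ (ρ (j + 1) ^ M)⁻¹ * ((dens μ G E₁ * dens μ G E₂) * prob μ G B ((X \ T) \ R)) := by
        gcongr
    _ = (ρ (j + 1) ^ M)⁻¹ * (dens μ G E₁ * (dens μ G E₂ * prob μ G B ((X \ T) \ R))) := by ring
    _ ≤ (ρ (j + 1) ^ M)⁻¹ * (dens μ G E₁ * (2 ^ n * prob μ G B (X \ T))) := by gcongr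
    _ = _ := by ring

/-- Conditioning on the rest of the complex does not increase the probability of an event on a
small set `N` by much, when only edges of size at most `j` meet `N`. -/
theorem expect_le (hj : j ≤ k) (X N : Finset (Vert W)) (hN : N ⊆ X)
    (hn : N.card * (Δ + 1) ^ j ≤ n) (ψ : PartMap W Ω → ℝ) (hψ : ∀ φ, 0 ≤ ψ φ ∧ ψ φ ≤ 1)
    (hψN : DependsOn ψ (N : Set (Vert W))) (hext : ∀ Y ⊆ X, ∀ a ∈ Y, Extends μ G B Y a) :
    (mapExpect μ fun φ => ψ φ * (okProd G (edgesIn B N j) φ * okProd G (crossing B N (X \ N) j) φ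
      * okProd G (edgesIn B (X \ N) k) φ))
      ≤ ((mapExpect μ fun φ => ψ φ * okProd G (edgesIn B N j) φ)
          + errBound n M ρ τ j * dens μ G (edgesIn B N j))
        * dens μ G (crossing B N (X \ N) j) * prob μ G B (X \ N) := by
  have hw := isWeight_mapWeight μ (W := W)
  induction j generalizing N ψ with
  | zero =>
    -- No retained edge meets N, so the event on N is independent of the embedding of the rest.
    have h1 : ∀ φ, okProd G (∅ : Finset B.VisibleEdge) φ = 1 := fun _ => rfl
    have h2 : dens μ G (∅ : Finset B.VisibleEdge) = 1 := rfl
    simp only [edgesIn_zero, crossing_zero, h1, h2, errBound, mul_one, one_mul, add_zero]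
    refine le_of_eq (mapExpect_mul_of_dependsOn μ hψN fun φ φ' hφ => ?_)
    exact okProd_edgesIn_congr G fun a ha => hφ a (Finset.mem_sdiff.1 ha).2
  | succ j ih =>
    set R := nbrs B N X with hR
    have hRX : R ⊆ X \ N := nbrs_subset
    have hNR : Disjoint N R := disjoint_nbrs
    have hNX : Disjoint N (X \ N) := Finset.disjoint_sdiff
    have hU : N ∪ R ⊆ X := Finset.union_subset hN (hRX.trans Finset.sdiff_subset)
    have hn' : N.card * (Δ + 1) ≤ n := by
      refine le_trans (Nat.mul_le_mul_left _ ?_) hn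
      exact Nat.le_self_pow (by omega) _
    have hUcard := h.card_union_nbrs_le (T := N) (X := X)
    have hNRn : N.card + R.card ≤ n := by
      rw [← Finset.card_union_of_disjoint hNR]; exact hUcard.trans hn'
    have hcross : crossing B N (X \ N) (j + 1) = crossing B N R (j + 1) := crossing_sdiff hN
    set A := dens μ G (edgesIn B N (j + 1)) with hA
    set D := dens μ G (crossing B N R (j + 1)) with hD
    set m := mapExpect μ fun φ => ψ φ * okProd G (edgesIn B N (j + 1)) φ with hm
    set F : PartMap W Ω → ℝ := fun y => mapExpect μ fun x =>
      ψ x * (okProd G (edgesIn B N (j + 1)) x * okProd G (crossing B N R (j + 1)) (mix N x y))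
      with hF
    set rest : PartMap W Ω → ℝ := okProd G (edgesIn B (X \ N) k) with hrest
    -- The atypical event: y embeds R but has too many weighted extensions to N. It depends on R
    -- only, so it can serve as the weight on N ∪ R in the induction hypothesis.
    set ψ' : PartMap W Ω → ℝ := fun y =>
      if m * D + τ (j + 1) * A * D < F y then okProd G (edgesIn B R (j + 1)) y else 0 with hψ'
    have hτ := h.tau_pos (j + 1) ⟨by omega, hj⟩
    have hA0 : 0 < A := h.dens_pos _
    have hD0 : 0 < D := h.dens_pos _
    have hm0 : 0 ≤ m := hw.expect_nonneg fun φ => mul_nonneg (hψ φ).1 (okProd_nonneg G _ _)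
    have hF0 : ∀ y, 0 ≤ F y := fun y => hw.expect_nonneg fun φ =>
      mul_nonneg (hψ φ).1 (mul_nonneg (okProd_nonneg G _ _) (okProd_nonneg G _ _))
    have hψ'01 : ∀ φ, 0 ≤ ψ' φ ∧ ψ' φ ≤ 1 := by
      intro φ
      simp only [hψ']
      split_ifs
      · exact ⟨okProd_nonneg G _ _, okProd_le_one G _ _⟩
      · exact ⟨le_rfl, zero_le_one⟩
    have hψ'R : ∀ φ, ψ' φ ≤ okProd G (edgesIn B R j) φ := by
      intro φ
      simp only [hψ']
      split_ifs
      · exact okProd_anti G (edgesIn_mono subset_rfl (Nat.le_succ j)) φ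
      · exact okProd_nonneg G _ _
    have hFR : ∀ y y' : PartMap W Ω, (∀ a ∈ R, y a = y' a) → F y = F y' := by
      intro y y' hy
      simp only [hF]
      congr 1; ext x; congr 2
      refine okProd_crossing_congr G fun a ha => ?_
      by_cases haN : a ∈ N
      · rw [mix_of_mem haN, mix_of_mem haN]
      · rw [mix_of_notMem haN, mix_of_notMem haN, hy a ((Finset.mem_union.1 ha).resolve_left haN)]
    have hψ'dep : ∀ y y' : PartMap W Ω, (∀ a ∈ R, y a = y' a) → ψ' y = ψ' y' := by
      intro y y' hy
      simp only [hψ', hFR y y' hy, okProd_edgesIn_congr G hy]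
    have hψ'mix : ∀ x y : PartMap W Ω, ψ' (mix N x y) = ψ' y := fun x y =>
      hψ'dep _ _ fun a ha => mix_of_notMem (Finset.disjoint_right.1 hNR ha)
    have hLHS : (mapExpect μ fun φ => ψ φ * (okProd G (edgesIn B N (j + 1)) φ
        * okProd G (crossing B N R (j + 1)) φ * rest φ))
        = mapExpect μ fun y => rest y * F y := by
      rw [mapExpect_mix_swap μ N]
      congr 1; ext y
      simp only [hF, mapExpect, ← expect_const_mul]
      congr 1; ext x
      rw [okProd_mix_left, hrest, okProd_mix_right hNX,
        hψN (x := mix N x y) (y := x) fun a ha => mix_of_mem (Finset.mem_coe.1 ha)]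
      ring
    have hpoint : ∀ y, rest y * F y ≤ (m * D + τ (j + 1) * A * D) * rest y
        + rest y * (ψ' y * F y) := by
      intro y
      have hr0 : 0 ≤ rest y := okProd_nonneg G _ _
      simp only [hψ']
      split_ifs with hlt
      · have : rest y * okProd G (edgesIn B R (j + 1)) y = rest y := by
          rw [hrest, okProd_mul, Finset.union_eq_left.2 (edgesIn_mono hRX hj)]
        rw [← mul_assoc (rest y), this]
        have : 0 ≤ (m * D + τ (j + 1) * A * D) * rest y := by positivity
        linarith
      · rw [zero_mul, mul_zero, add_zero, mul_comm]
        exact mul_le_mul_of_nonneg_right (not_lt.1 hlt) hr0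
    have hmain : (mapExpect μ fun y => rest y * F y)
        ≤ (m * D + τ (j + 1) * A * D) * prob μ G B (X \ N)
          + mapExpect μ fun y => rest y * (ψ' y * F y) := by
      refine (hw.expect_mono hpoint).trans_eq ?_
      rw [expect_add, expect_const_mul]
      rfl
    -- In the atypical part a crude bound suffices: ψ is replaced by 1 and all edges of size greater
    -- than j that meet N ∪ R are dropped.
    have hexc : (mapExpect μ fun y => rest y * (ψ' y * F y))
        ≤ mapExpect μ fun φ => ψ' φ * (okProd G (edgesIn B (N ∪ R) j) φ
          * okProd G (crossing B (N ∪ R) (X \ (N ∪ R)) j) φ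
          * okProd G (edgesIn B (X \ (N ∪ R)) k) φ) := by
      rw [mapExpect_mix_swap μ N (fun φ => ψ' φ * (okProd G (edgesIn B (N ∪ R) j) φ
          * okProd G (crossing B (N ∪ R) (X \ (N ∪ R)) j) φ
          * okProd G (edgesIn B (X \ (N ∪ R)) k) φ))]
      refine hw.expect_mono fun y => ?_
      simp only [hF, mapExpect, ← expect_const_mul]
      refine hw.expect_mono fun x => ?_
      rw [hψ'mix]
      have e1 : rest y = rest (mix N x y) := (okProd_mix_right hNX x y).symm
      have e2 : okProd G (edgesIn B N (j + 1)) x = okProd G (edgesIn B N (j + 1)) (mix N x y) :=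
        (okProd_mix_left x y).symm
      rw [e1, e2]
      set φ := mix N x y
      have h1 : rest φ * (okProd G (edgesIn B N (j + 1)) φ * okProd G (crossing B N R (j + 1)) φ)
          ≤ okProd G (edgesIn B (N ∪ R) j) φ
          * okProd G (crossing B (N ∪ R) (X \ (N ∪ R)) j) φ
          * okProd G (edgesIn B (X \ (N ∪ R)) k) φ := by
        rw [hrest, okProd_mul, okProd_mul, okProd_mul, okProd_mul]
        refine okProd_anti G ?_ φ
        intro e he
        have heX : e.verts ⊆ X ∧ ((∃ a ∈ e.verts, a ∈ N) → e.size ≤ j ∧ e.verts ⊆ N ∪ R) := by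
          rw [edgesIn_union_crossing hU] at he
          rcases Finset.mem_union.1 he with he | he
          · obtain ⟨⟨h1, h2⟩, -⟩ := exists_mem_of_mem_sdiff he
            exact ⟨h1, fun ⟨a, ha, haN⟩ => ⟨h2, verts_subset_union_nbrs h1 ha haN⟩⟩
          · have h1 := (mem_edgesIn.1 he).1
            exact ⟨h1.trans Finset.sdiff_subset, fun ⟨a, ha, haN⟩ =>
              absurd (Finset.mem_union_left _ haN) (Finset.mem_sdiff.1 (h1 ha)).2⟩
        by_cases hex : ∃ a ∈ e.verts, a ∈ N
        · obtain ⟨hs, hv⟩ := heX.2 hex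
          obtain ⟨a, ha, haN⟩ := hex
          refine Finset.mem_union_right _ ?_
          by_cases heN : e.verts ⊆ N
          · exact Finset.mem_union_left _ (mem_edgesIn.2 ⟨heN, by omega⟩)
          · exact Finset.mem_union_right _ (mem_crossing.2 ⟨⟨hv, by omega⟩, heN, fun hR' =>
              Finset.disjoint_left.1 hNR haN (hR' ha)⟩)
        · push Not at hex
          exact Finset.mem_union_left _ (mem_edgesIn.2
            ⟨fun a ha => Finset.mem_sdiff.2 ⟨heX.1 ha, hex a ha⟩, e.size_le⟩)
      have h2 : 0 ≤ ψ' y := (hψ'01 y).1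
      have h3 : 0 ≤ rest φ * (okProd G (edgesIn B N (j + 1)) φ
          * okProd G (crossing B N R (j + 1)) φ) :=
        mul_nonneg (okProd_nonneg G _ _) (mul_nonneg (okProd_nonneg G _ _) (okProd_nonneg G _ _))
      calc _ = ψ x * (ψ' y * (rest φ * (okProd G (edgesIn B N (j + 1)) φ
            * okProd G (crossing B N R (j + 1)) φ))) := by ring
        _ ≤ 1 * (ψ' y * (rest φ * (okProd G (edgesIn B N (j + 1)) φ
            * okProd G (crossing B N R (j + 1)) φ))) :=
            mul_le_mul_of_nonneg_right (hψ x).2 (mul_nonneg h2 h3)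
        _ ≤ _ := by rw [one_mul]; exact mul_le_mul_of_nonneg_left h1 h2
    have hih := ih (by omega) (N ∪ R) hU
      (by
        refine le_trans ?_ hn
        rw [pow_succ']
        calc (N ∪ R).card * (Δ + 1) ^ j ≤ N.card * (Δ + 1) * (Δ + 1) ^ j :=
              Nat.mul_le_mul_right _ hUcard
          _ = _ := by ring) ψ' hψ'01
      (fun y y' hy => hψ'dep y y' fun a ha => hy a (by simp [ha]))
    have hrare : mapExpect μ ψ' ≤ 24 * τ (j + 1) ^ 2 * dens μ G (edgesIn B R j) := by
      refine (h.exceptional_le hNR hNRn (by omega) hj ψ hψ).trans ?_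
      exact mul_le_mul_of_nonneg_left
        (dens_anti μ G (edgesIn_mono subset_rfl (Nat.le_succ j))) (by positivity)
    -- The induction hypothesis asks for the weight of the atypical event on embeddings of N ∪ R,
    -- not of R alone; `expect_mul_le` makes this change by the Cauchy-Schwarz type bound.
    have hsmall : (mapExpect μ fun φ => ψ' φ * okProd G (edgesIn B (N ∪ R) j) φ)
        ≤ 13 * τ (j + 1) * dens μ G (edgesIn B (N ∪ R) j) := by
      refine le_trans ?_ (h.expect_mul_le hNR hNRn (by omega) hj (Nat.le_succ j) ψ'
        (fun φ => (hψ'01 φ).1) hψ'R hrare)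
      rw [mapExpect_mix_swap μ N]
      refine hw.expect_mono fun y => ?_
      simp only [mapExpect, ← expect_const_mul]
      refine hw.expect_mono fun x => ?_
      rw [hψ'mix, okProd_edgesIn_union G hNR, okProd_mix_left]
      refine mul_le_mul_of_nonneg_left ?_ (hψ'01 y).1
      refine mul_le_mul_of_nonneg_right ?_ (okProd_nonneg G _ _)
      exact mul_le_of_le_one_right (okProd_nonneg G _ _) (okProd_le_one G _ _)
    have htrans := h.dens_mul_prob_le hN hRX (hUcard.trans hn') hj hext
    rw [hcross] at htrans ⊢
    have herr := h.errBound_nonneg (j := j) (by omega)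
    have hc0 := dens_nonneg μ G (crossing B (N ∪ R) (X \ (N ∪ R)) j)
    have hp0 := prob_nonneg μ G (B := B) (X \ (N ∪ R))
    have hlast : (mapExpect μ fun φ => ψ' φ * (okProd G (edgesIn B (N ∪ R) j) φ
          * okProd G (crossing B (N ∪ R) (X \ (N ∪ R)) j) φ
          * okProd G (edgesIn B (X \ (N ∪ R)) k) φ))
        ≤ (13 * τ (j + 1) + errBound n M ρ τ j) * (2 ^ n * (ρ (j + 1) ^ M)⁻¹
          * (A * D * prob μ G B (X \ N))) := by
      refine hih.trans ?_
      calc _ ≤ (13 * τ (j + 1) * dens μ G (edgesIn B (N ∪ R) j)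
            + errBound n M ρ τ j * dens μ G (edgesIn B (N ∪ R) j))
            * dens μ G (crossing B (N ∪ R) (X \ (N ∪ R)) j) * prob μ G B (X \ (N ∪ R)) := by
            gcongr
        _ = (13 * τ (j + 1) + errBound n M ρ τ j) * (dens μ G (edgesIn B (N ∪ R) j)
            * dens μ G (crossing B (N ∪ R) (X \ (N ∪ R)) j)
            * prob μ G B (X \ (N ∪ R))) := by ring
        _ ≤ _ := mul_le_mul_of_nonneg_left htrans (by positivity)
    rw [hLHS]
    refine (hmain.trans (add_le_add_right (hexc.trans hlast) _)).trans (le_of_eq ?_)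
    rw [errBound]
    ring

end Regular

end Upper

/-! ### Extending embeddings by one vertex: the lower bound. -/

section Lower
open scoped Classical
open ColoredComplex ColoredComplex.VisibleEdge

variable {ι : Type u} [Fintype ι] {k : ℕ} {C : Idx ι k → Type x} {W : ι → Type w}
  [∀ i, Fintype (W i)] {B : ColoredComplex k C W}
  {Ω : ι → Type v} [∀ i, Fintype (Ω i)]
  [∀ i, MeasurableSpace (Ω i)] [∀ i, DiscreteMeasurableSpace (Ω i)]
  {μ : (i : ι) → Measure (Ω i)} [∀ i, IsProbabilityMeasure (μ i)]
  {T R X : Finset (Vert W)} {i j : ℕ} {G : ColoredGraph k C Ω}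
  {Δ n M : ℕ} {ρ τ : ℕ → ℝ} {u : Vert W} {δ : ℝ}

lemma crossing_comm : crossing B T R j = crossing B R T j := by
  ext e
  simp only [mem_crossing, Finset.union_comm T R]
  tauto

lemma crossing_erase (hu : u ∈ X) :
    crossing B (X.erase u) {u} j = crossing B (nbrs B {u} X) {u} j := by
  rw [crossing_comm, ← Finset.sdiff_singleton_eq_erase,
    crossing_sdiff (Finset.singleton_subset_iff.2 hu), crossing_comm]

lemma nbrs_subset_erase : nbrs B {u} X ⊆ X.erase u := by
  rw [← Finset.sdiff_singleton_eq_erase]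
  exact nbrs_subset

variable (μ G) in
lemma dens_edgesIn_sdiff_erase (hu : u ∈ X) :
    dens μ G (edgesIn B X k \ edgesIn B (X.erase u) k)
      = dens μ G (edgesIn B {u} k) * dens μ G (crossing B (nbrs B {u} X) {u} k) := by
  rw [← Finset.sdiff_singleton_eq_erase,
    ← edgesIn_union_crossing (Finset.singleton_subset_iff.2 hu),
    dens_union μ G disjoint_edgesIn_crossing, crossing_sdiff (Finset.singleton_subset_iff.2 hu),
    crossing_comm]

variable (μ G) in
/-- The probability of embedding the complex on `X` in terms of the extensions of maps on
`X.erase u` to `u`. -/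
lemma prob_eq_extensions (hu : u ∈ X) :
    prob μ G B X = mapExpect μ fun x => okProd G (edgesIn B (X.erase u) k) x
      * mapExpect μ fun y => okProd G (edgesIn B {u} k) y
        * okProd G (crossing B (nbrs B {u} X) {u} k) (mix (nbrs B {u} X) x y) := by
  have hdisj : Disjoint (X.erase u) {u} := by simp
  have hX : X.erase u ∪ {u} = X := by
    ext a; simp only [Finset.mem_union, Finset.mem_erase, Finset.mem_singleton]
    constructor
    · rintro (h | rfl)
      exacts [h.2, hu]
    · tauto
  unfold prob
  rw [mapExpect_mix μ (X.erase u)]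
  congr 1; ext x
  simp only [mapExpect, ← expect_const_mul]
  congr 1; ext y
  have hsplit := okProd_edgesIn_union G (B := B) (j := k) hdisj (mix (X.erase u) x y)
  rw [hX] at hsplit
  rw [hsplit, okProd_mix_left, okProd_mix_right hdisj, crossing_erase hu,
    okProd_crossing_congr G (φ' := mix (nbrs B {u} X) x y), mul_assoc]
  intro a ha
  rcases Finset.mem_union.1 ha with ha | ha
  · rw [mix_of_mem ha, mix_of_mem (nbrs_subset_erase ha)]
  · have h1 : a ∉ X.erase u := Finset.disjoint_right.1 hdisj ha
    rw [mix_of_notMem h1, mix_of_notMem fun h => h1 (nbrs_subset_erase h)]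

namespace Regular

variable (h : Regular B μ G Δ n M ρ τ)
include h

/-- A rare event on a small set `N` stays rare after conditioning on an embedding of the complex
on `X`. -/
lemma expect_mul_okProd_le (hk : 1 ≤ k) {N : Finset (Vert W)} (hNX : N ⊆ X)
    (hn' : N.card * (Δ + 1) ^ (k - 1) ≤ n) (hNn : N.card ≤ n) (ψ : PartMap W Ω → ℝ)
    (hψ01 : ∀ φ, 0 ≤ ψ φ ∧ ψ φ ≤ 1) (hψdep : DependsOn ψ (N : Set (Vert W))) {κ : ℝ} (hκ : 0 ≤ κ)
    (hψE : mapExpect μ ψ ≤ κ * dens μ G (edgesIn B N k))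
    (hext : ∀ Y ⊆ X, ∀ a ∈ Y, Extends μ G B Y a) :
    (mapExpect μ fun x => ψ x * okProd G (edgesIn B X k) x)
      ≤ (κ + errBound n M ρ τ (k - 1)) * (2 ^ n * (ρ k ^ M)⁻¹) * prob μ G B X := by
  have hw := isWeight_mapWeight μ (W := W)
  have hup := h.expect_le (j := k - 1) (by omega) (X) N hNX
    hn' ψ hψ01 hψdep hext
  -- The edges of size k at N are dropped, so that `expect_le` contributes only the error for size k
  -- - 1, which is negligible against powers of ρ k.
  have hdrop : (mapExpect μ fun x => ψ x * okProd G (edgesIn B X k) x) ≤ mapExpect μ fun φ =>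
      ψ φ * (okProd G (edgesIn B N (k - 1)) φ
        * okProd G (crossing B N (X \ N) (k - 1)) φ
        * okProd G (edgesIn B (X \ N) k) φ) := by
    refine hw.expect_mono fun φ => mul_le_mul_of_nonneg_left ?_ (hψ01 φ).1
    rw [okProd_mul, okProd_mul, edgesIn_union_crossing hNX]
    refine okProd_anti G (Finset.union_subset ?_ ?_) φ
    · exact Finset.sdiff_subset.trans (edgesIn_mono subset_rfl (Nat.sub_le k 1))
    · exact edgesIn_mono Finset.sdiff_subset le_rfl
  have hk' : k - 1 + 1 = k := by omega
  -- With T empty the comparison returns from X ∖ N to X itself.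
  have htrans := h.dens_mul_prob_le (T := ∅) (R := N) (X := X) (j := k - 1)
    (Finset.empty_subset _) (by rwa [Finset.sdiff_empty])
    (by rwa [Finset.empty_union]) (by omega) hext
  have he1 : edgesIn B ∅ k = ∅ := by
    ext e
    simp only [mem_edgesIn, Finset.notMem_empty, iff_false, Finset.subset_empty]
    exact fun h => e.verts_nonempty.ne_empty h.1
  have he2 : crossing B ∅ X k = ∅ := by
    ext e
    simp only [mem_crossing, Finset.empty_union, Finset.notMem_empty, iff_false]
    tauto
  have hd1 : dens μ G (∅ : Finset B.VisibleEdge) = 1 := rfl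
  rw [hk', Finset.empty_union, Finset.sdiff_empty, he1, he2, hd1, one_mul, one_mul] at htrans
  have herr := h.errBound_nonneg (j := k - 1) (by omega)
  have hc0 := dens_nonneg μ G (crossing B N (X \ N) (k - 1))
  have hp0 := prob_nonneg μ G (B := B) (X \ N)
  have hp := prob_nonneg μ G (B := B) (X)
  refine (hdrop.trans hup).trans ?_
  have hψ1 : (mapExpect μ fun φ => ψ φ * okProd G (edgesIn B N (k - 1)) φ)
      ≤ κ * dens μ G (edgesIn B N (k - 1)) := by
    refine (hw.expect_mono fun φ => mul_le_of_le_one_right (hψ01 φ).1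
      (okProd_le_one G _ _)).trans (hψE.trans ?_)
    exact mul_le_mul_of_nonneg_left
      (dens_anti μ G (edgesIn_mono subset_rfl (Nat.sub_le k 1))) (by positivity)
  calc _ ≤ (κ * dens μ G (edgesIn B N (k - 1))
        + errBound n M ρ τ (k - 1) * dens μ G (edgesIn B N (k - 1)))
        * dens μ G (crossing B N (X \ N) (k - 1)) * prob μ G B (X \ N) := by
        gcongr
    _ = (κ + errBound n M ρ τ (k - 1)) * (dens μ G (edgesIn B N (k - 1))
        * dens μ G (crossing B N (X \ N) (k - 1))
        * prob μ G B (X \ N)) := by ring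
    _ ≤ (κ + errBound n M ρ τ (k - 1))
        * (2 ^ n * (ρ k ^ M)⁻¹ * prob μ G B X) :=
        mul_le_mul_of_nonneg_left htrans (by positivity)
    _ = (κ + errBound n M ρ τ (k - 1)) * (2 ^ n * (ρ k ^ M)⁻¹)
        * prob μ G B X := by ring

/-- Embeddings of N with fewer than (1 - δ) * D extensions to u are rare by the second moment
method, and stay rare, up to a fraction δ, among the embeddings of X ∖ u. Discarding them loses the
two factors 1 - δ. -/
lemma prob_ge_of_card_le (hk : 1 ≤ k) (hu : u ∈ X) (hn : Δ + 1 ≤ n)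
    (hn' : Δ * (Δ + 1) ^ (k - 1) ≤ n) (hδ : 0 < δ) (hδ1 : δ ≤ 1)
    (hnum : (4 * τ k ^ 8 / δ ^ 2 + errBound n M ρ τ (k - 1)) * (2 ^ n * (ρ k ^ M)⁻¹) ≤ δ)
    (hext : ∀ Y ⊆ X.erase u, ∀ a ∈ Y, Extends μ G B Y a) :
    (1 - 2 * δ) * dens μ G (edgesIn B X k \ edgesIn B (X.erase u) k) * prob μ G B (X.erase u)
      ≤ prob μ G B X := by
  have hw := isWeight_mapWeight μ (W := W)
  set N := nbrs B {u} X with hN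
  have hNu : Disjoint N {u} := disjoint_nbrs.symm
  have hNX : N ⊆ X.erase u := nbrs_subset_erase
  have hNcard : N.card ≤ Δ := by simpa using card_nbrs_le (T := {u}) (X := X) h.degree_le
  have cb := fun s t => h.count_bounds hNu (by rw [Finset.card_singleton]; omega) hk le_rfl
    le_rfl s t
  have c10 := (cb {false} ∅).2
  have c11 := (cb {false} {false}).1
  have c12 := (cb {false} {false, true}).2
  rw [copyExpect_one_zero] at c10
  rw [copyExpect_one_one] at c11
  rw [copyExpect_one_two] at c12
  simp only [Finset.card_singleton, Finset.card_empty, Finset.card_pair Bool.false_ne_true,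
    pow_one, pow_zero, mul_one, one_mul, mul_zero] at c10 c11 c12
  set f : PartMap W Ω → ℝ := fun x => mapExpect μ fun y => okProd G (edgesIn B {u} k) y
        * okProd G (crossing B N {u} k) (mix N x y) with hf
  set A := dens μ G (edgesIn B N k) with hA
  set D := dens μ G (edgesIn B {u} k) * dens μ G (crossing B N {u} k) with hD
  have hA0 : 0 < A := h.dens_pos _
  have hD0 : 0 < D := mul_pos (h.dens_pos _) (h.dens_pos _)
  have hvar := variance_le (w := mapWeight μ W) (v := mapWeight μ W) (okProd G (edgesIn B N k))
    (okProd G (edgesIn B {u} k)) (fun x y => okProd G (crossing B N {u} k) (mix N x y))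
    (A := A) (D := D) (θ := τ k ^ 8) hD0.le c10 (by convert c11 using 1; ring)
    (by convert c12 using 1; ring)
  set ψ : PartMap W Ω → ℝ := fun x => if f x < D - δ * D then okProd G (edgesIn B N k) x else 0
    with hψ
  have hψE : mapExpect μ ψ ≤ 4 * τ k ^ 8 / δ ^ 2 * A := by
    refine (expect_exceptional_le' hw _ f (fun _ => okProd_nonneg G _ _) (mul_pos hδ hD0)
      hvar).trans (le_of_eq ?_)
    field_simp
  have hψ01 : ∀ φ, 0 ≤ ψ φ ∧ ψ φ ≤ 1 := by
    intro φ
    simp only [hψ]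
    split_ifs
    · exact ⟨okProd_nonneg G _ _, okProd_le_one G _ _⟩
    · exact ⟨le_rfl, zero_le_one⟩
  have hψdep : DependsOn ψ (N : Set (Vert W)) := by
    intro x x' hx
    have h1 : f x = f x' := by
      simp only [hf]
      congr 1; ext y; congr 1
      refine okProd_crossing_congr G fun a ha => ?_
      by_cases haN : a ∈ N
      · rw [mix_of_mem haN, mix_of_mem haN, hx a (Finset.mem_coe.2 haN)]
      · rw [mix_of_notMem haN, mix_of_notMem haN]
    simp only [hψ, h1, okProd_edgesIn_congr G (B := B) (j := k) fun a ha =>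
      hx a (Finset.mem_coe.2 ha)]
  have hf0 : ∀ x, 0 ≤ f x := fun x => hw.expect_nonneg fun y =>
    mul_nonneg (okProd_nonneg G _ _) (okProd_nonneg G _ _)
  set rest : PartMap W Ω → ℝ := okProd G (edgesIn B (X.erase u) k) with hrest
  have hlow : (1 - δ) * D * (prob μ G B (X.erase u) - mapExpect μ fun x => ψ x * rest x)
      ≤ prob μ G B X := by
    rw [prob_eq_extensions μ G hu, prob, mapExpect, mapExpect, ← expect_sub, ← expect_const_mul]
    refine hw.expect_mono fun x => ?_
    have hr0 : 0 ≤ rest x := okProd_nonneg G _ _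
    show (1 - δ) * D * (rest x - ψ x * rest x) ≤ rest x * f x
    simp only [hψ]
    split_ifs with hlt
    · have : okProd G (edgesIn B N k) x * rest x = rest x := by
        rw [hrest, okProd_mul, Finset.union_eq_right.2 (edgesIn_mono hNX le_rfl)]
      rw [this, sub_self, mul_zero]
      exact mul_nonneg hr0 (hf0 x)
    · rw [zero_mul, sub_zero, mul_comm]
      exact mul_le_mul_of_nonneg_left (by linarith) hr0
  have hbad : (mapExpect μ fun x => ψ x * rest x) ≤ δ * prob μ G B (X.erase u) := by
    have hτ := h.tau_pos k ⟨hk, le_rfl⟩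
    refine (h.expect_mul_okProd_le hk hNX ((Nat.mul_le_mul_right _ hNcard).trans hn') (by omega)
      ψ hψ01 hψdep (by positivity) hψE hext).trans ?_
    exact mul_le_mul_of_nonneg_right hnum (prob_nonneg μ G _)
  have hp := prob_nonneg μ G (B := B) (X.erase u)
  rw [dens_edgesIn_sdiff_erase μ G hu]
  refine le_trans ?_ hlow
  calc (1 - 2 * δ) * D * prob μ G B (X.erase u)
      ≤ (1 - δ) * (1 - δ) * (D * prob μ G B (X.erase u)) := by
        rw [mul_assoc]
        exact mul_le_mul_of_nonneg_right (by nlinarith) (by positivity)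
    _ = (1 - δ) * D * (prob μ G B (X.erase u) - δ * prob μ G B (X.erase u)) := by ring
    _ ≤ _ := by
        refine mul_le_mul_of_nonneg_left (by linarith) (mul_nonneg (by linarith) hD0.le)

/-- If all degrees are at most one, then a vertex and its neighbor form a component. -/
lemma prob_ge_of_degree_le_one (hk : 1 ≤ k) (hu : u ∈ X) (hn : 1 ≤ n) (hΔ : Δ = 1)
    (hτδ : τ k ^ 8 ≤ δ) :
    (1 - 2 * δ) * dens μ G (edgesIn B X k \ edgesIn B (X.erase u) k) * prob μ G B (X.erase u)
      ≤ prob μ G B X := by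
  have hw := isWeight_mapWeight μ (W := W)
  set N := nbrs B {u} X with hN
  have hNu : Disjoint N {u} := disjoint_nbrs.symm
  have hNX : N ⊆ X.erase u := nbrs_subset_erase
  have hNX' : N ∪ {u} ⊆ X := Finset.union_subset (hNX.trans (Finset.erase_subset _ _))
    (Finset.singleton_subset_iff.2 hu)
  have hNcard : N.card ≤ 1 := by simpa [hΔ] using card_nbrs_le (T := {u}) (X := X) h.degree_le
  have hXN : X.erase u \ N = X \ (N ∪ {u}) := by
    ext a; simp only [Finset.mem_sdiff, Finset.mem_erase, Finset.mem_union, Finset.mem_singleton]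
    tauto
  -- A neighbor of u already has u as its only neighbor, so no edge leaves N ∪ {u}. The embedding
  -- probabilities therefore factor exactly, and only the counts of N and of N ∪ {u} are needed.
  have hcomp : ∀ e : B.VisibleEdge, e.verts ⊆ X → ∀ a ∈ e.verts, a ∈ N ∪ {u} →
      e.verts ⊆ N ∪ {u} := by
    intro e heX a ha haU
    rcases Finset.mem_union.1 haU with haN | hau
    · intro b hb
      by_contra hbU
      simp only [Finset.mem_union, Finset.mem_singleton, not_or] at hbU
      obtain ⟨haX, u', hu', e', hue', hae'⟩ := Finset.mem_filter.1 haN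
      rw [Finset.mem_singleton] at hu'
      subst hu'
      have hua : u' ≠ a := fun h => (Finset.mem_sdiff.1 haX).2 (by simp [h])
      have hba : b ≠ a := fun h => hbU.1 (h ▸ haN)
      have hsub : ({u', b} : Finset (Vert W)) ⊆
          Finset.univ.filter fun b => b ≠ a ∧ Adj B a b := by
        intro c hc
        rcases Finset.mem_insert.1 hc with rfl | hc
        · exact Finset.mem_filter.2 ⟨Finset.mem_univ _, hua, e', hae', hue'⟩
        · rw [Finset.mem_singleton.1 hc]
          exact Finset.mem_filter.2 ⟨Finset.mem_univ _, hba, e, ha, hb⟩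
      have h1 := (Finset.card_le_card hsub).trans ((card_adj_le a).trans (h.degree_le a))
      rw [Finset.card_pair (Ne.symm hbU.2)] at h1
      omega
    · rw [Finset.union_comm]
      exact verts_subset_union_nbrs heX ha hau
  have hsplit : ∀ Y Z : Finset (Vert W), Y ⊆ N ∪ {u} → Z ⊆ X \ (N ∪ {u}) →
      prob μ G B (Y ∪ Z) = prob μ G B Y * prob μ G B Z := by
    intro Y Z hY hZ
    have hd : Disjoint Y Z := Finset.disjoint_of_subset_left hY
      (Finset.disjoint_of_subset_right hZ Finset.disjoint_sdiff)
    have hcr : crossing B Y Z k = ∅ := by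
      ext e
      simp only [mem_crossing, Finset.notMem_empty, iff_false]
      rintro ⟨⟨h1, -⟩, h2, h3⟩
      obtain ⟨a, ha, haZ⟩ := Finset.not_subset.1 h3
      have haY := (Finset.mem_union.1 (h1 ha)).resolve_right haZ
      have heX : e.verts ⊆ X := h1.trans (Finset.union_subset (hY.trans hNX')
        (hZ.trans Finset.sdiff_subset))
      have h4 := hcomp e heX a ha (hY haY)
      refine h2 fun b hb => (Finset.mem_union.1 (h1 hb)).resolve_right fun hbZ => ?_
      exact (Finset.mem_sdiff.1 (hZ hbZ)).2 (h4 hb)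
    unfold prob
    rw [← mapExpect_mul_of_dependsOn μ (T := Y)
      (fun φ φ' hφ => okProd_edgesIn_congr G fun a ha => hφ a (Finset.mem_coe.2 ha))
      (fun φ φ' hφ => okProd_edgesIn_congr G fun a ha => hφ a
        fun haY => Finset.disjoint_left.1 hd (Finset.mem_coe.1 haY) ha)]
    congr 1; ext φ
    rw [okProd_edgesIn_union G hd, hcr]
    exact mul_one _
  have hX : prob μ G B X = prob μ G B (N ∪ {u}) * prob μ G B (X \ (N ∪ {u})) := by
    rw [← hsplit _ _ subset_rfl subset_rfl, Finset.union_sdiff_of_subset hNX']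
  have hXe : prob μ G B (X.erase u) = prob μ G B N * prob μ G B (X \ (N ∪ {u})) := by
    rw [← hsplit _ _ Finset.subset_union_left subset_rfl, ← hXN,
      Finset.union_sdiff_of_subset hNX]
  have cb : ∀ s t : Finset Bool, s.card ≤ 1 → t.card ≤ 1 → _ := fun s t hs ht =>
    h.count N {u} s t k k hNu (by rw [Finset.card_singleton]; nlinarith) hk le_rfl le_rfl
  have c10 := (abs_le.1 (cb {false} ∅ (by simp) (by simp))).2
  have c11 := (abs_le.1 (cb {false} {false} (by simp) (by simp))).1
  rw [copyExpect_one_zero] at c10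
  rw [copyExpect_one_one] at c11
  simp only [Finset.card_singleton, Finset.card_empty,
    pow_one, pow_zero, mul_one, mul_zero] at c10 c11
  have hNU : prob μ G B (N ∪ {u}) = mapExpect μ fun x => mapExpect μ fun y =>
      okProd G (edgesIn B N k) x *
      (okProd G (edgesIn B {u} k) y * okProd G (crossing B N {u} k) (mix N x y)) := by
    unfold prob
    rw [mapExpect_mix μ N]
    congr 1; ext x; congr 1; ext y
    rw [okProd_edgesIn_union G hNu, okProd_mix_left, okProd_mix_right hNu, mul_assoc]
  rw [← hNU] at c11
  change prob μ G B N - _ ≤ _ at c10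
  rw [dens_edgesIn_sdiff_erase μ G hu, hX, hXe]
  have hA0 := h.dens_pos (edgesIn B N k)
  have hD0 := h.dens_pos (edgesIn B {u} k)
  have hC0 := h.dens_pos (crossing B N {u} k)
  have hτ := h.tau_pos k ⟨hk, le_rfl⟩
  have hτ8 : 0 < τ k ^ 8 := by positivity
  have hp0 := prob_nonneg μ G (B := B) (X \ (N ∪ {u}))
  have hN0 := prob_nonneg μ G (B := B) N
  rw [← mul_assoc]
  refine mul_le_mul_of_nonneg_right ?_ hp0
  set A := dens μ G (edgesIn B N k)
  set D := dens μ G (edgesIn B {u} k)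
  set E := dens μ G (crossing B N {u} k)
  have hDE : 0 < D * E := by positivity
  -- The upper bound for the probability on N can be multiplied by 1 - 2 * δ only if this factor is
  -- nonnegative; otherwise the claim is trivial.
  by_cases hneg : 1 - 2 * δ ≤ 0
  · refine le_trans ?_ (prob_nonneg μ G _)
    exact mul_nonpos_of_nonpos_of_nonneg
      (mul_nonpos_of_nonpos_of_nonneg hneg hDE.le) hN0
  · have h1 : (1 - 2 * δ) * prob μ G B N ≤ (1 - 2 * δ) * ((1 + τ k ^ 8) * A) :=
      mul_le_mul_of_nonneg_left (by linarith) (by linarith)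
    have h2 : (1 - 2 * δ) * ((1 + τ k ^ 8) * A) ≤ (1 - τ k ^ 8) * A := by
      rw [← mul_assoc]
      refine mul_le_mul_of_nonneg_right ?_ hA0.le
      nlinarith
    have h3 := mul_le_mul_of_nonneg_right (h1.trans h2) hDE.le
    linarith

/-- The lower bound for the extension of embeddings to one more vertex. -/
theorem prob_ge (hk : 1 ≤ k) (hn : 1 ≤ n)
    (hsize : Δ = 1 ∨ (Δ + 1 ≤ n ∧ Δ * (Δ + 1) ^ (k - 1) ≤ n)) (hδ : 0 < δ) (hδ1 : δ ≤ 1 / 4)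
    (hτδ : τ k ^ 8 ≤ δ)
    (hnum : (4 * τ k ^ 8 / δ ^ 2 + errBound n M ρ τ (k - 1)) * (2 ^ n * (ρ k ^ M)⁻¹) ≤ δ)
    (X : Finset (Vert W)) :
    ∀ u ∈ X, (1 - 2 * δ) * dens μ G (edgesIn B X k \ edgesIn B (X.erase u) k)
      * prob μ G B (X.erase u) ≤ prob μ G B X := by
  induction X using Finset.strongInduction with
  | H X ih =>
    intro u hu
    -- The case Δ = 1 is separate because then n = Δ ^ (2 * k) = 1 in the application, too small for
    -- u together with a neighbor.
    rcases hsize with hΔ | ⟨h1, h2⟩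
    · exact h.prob_ge_of_degree_le_one hk hu hn hΔ hτδ
    · refine h.prob_ge_of_card_le hk hu h1 h2 hδ (by linarith) hnum fun Y hY a ha => ?_
      refine le_trans ?_ (ih Y (lt_of_le_of_lt hY (Finset.erase_ssubset hu)) a ha)
      refine mul_le_mul_of_nonneg_right (mul_le_mul_of_nonneg_right (by linarith)
        (dens_nonneg μ G _)) (prob_nonneg μ G _)

end Regular

end Lower

/-! ### The choice of the constants. -/

section Constants

variable {k n M : ℕ} {ρ τ : ℕ → ℝ} {c : ℝ}

/-- The basic small quantity attached to the size `j`. -/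
def smallness (k M : ℕ) (c : ℝ) (j : ℕ) (t : ℝ) : ℝ := (c * t) ^ (4 ^ (k - j) * (M + 3))

lemma smallness_pos (hc : 0 < c) {t : ℝ} (ht : 0 < t) (j : ℕ) : 0 < smallness k M c j t := by
  unfold smallness; positivity

lemma smallness_le (hc : 0 < c) (hc1 : c ≤ 1) {t : ℝ} (ht : 0 < t) (ht1 : t ≤ 1) (j : ℕ) :
    smallness k M c j t ≤ c * t := by
  have h1 : c * t ≤ 1 := mul_le_one₀ hc1 ht.le ht1
  exact pow_le_of_le_one (by positivity) h1 (by positivity)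

lemma smallness_mono (hc : 0 < c) (hc1 : c ≤ 1) {s t : ℝ} (hs : 0 < s) (hst : s ≤ t) (ht1 : t ≤ 1)
    {i j : ℕ} (hij : i ≤ j) : smallness k M c i s ≤ smallness k M c j t := by
  have h1 : c * s ≤ 1 := mul_le_one₀ hc1 hs.le (hst.trans ht1)
  calc (c * s) ^ (4 ^ (k - i) * (M + 3)) ≤ (c * s) ^ (4 ^ (k - j) * (M + 3)) := by
        refine pow_le_pow_of_le_one (by positivity) h1 (Nat.mul_le_mul_right _ ?_)
        exact Nat.pow_le_pow_right (by norm_num) (by omega)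
    _ ≤ (c * t) ^ (4 ^ (k - j) * (M + 3)) := by
        refine pow_le_pow_left₀ (by positivity) ?_ _
        exact mul_le_mul_of_nonneg_left hst hc.le

/-- The exponent of `smallness` exceeds M, so a single factor absorbs the loss ρ ^ (-M) of one
transfer step. -/
lemma smallness_mul_inv_le (hc : 0 < c) (hc1 : c ≤ 1) {t : ℝ} (ht : 0 < t) (ht1 : t ≤ 1) (j : ℕ) :
    smallness k M c j t * (t ^ M)⁻¹ ≤ c := by
  have h1 : c * t ≤ 1 := mul_le_one₀ hc1 ht.le ht1
  have h2 : smallness k M c j t ≤ (c * t) ^ (M + 1) := by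
    refine pow_le_pow_of_le_one (by positivity) h1 ?_
    have : 1 ≤ 4 ^ (k - j) := Nat.one_le_pow _ _ (by norm_num)
    nlinarith
  calc smallness k M c j t * (t ^ M)⁻¹ ≤ (c * t) ^ (M + 1) * (t ^ M)⁻¹ :=
        mul_le_mul_of_nonneg_right h2 (by positivity)
    _ = c ^ M * t * c := by
        rw [mul_pow, pow_succ t, pow_succ c]
        field_simp
    _ ≤ 1 * c := by
        refine mul_le_mul_of_nonneg_right ?_ hc.le
        exact mul_le_one₀ (pow_le_one₀ hc.le hc1) ht.le ht1
    _ = c := one_mul c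

/-- The purpose of the exponent 4 ^ (k - j): of the four factors gained per size, one pays for ρ ^
(-M) and three remain. -/
lemma smallness_succ {j : ℕ} (hj : j + 1 ≤ k) (t : ℝ) :
    smallness k M c j t = smallness k M c (j + 1) t ^ 4 := by
  unfold smallness
  rw [← pow_mul]
  congr 1
  rw [show k - j = (k - (j + 1)) + 1 by omega, pow_succ]
  ring

/-- The errors accumulated up to size `j` are negligible at size `j + 1`. -/
lemma errBound_le (hc : 0 < c) (hc1 : c ≤ 1) (hcQ : 2 ^ n * (28 * M + 1) * c ≤ 1)
    (hρ : ∀ i ∈ Set.Icc 1 k, 0 < ρ i) (hρ1 : ∀ i ∈ Set.Icc 1 k, ρ i ≤ 1)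
    (hmono : MonotoneOn ρ (Set.Icc 1 k)) (j : ℕ) (hj : j + 1 ≤ k) :
    errBound n M ρ (fun i => 2 * M * smallness k M c i (ρ i)) j
      ≤ smallness k M c (j + 1) (ρ (j + 1)) ^ 3 := by
  induction j with
  | zero =>
    have := smallness_pos (k := k) (M := M) hc (hρ 1 ⟨le_rfl, hj⟩) 1
    unfold errBound
    positivity
  | succ j ih =>
    have hm : j + 1 ∈ Set.Icc 1 k := ⟨by omega, by omega⟩
    have hm' : j + 1 + 1 ∈ Set.Icc 1 k := ⟨by omega, by omega⟩
    have hr := hρ _ hm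
    have hr1 := hρ1 _ hm
    have ih := ih (by omega)
    unfold errBound
    set s := smallness k M c (j + 1) (ρ (j + 1)) with hs
    set z := smallness k M c (j + 1 + 1) (ρ (j + 1)) with hz
    have hs0 : 0 < s := smallness_pos hc hr _
    have hz0 : 0 < z := smallness_pos hc hr _
    have hs1 : s ≤ 1 := (smallness_le hc hc1 hr hr1 _).trans (mul_le_one₀ hc1 hr.le hr1)
    have hsz : s = z ^ 4 := smallness_succ (by omega) _
    have hle : z ≤ smallness k M c (j + 1 + 1) (ρ (j + 1 + 1)) :=
      smallness_mono hc hc1 hr (hmono hm hm' (by omega)) (hρ1 _ hm') le_rfl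
    have hinv : z * (ρ (j + 1) ^ M)⁻¹ ≤ c := smallness_mul_inv_le hc hc1 hr hr1 _
    have hI : 1 ≤ (ρ (j + 1) ^ M)⁻¹ := (one_le_inv₀ (by positivity)).2 (pow_le_one₀ hr.le hr1)
    have hK : (1 : ℝ) ≤ 2 ^ n := one_le_pow₀ (by norm_num)
    set I := (ρ (j + 1) ^ M)⁻¹
    have hKI : (1 : ℝ) ≤ 2 ^ n * I := by nlinarith
    have h3 : s ^ 3 ≤ s := pow_le_of_le_one hs0.le hs1 (by norm_num)
    -- The constant is 28 * M + 1: the terms in τ contribute 2 * M + 26 * M, and the inductive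
    -- error, at most s ^ 3 ≤ s, contributes 1.
    calc 2 * M * s + 2 ^ n * I * (13 * (2 * M * s) + errBound n M ρ _ j)
        ≤ (2 ^ n * I) * (2 * M * s) + 2 ^ n * I * (13 * (2 * M * s) + s) := by
          refine add_le_add (le_mul_of_one_le_left (by positivity) hKI) ?_
          exact mul_le_mul_of_nonneg_left (by linarith) (by positivity)
      _ = 2 ^ n * (28 * M + 1) * (z * I) * z ^ 3 := by rw [hsz]; ring
      _ ≤ 2 ^ n * (28 * M + 1) * c * z ^ 3 := by gcongr
      _ ≤ 1 * z ^ 3 := mul_le_mul_of_nonneg_right hcQ (by positivity)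
      _ ≤ smallness k M c (j + 1 + 1) (ρ (j + 1 + 1)) ^ 3 := by
          rw [one_mul]; exact pow_le_pow_left₀ hz0.le hle 3

end Constants

/-! ### From the conditional expectation to quotients of embedding probabilities. -/

section Translation
open scoped Classical
open ColoredComplex ColoredComplex.VisibleEdge

variable {ι : Type u} [Fintype ι] {k : ℕ} {C : Idx ι k → Type x} {W : ι → Type w}
  [∀ i, Fintype (W i)] {B : ColoredComplex k C W}
  {Ω : ι → Type v} [∀ i, Fintype (Ω i)]
  [∀ i, MeasurableSpace (Ω i)] [∀ i, DiscreteMeasurableSpace (Ω i)]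
  (μ : (i : ι) → Measure (Ω i)) [∀ i, IsProbabilityMeasure (μ i)]
  (G : ColoredGraph k C Ω) (a : Vert W)

lemma edgesAt_eq : B.edgesAt a
    = edgesIn B Finset.univ k \ edgesIn B (Finset.univ.erase a) k := by
  ext e
  simp only [edgesAt, Finset.mem_filter, Finset.mem_univ, true_and, Finset.mem_sdiff, mem_edgesIn,
    Finset.subset_univ, e.size_le, and_true, mem_iff_mem_verts]
  constructor
  · exact fun h h' => Finset.notMem_erase a _ (h' h)
  · intro h
    by_contra ha
    exact h fun b hb => Finset.mem_erase.2 ⟨fun hba => ha (hba ▸ hb), Finset.mem_univ _⟩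

lemma extend_of_ne (φ : PartMap (fun i => {b : W i // (⟨i, b⟩ : Vert W) ≠ a}) Ω) (z : Ω a.1)
    {i : ι} {b : W i} (h : (⟨i, b⟩ : Vert W) ≠ a) : φ.extend z ⟨i, b⟩ = φ ⟨i, b, h⟩ := dif_neg h

lemma extend_eq_glue (φ : PartMap (fun i => {b : W i // (⟨i, b⟩ : Vert W) ≠ a}) Ω)
    (y : PartMap W Ω) : φ.extend (y a)
      = glue (Finset.univ.erase a) (fun b hb => ⟨b.2, (Finset.mem_erase.1 hb).1⟩) φ y := by
  funext b
  by_cases h : b = a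
  · subst h
    simp [PartMap.extend, glue]
  · rw [glue, dif_pos (Finset.mem_erase.2 ⟨h, Finset.mem_univ b⟩), PartMap.extend, dif_neg h]

/-- The edges of B ∖ a are exactly the edges of B that avoid a, and on those the value `y a` plays
no role. -/
lemma delete_embeds_iff (φ : PartMap (fun i => {b : W i // (⟨i, b⟩ : Vert W) ≠ a}) Ω)
    (y : PartMap W Ω) : okProd G (edgesIn B (Finset.univ.erase a) k) (φ.extend (y a))
      = if (B.delete a).Embeds G φ then 1 else 0 := by
  have hiff : (∀ e ∈ edgesIn B (Finset.univ.erase a) k, B.color e.1.1 e.1.2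
      = some (G.color e.1.1 ((φ.extend (y a)).mapEdge e.1.2))) ↔ (B.delete a).Embeds G φ := ?_
  · unfold okProd ok
    rw [Finset.prod_boole]
    by_cases hE : (B.delete a).Embeds G φ
    · rw [if_pos hE, if_pos (hiff.2 hE)]
    · rw [if_neg hE, if_neg fun h => hE (hiff.1 h)]
  constructor
  · intro h I e c hc
    have h1 := h ⟨⟨I, fun i => (e i).1⟩, by
      rw [show B.color I (fun i => (e i).1) = some c from hc]; rfl⟩ (mem_edgesIn.2 ⟨?_, ?_⟩)
    · have h2 : some c = some (G.color I ((φ.extend (y a)).mapEdge fun i => (e i).1)) :=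
        (show B.color I (fun i => (e i).1) = some c from hc).symm.trans h1
      rw [Option.some.inj h2]
      congr 1
      funext i
      exact (extend_of_ne a φ _ (e i).2).symm
    · intro b hb
      obtain ⟨i, rfl⟩ := mem_verts.1 hb
      exact Finset.mem_erase.2 ⟨(e i).2, Finset.mem_univ _⟩
    · exact size_le _
  · intro h e he
    have hne : ∀ i : e.1.1.1, (⟨i.1, e.1.2 i⟩ : Vert W) ≠ a := fun i =>
      (Finset.mem_erase.1 ((mem_edgesIn.1 he).1 (mk_mem_verts e i))).1
    obtain ⟨c, hc⟩ := Option.isSome_iff_exists.1 e.2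
    have h1 := h e.1.1 (fun i => ⟨e.1.2 i, hne i⟩) c hc
    rw [hc, ← h1]
    congr 2
    funext i
    exact (extend_of_ne a φ _ (hne i)).symm

lemma prob_eq_glue (f : PartMap W Ω → ℝ) :
    mapExpect μ f = mapExpect μ fun φ : PartMap (fun i => {b : W i // (⟨i, b⟩ : Vert W) ≠ a}) Ω =>
      mapExpect μ fun y => f (φ.extend (y a)) := by
  rw [mapExpect_glue μ (Finset.univ.erase a) (W := fun i => {b : W i // (⟨i, b⟩ : Vert W) ≠ a})
    (fun b hb => ⟨b.2, (Finset.mem_erase.1 hb).1⟩)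
    (fun b b' hb hb' h => by
      obtain ⟨i, b⟩ := b
      obtain ⟨i', b'⟩ := b'
      simp only [Sigma.mk.injEq] at h
      obtain ⟨rfl, h⟩ := h
      obtain rfl : b = b' := congrArg Subtype.val (eq_of_heq h)
      rfl)]
  simp only [extend_eq_glue]

lemma prob_erase_eq : prob μ G B (Finset.univ.erase a)
    = (randomMap μ fun i => {b : W i // (⟨i, b⟩ : Vert W) ≠ a}).real
      {φ | (B.delete a).Embeds G φ} := by
  rw [prob, prob_eq_glue μ a]
  simp only [delete_embeds_iff, mapExpect, (isWeight_mapWeight μ (W := W)).expect_const]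
  rw [← mapExpect, ← integral_randomMap, ← integral_indicator_one (MeasurableSet.of_discrete)]
  congr 1

lemma prob_univ_eq : prob μ G B Finset.univ
    = mapExpect μ fun φ : PartMap (fun i => {b : W i // (⟨i, b⟩ : Vert W) ≠ a}) Ω =>
      (μ a.1).real {z | B.Embeds G (φ.extend z)} := by
  have huniv : edgesIn B Finset.univ k = Finset.univ := by
    ext e
    simp [mem_edgesIn, e.size_le]
  have hprob : prob μ G B Finset.univ = mapExpect μ fun φ => if B.Embeds G φ then 1 else 0 := by
    unfold prob
    rw [huniv]
    congr 1; ext φ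
    exact prod_ok G φ
  rw [hprob, prob_eq_glue μ a]
  congr 1; ext φ
  rw [← integral_randomMap]
  have hmp := measurePreserving_eval (fun b : Vert W => μ b.1) a
  rw [← hmp.measureReal_preimage (MeasurableSet.of_discrete.nullMeasurableSet),
    ← integral_indicator_one (MeasurableSet.of_discrete)]
  congr 1

/-- The conditional extension probability is a quotient of embedding probabilities. -/
lemma condExtendProb_mul_prob (hpos : 0 < prob μ G B (Finset.univ.erase a)) :
    condExtendProb μ B G a * prob μ G B (Finset.univ.erase a) = prob μ G B Finset.univ := by
  rw [prob_erase_eq] at hpos ⊢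
  unfold condExtendProb ProbabilityTheory.cond
  rw [integral_smul_measure, prob_univ_eq μ G a, ← integral_randomMap,
    ← integral_indicator (MeasurableSet.of_discrete), ENNReal.toReal_inv, smul_eq_mul]
  rw [mul_comm, ← mul_assoc]
  change _ * (Measure.real _ _)⁻¹ * _ = _
  rw [mul_inv_cancel₀ hpos.ne', one_mul]
  congr 1; ext φ
  rw [Set.indicator_apply]
  split_ifs with hφ
  · rfl
  · symm
    -- Outside the conditioning event no extension embeds B, so the restriction of the integral to
    -- that event loses nothing.
    have : {z | B.Embeds G (φ.extend z)} = ∅ := by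
      ext z
      simp only [Set.mem_ofPred_eq, Set.mem_empty_iff_false, iff_false]
      intro hz
      refine hφ fun I e c hc => ?_
      rw [← hz I (fun i => (e i).1) c hc]
      congr 1
      funext i
      exact (extend_of_ne a φ _ (e i).2).symm
    rw [this, measureReal_empty]

end Translation

/-! ### Assembly for explicit constants. -/

section Assembly
open scoped Classical
open ColoredComplex ColoredComplex.VisibleEdge

variable {ι : Type u} [Fintype ι] {k : ℕ} {C : Idx ι k → Type x} {W : ι → Type w}
  [∀ i, Fintype (W i)] {B : ColoredComplex k C W}
  {Ω : ι → Type v} [∀ i, Fintype (Ω i)]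
  [∀ i, MeasurableSpace (Ω i)] [∀ i, DiscreteMeasurableSpace (Ω i)]
  {μ : (i : ι) → Measure (Ω i)} [∀ i, IsProbabilityMeasure (μ i)] {G : ColoredGraph k C Ω}
  {Δ n M : ℕ} {ρ : ℕ → ℝ} {c : ℝ}

/-- A product of at most M densities, each with relative error s ^ 8, has relative error at most 2 *
M * s ^ 8 ≤ (2 * M * s) ^ 8, whence τ = 2 * M * s. Monotonicity of `smallness` lets the error at
size j dominate those at smaller sizes. -/
lemma regular_of_countsBlowups {V : ι → Type y} {S : ColoredComplex k C V}
    (hk : 1 ≤ k) (hΔ : 1 ≤ Δ) (hM : 2 ^ ((Δ + 1) * n) ≤ M) (hc : 0 < c) (hcM : 2 * M * c ≤ 1)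
    (hρ1 : 0 < ρ 1) (hmono : MonotoneOn ρ (Set.Icc 1 k)) (hρk : ρ k < 1)
    (hcount : CountsBlowups.{u, v, w, x, y} μ S G (2 * Δ) (2 * n)
      fun i => smallness k M c i (ρ i) ^ 8)
    (hS : ∀ e : S.VisibleEdge, ρ e.size < e.density G μ) (hB : B.IsBlowup Δ S) :
    Regular B μ G Δ n M ρ fun i => 2 * M * smallness k M c i (ρ i) := by
  have hpos : ∀ i ∈ Set.Icc 1 k, 0 < ρ i := fun i hi =>
    hρ1.trans_le (hmono ⟨le_rfl, hk⟩ hi hi.1)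
  have hle : ∀ i ∈ Set.Icc 1 k, ρ i ≤ 1 := fun i hi =>
    (hmono hi ⟨hk, le_rfl⟩ hi.2).trans hρk.le
  have hM1 : 1 ≤ M := Nat.one_le_two_pow.trans hM
  have hM1' : (1 : ℝ) ≤ M := by exact_mod_cast hM1
  have hc1 : c ≤ 1 := by nlinarith
  have hsc : ∀ i ∈ Set.Icc 1 k, smallness k M c i (ρ i) ≤ c := fun i hi =>
    (smallness_le hc hc1 (hpos i hi) (hle i hi) i).trans
      (mul_le_of_le_one_right hc.le (hle i hi))
  refine ⟨?_, ?_, hB.1, hpos, hmono, hle, ?_, ?_, hM⟩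
  · intro T R s t i j hTR hcard hj hjk hij
    have hm : j ∈ Set.Icc 1 k := ⟨hj, hjk⟩
    have hs0 := smallness_pos (k := k) (M := M) hc (hpos j hm) j
    have hs1 := hsc j hm
    have h8 : smallness k M c j (ρ j) ^ 8 ≤ smallness k M c j (ρ j) :=
      pow_le_of_le_one hs0.le (hs1.trans hc1) (by norm_num)
    refine (abs_copyExpect_sub_le μ G hcount hB hTR hcard
      ((Nat.pow_le_pow_right (by norm_num) (Nat.mul_le_mul_right n (by omega))).trans hM)
      (θ := smallness k M c j (ρ j) ^ 8) (by positivity) (h8.trans (hs1.trans hc1))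
      (by nlinarith) ?_).trans ?_
    · intro i' hi'
      have hm' : i' ∈ Set.Icc 1 k := ⟨hi'.1, hi'.2.trans (hij.trans hjk)⟩
      refine pow_le_pow_left₀ (smallness_pos hc (hpos i' hm') i').le ?_ 8
      exact smallness_mono hc hc1 (hpos i' hm') (hmono hm' hm (hi'.2.trans hij)) (hle j hm)
        (hi'.2.trans hij)
    · refine mul_le_mul_of_nonneg_right ?_ (mul_nonneg (mul_nonneg
        (pow_nonneg (dens_nonneg μ G _) _) (pow_nonneg (dens_nonneg μ G _) _))
        (pow_nonneg (dens_nonneg μ G _) _))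
      rw [mul_pow]
      refine mul_le_mul_of_nonneg_right ?_ (by positivity)
      exact le_self_pow₀ (by linarith) (by norm_num)
  · obtain ⟨φ, hφ⟩ := hB.2
    exact lt_density_of_embedsComplex μ G hS hφ
  · intro i hi
    have := smallness_pos (k := k) (M := M) hc (hpos i hi) i
    positivity
  · intro i hi
    have := hsc i hi
    nlinarith

/-- The extension probability of a vertex in a blowup, for explicit constants. -/
lemma condExtendProb_ge {V : ι → Type y} {S : ColoredComplex k C V}
    (hk : 1 ≤ k) (hΔ : 1 ≤ Δ) (hM : 2 ^ ((Δ + 1) * Δ ^ (2 * k)) ≤ M) (hc : 0 < c)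
    (hcQ : 2 ^ (Δ ^ (2 * k)) * (2 * (16 * (2 * M) ^ 8 + 1)) * c ≤ 1)
    (hρ1 : 0 < ρ 1) (hmono : MonotoneOn ρ (Set.Icc 1 k)) (hρk : ρ k < 1)
    (hcount : CountsBlowups.{u, v, w, x, y} μ S G (2 * Δ) (2 * Δ ^ (2 * k))
      fun i => smallness k M c i (ρ i) ^ 8)
    (hS : ∀ e : S.VisibleEdge, ρ e.size < e.density G μ) (hB : B.IsBlowup Δ S) (a : Vert W) :
    (1 - smallness k M c k (ρ k) ^ 2) * ∏ e ∈ B.edgesAt a, e.density G μ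
      ≤ condExtendProb μ B G a := by
  have hpos : ∀ i ∈ Set.Icc 1 k, 0 < ρ i := fun i hi =>
    hρ1.trans_le (hmono ⟨le_rfl, hk⟩ hi hi.1)
  have hle : ∀ i ∈ Set.Icc 1 k, ρ i ≤ 1 := fun i hi =>
    (hmono hi ⟨hk, le_rfl⟩ hi.2).trans hρk.le
  have hM1 : 1 ≤ M := Nat.one_le_two_pow.trans hM
  have hM1' : (1 : ℝ) ≤ M := by exact_mod_cast hM1
  set n := Δ ^ (2 * k) with hn
  have hn1 : 1 ≤ n := Nat.one_le_pow _ _ hΔ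
  have hK : (1 : ℝ) ≤ 2 ^ n := one_le_pow₀ (by norm_num)
  have hQ : (2 * M : ℝ) ≤ (2 * M) ^ 8 := le_self_pow₀ (by linarith) (by norm_num)
  have hQc : 2 * (16 * (2 * (M : ℝ)) ^ 8 + 1) * c ≤ 1 := by
    refine le_trans ?_ hcQ
    rw [mul_assoc (2 ^ n : ℝ)]
    exact le_mul_of_one_le_left (by positivity) hK
  have hcM : 2 * M * c ≤ 1 := by nlinarith
  have hc1 : c ≤ 1 := by nlinarith
  have hreg := regular_of_countsBlowups hk hΔ hM hc hcM hρ1 hmono hρk hcount hS hB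
  set z := smallness k M c k (ρ k) with hz
  have hz0 : 0 < z := smallness_pos hc (hpos k ⟨hk, le_rfl⟩) k
  have hzc : z ≤ c := (smallness_le hc hc1 (hpos k ⟨hk, le_rfl⟩) hρk.le k).trans
    (mul_le_of_le_one_right hc.le hρk.le)
  have hinv : z * (ρ k ^ M)⁻¹ ≤ c :=
    smallness_mul_inv_le hc hc1 (hpos k ⟨hk, le_rfl⟩) hρk.le k
  have herr : errBound n M ρ (fun i => 2 * M * smallness k M c i (ρ i)) (k - 1) ≤ z ^ 3 := by
    have := errBound_le (n := n) hc hc1 (by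
      refine le_trans ?_ hcQ
      refine mul_le_mul_of_nonneg_right (mul_le_mul_of_nonneg_left ?_ (by positivity)) hc.le
      linarith) hpos hle hmono (k - 1) (by omega)
    rwa [show k - 1 + 1 = k by omega] at this
  have hc2 : c ≤ 1 / 2 := by nlinarith
  have hI : 0 < (ρ k ^ M)⁻¹ := inv_pos.2 (pow_pos (hpos k ⟨hk, le_rfl⟩) M)
  have hz1 : z ≤ 1 := hzc.trans hc1
  -- Here δ = z ^ 2 / 2, so that 2 * δ = z ^ 2 is the fourth root of η_k = z ^ 8. The left side is
  -- of order z ^ 3 * ρ ^ (-M), and the spare factor z absorbs ρ ^ (-M).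
  have hnum : (4 * (2 * M * z) ^ 8 / (z ^ 2 / 2) ^ 2
      + errBound n M ρ (fun i => 2 * M * smallness k M c i (ρ i)) (k - 1))
      * (2 ^ n * (ρ k ^ M)⁻¹) ≤ z ^ 2 / 2 := by
    have e1 : 4 * (2 * M * z) ^ 8 / (z ^ 2 / 2) ^ 2 = 16 * (2 * (M : ℝ)) ^ 8 * (z * z ^ 3) := by
      field_simp
      ring
    have e2 : 16 * (2 * (M : ℝ)) ^ 8 * (z * z ^ 3) ≤ 16 * (2 * (M : ℝ)) ^ 8 * z ^ 3 := by
      refine mul_le_mul_of_nonneg_left ?_ (by positivity)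
      exact mul_le_of_le_one_left (by positivity) hz1
    rw [e1]
    calc _ ≤ (16 * (2 * (M : ℝ)) ^ 8 * z ^ 3 + z ^ 3) * (2 ^ n * (ρ k ^ M)⁻¹) :=
          mul_le_mul_of_nonneg_right (add_le_add e2 herr) (by positivity)
      _ = 2 ^ n * (2 * (16 * (2 * M) ^ 8 + 1)) * (z * (ρ k ^ M)⁻¹) * (z ^ 2 / 2) := by ring
      _ ≤ 2 ^ n * (2 * (16 * (2 * M) ^ 8 + 1)) * c * (z ^ 2 / 2) := by gcongr
      _ ≤ 1 * (z ^ 2 / 2) := mul_le_mul_of_nonneg_right hcQ (by positivity)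
      _ = _ := one_mul _
  -- For Δ ≥ 2 one has Δ + 1 ≤ Δ ^ 2; this is the source of the exponent 2 * k in the size bound.
  have hsize : Δ = 1 ∨ (Δ + 1 ≤ n ∧ Δ * (Δ + 1) ^ (k - 1) ≤ n) := by
    rcases hΔ.eq_or_lt with h | h
    · exact Or.inl h.symm
    · have h2 : Δ + 1 ≤ Δ ^ 2 := by nlinarith
      refine Or.inr ⟨h2.trans (Nat.pow_le_pow_right hΔ (by omega)), ?_⟩
      calc Δ * (Δ + 1) ^ (k - 1) ≤ Δ ^ 2 * (Δ ^ 2) ^ (k - 1) :=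
            Nat.mul_le_mul (by nlinarith) (Nat.pow_le_pow_left h2 _)
        _ = n := by
            rw [← pow_succ', ← pow_mul, hn]
            congr 2
            omega
  have hz2 : z ^ 2 ≤ 1 / 4 := by nlinarith
  have hδ : z ^ 2 / 2 ≤ 1 / 4 := by linarith
  have hτδ : (2 * M * z) ^ 8 ≤ z ^ 2 / 2 := by
    have h6 : z ^ 6 ≤ c := (pow_le_of_le_one hz0.le hz1 (by norm_num)).trans hzc
    calc (2 * M * z) ^ 8 = (2 * M) ^ 8 * z ^ 6 * z ^ 2 := by ring
      _ ≤ (2 * M) ^ 8 * c * z ^ 2 := by gcongr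
      _ ≤ 1 / 2 * z ^ 2 := by
          refine mul_le_mul_of_nonneg_right ?_ (by positivity)
          have : 0 ≤ (2 * (M : ℝ)) ^ 8 * c := by positivity
          nlinarith
      _ = _ := by ring
  have hge := hreg.prob_ge hk hn1 hsize (δ := z ^ 2 / 2) (by positivity) hδ hτδ hnum
  have hext : ∀ Y : Finset (Vert W), ∀ b ∈ Y, Extends μ G B Y b := fun Y b hb =>
    le_trans (mul_le_mul_of_nonneg_right (mul_le_mul_of_nonneg_right (by linarith)
      (dens_nonneg μ G _)) (prob_nonneg μ G _)) (hge Y b hb)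
  -- Removing all vertices one by one bounds this probability below by a power of 1 / 2 times
  -- positive densities, so the condition has positive probability.
  have hp : 0 < prob μ G B (Finset.univ.erase a) := by
    have h1 := prob_sdiff_le (Finset.univ.erase a) (Finset.univ.erase a) subset_rfl
      fun Y _ b hb => hext Y b hb
    rw [Finset.sdiff_self, prob_empty, mul_one] at h1
    exact lt_of_lt_of_le (mul_pos (by positivity) (hreg.dens_pos _)) h1
  have hfin := hge Finset.univ a (Finset.mem_univ a)
  rw [← condExtendProb_mul_prob μ G a hp, ← edgesAt_eq] at hfin
  have hfin' := le_of_mul_le_mul_right hfin hp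
  rwa [show 1 - 2 * (z ^ 2 / 2) = 1 - z ^ 2 by ring] at hfin'

end Assembly

end BlowupCounting

theorem mainTheorem2 (k Δ : ℕ) (hk : 0 < k) (hΔ : 0 < Δ) (ε : ℝ) (hε : 0 < ε) (hε1 : ε ≤ 1) :
    ∃ η : ℕ → ℝ → ℝ,
      (∀ i ∈ Set.Icc 1 k, ∀ t ∈ Set.Ioo (0 : ℝ) 1, 0 < η i t ∧ η i t < ε) ∧
      ∀ ρ : ℕ → ℝ, 0 < ρ 1 → MonotoneOn ρ (Set.Icc 1 k) → ρ k < 1 →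
      ∀ (ι : Type u) [Fintype ι], k ≤ Fintype.card ι →
      ∀ h : ℕ, 0 < h →
      ∀ (Ω : ι → Type v) [∀ i, Fintype (Ω i)] [∀ i, MeasurableSpace (Ω i)]
        [∀ i, DiscreteMeasurableSpace (Ω i)]
        (μ : (i : ι) → Measure (Ω i)) [∀ i, IsProbabilityMeasure (μ i)]
        (C : Idx ι k → Type x) [∀ I, Fintype (C I)],
      (∀ I, (Fintype.card (C I) : ℝ) ≤ 1 / ρ I.size) →
      ∀ (G : ColoredGraph k C Ω)
        (V : ι → Type y) [∀ i, Fintype (V i)], (∀ i, Fintype.card (V i) = h) →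
      ∀ S : ColoredComplex k C V,
      (∀ (W : ι → Type w) [∀ i, Fintype (W i)] (S' : ColoredComplex k C W),
        S'.IsBlowup (2 * Δ) S → Fintype.card (Vert W) ≤ 2 * Δ ^ (2 * k) →
        ∃ t : S'.VisibleEdge → ℝ,
          (∀ e, max 0 ((1 - η e.size (ρ e.size)) * e.density G μ) ≤ t e ∧
            t e ≤ min 1 ((1 + η e.size (ρ e.size)) * e.density G μ)) ∧
          embedProb μ S' G = ∏ e, t e) →
      (∀ e : S.VisibleEdge, ρ e.size < e.density G μ) →
      ∀ (W : ι → Type w) [∀ i, Fintype (W i)] (B : ColoredComplex k C W), B.IsBlowup Δ S →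
      ∀ a : Vert W,
        (1 - η k (ρ k) ^ (1 / 4 : ℝ)) * ∏ e ∈ B.edgesAt a, e.density G μ
          ≤ condExtendProb μ B G a := by
  set M : ℕ := 2 ^ ((Δ + 1) * Δ ^ (2 * k)) with hM
  -- Q collects every constant to be absorbed, and c = ε / Q ensures both Q * c ≤ 1 and η < ε.
  set Q : ℝ := 2 ^ (Δ ^ (2 * k)) * (2 * (16 * (2 * M) ^ 8 + 1)) with hQ
  have hQ1 : 1 < Q := by
    have h1 : (1 : ℝ) ≤ 2 ^ (Δ ^ (2 * k)) := one_le_pow₀ (by norm_num)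
    have h2 : (0 : ℝ) ≤ (2 * M) ^ 8 := by positivity
    nlinarith
  have hQ0 : 0 < Q := by linarith
  set c : ℝ := ε / Q with hc
  have hc0 : 0 < c := by positivity
  have hcε : c < ε := div_lt_self hε hQ1
  have hcQ : Q * c ≤ 1 := by rw [hc, mul_div_cancel₀ _ hQ0.ne']; exact hε1
  refine ⟨fun i t => smallness k M c i t ^ 8, fun i _ t ht => ?_, ?_⟩
  · have h1 := smallness_pos (k := k) (M := M) hc0 ht.1 i
    have h2 : smallness k M c i t < ε :=
      ((smallness_le hc0 (by linarith) ht.1 ht.2.le i).trans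
        (mul_le_of_le_one_right hc0.le ht.2.le)).trans_lt hcε
    exact ⟨by positivity,
      (pow_le_of_le_one h1.le (by linarith) (by norm_num)).trans_lt h2⟩
  · intro ρ hρ1 hmono hρk ι _ _ h _ Ω _ _ _ μ _ C _ _ G V _ _ S hcount hS W _ B hB a
    have hρ : 0 < ρ k := hρ1.trans_le (hmono ⟨le_rfl, hk⟩ ⟨hk, le_rfl⟩ hk)
    have hz := smallness_pos (k := k) (M := M) hc0 hρ k
    have hpow : (smallness k M c k (ρ k) ^ 8) ^ (1 / 4 : ℝ) = smallness k M c k (ρ k) ^ 2 := by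
      rw [← Real.rpow_natCast, ← Real.rpow_mul hz.le, ← Real.rpow_natCast]
      norm_num
    show (1 - (smallness k M c k (ρ k) ^ 8) ^ (1 / 4 : ℝ)) * _ ≤ _
    rw [hpow]
    exact condExtendProb_ge hk hΔ le_rfl hc0 hcQ hρ1 hmono hρk hcount hS hB a
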